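/- **Conventions.** Let $\Bbbk$ be a field of characteristic $0$ (for instance a subfield of $\mathbb C$). All vertex algebras $V$ are over $\Bbbk$, with products $a(n)b$ $(n\in\mathbb Z)$, unit $\mathbb 1$ and $Da=a(-2)\mathbb 1$, and carry an $sl_2$ structure: $V=\bigoplus_{d\in\mathbb Z}V_d$ with $V_i(n)V_j\subseteq V_{i+j-n-1}$, $\mathbb 1\in V_0$, and there is a locally nilpotent operator $D^*:V\to V$ of degree $-1$ with $D^*\mathbb 1=0$ and $[D^*,a(m)]=(2d-m-2)\,a(m+1)+(D^*a)(m)$ for $a\in V_d$, $m\in\mathbb Z$. Homomorphisms preserve the products, the unit, the grading and $D^*$. Let $\Phi^l$ be the space of rational functions $p(z_1,\dots,z_l)\prod_{i<j}(z_i-z_j)^{k_{ij}}$ with $p\in\Bbbk[z_1,\dots,z_l]$, $k_{ij}\in\mathbb Z$, graded by $\deg z_i=1$; $\operatorname{ord}_{ij}$ is the order at $z_i-z_j$. For $\sigma\in\Sigma_l$ put $(\sigma\alpha)(z_1,\dots,z_l)=\alpha(z_{\sigma(1)},\dots,z_{\sigma(l)})$. Let $\mathcal G$ be a set with integers $\deg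 a$ $(a\in\mathcal G)$ and $\mathrm{loc}(a,b)$ $(a,b\in\mathcal G)$. Let $T(\mathcal G)$ be the set of all finite words $\mathbf a=a_1\otimes\cdots\otimes a_l$, $l\ge 0$, $a_i\in\mathcal G$, and put $\sigma\mathbf a=a_{\sigma(1)}\otimes\cdots\otimes a_{\sigma(l)}$. *Correlation functions.* Let $V$ be a vertex algebra with a map $\mathcal G\to V$, written $a\mapsto a$, such that $a\in V_{\deg a}$ and $D^*a=0$ for all $a\in\mathcal G$, and $V$ is generated by the image. For $\mathbf a\in T(\mathcal G)$ let $V^{\mathbf a}=\operatorname{span}\{a_1(n_1)\cdots a_l(n_l)\mathbb 1 : n_i\in\mathbb Z\}$, and let $\Omega(V)^{\mathbf a}\subset\Phi^l$ be the span, over all $d\in\mathbb Z$ and all linear functionals $f:V\to\Bbbk$ with $f(V_n)=0$ for $n\ne d$, of the functions $\alpha_f\in\Phi^l$ whose expansion in the domain $|z_1|>\cdots>|z_l|$ is $\sum_{m_1,\dots,m_l\in\mathbb Z} f\big(a_1(m_1)\cdots a_l(m_l)\mathbb 1\big)\,z_1^{-m_1-1}\cdots z_l^{-m_l-1}$. The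 vertex coalgebra of correlation functions of $V$ is $\Omega(V)=\bigoplus_{\mathbf a\in T(\mathcal G)}\Omega(V)^{\mathbf a}$. **Theorem.** Let $\Omega=\bigoplus_{\mathbf a\in T(\mathcal G)}\Omega^{\mathbf a}$, where each $\Omega^{\mathbf a}\subset\Phi^{l}$ ($l$ the length of $\mathbf a$) is a graded subspace, and suppose that for every $\mathbf a=a_1\otimes\cdots\otimes a_l\in T(\mathcal G)$: * ($\Omega$0) $\Omega^{1}=\Bbbk$ for the empty word, and $\Omega^{a}=\Bbbk[z]$ for every $a\in\mathcal G$; * ($\Omega$1) $\operatorname{ord}_{ij}\alpha\ge-\mathrm{loc}(a_i,a_j)$ for all $\alpha\in\Omega^{\mathbf a}$ and $i<j$; * ($\Omega$2) $\Omega^{\mathbf a}=\sigma\Omega^{\sigma\mathbf a}$ for all $\sigma\in\Sigma_l$, and every $\alpha\in\Omega^{\mathbf a}$ is invariant under all transpositions $(i\;j)$ with $a_i=a_j$; * ($\Omega$3) $\Omega^{\mathbf a}$ is closed under $\Delta=\sum_i\partial_{z_i}$ and $\Delta^*=\sum_i\big(z_i^2\partial_{z_i}+2(\deg a_i)z_i\big)$;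 * ($\Omega$4) if $l\ge1$ and $\alpha\in\Omega^{\mathbf a}$, then in the expansion $\alpha=\sum_{n\ge n_0}z_1^{-n-1}\alpha_n(z_2,\dots,z_l)$ at $z_1=\infty$ all $\alpha_n$ lie in $\Omega^{a_2\otimes\cdots\otimes a_l}$. Then there are a vertex algebra $V=V(\Omega)$ and an embedding $\mathcal G\subset V$ such that $a\in V_{\deg a}$ and $D^*a=0$ for all $a\in\mathcal G$, $V$ is generated by $\mathcal G$, and: 1. $\Omega(V)^{\mathbf a}=\Omega^{\mathbf a}$ for every $\mathbf a\in T(\mathcal G)$, i.e. $\Omega(V)=\Omega$; 2. $V=\bigoplus_{\lambda\in\mathbb Z_+[\mathcal G]}V^\lambda$, where $V^{a_1+\cdots+a_l}=V^{a_1\otimes\cdots\otimes a_l}$ for every word, and $V^\lambda(n)V^\mu\subseteq V^{\lambda+\mu}$ for all $n\in\mathbb Z$; 3. (universal property) if $U$ is a vertex algebra with a map $\mathcal G\to U$ whose image generates $U$ and consists of elements $a\in U_{\deg a}$ with $D^*a=0$, and if $\Omega(U)^{\mathbf a}\subseteq\Omega^{\mathbf a}$ for all $\mathbf a\in T(\mathcal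 G)$, then there is a unique homomorphism of vertex algebras $V\to U$ that is the identity on $\mathcal G$. -/

import Mathlib

open Function

universe u v w

noncomputable section

namespace VertexCoalg

/-! ### Rational functions -/

/-- Rational functions in `l` variables `z_0, …, z_{l-1}` over `k`. -/
abbrev RatFn (k : Type u) [Field k] (l : ℕ) : Type u := FractionRing (MvPolynomial (Fin l) k)

variable {k : Type u} [Field k] {l : ℕ}

/-- A polynomial, viewed as a rational function. -/
def ofPoly (p : MvPolynomial (Fin l) k) : RatFn k l := algebraMap _ _ p

/-- The variable `z_i`. -/
def z (i : Fin l) : RatFn k l := ofPoly (MvPolynomial.X i)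

variable (k l) in
/-- The space of all functions `p(z) ∏_{i<j} (z_i - z_j)^{e i j}` with `p` a polynomial and
`e i j` arbitrary integers. -/
def Phi : Set (RatFn k l) :=
  {α | ∃ (p : MvPolynomial (Fin l) k) (e : Fin l → Fin l → ℤ),
    α = ofPoly p * ∏ i, ∏ j ∈ Finset.Ioi i, (z i - z j) ^ e i j}

/-- `α` is homogeneous of degree `d`, where every variable has degree one. -/
def IsHomog (d : ℤ) (α : RatFn k l) : Prop :=
  ∃ (p q : MvPolynomial (Fin l) k) (m n : ℕ), p.IsHomogeneous m ∧ q.IsHomogeneous n ∧ q ≠ 0 ∧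
    d = (m : ℤ) - n ∧ α = ofPoly p / ofPoly q

/-- The order of `α` at the prime polynomial `z_i - z_j` is at least `n`
(this holds for all `n` when `α = 0`). -/
def OrdGe (i j : Fin l) (n : ℤ) (α : RatFn k l) : Prop :=
  ∃ p q : MvPolynomial (Fin l) k, ¬ (MvPolynomial.X i - MvPolynomial.X j) ∣ q ∧
    α = (z i - z j) ^ n * (ofPoly p / ofPoly q)

/-- Permutation of the variables of a polynomial, with values in rational functions. -/
def permPoly (σ : Equiv.Perm (Fin l)) : MvPolynomial (Fin l) k →ₐ[k] RatFn k l :=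
  (IsScalarTower.toAlgHom k (MvPolynomial (Fin l) k) (RatFn k l)).comp (MvPolynomial.rename σ)

theorem permPoly_injective (σ : Equiv.Perm (Fin l)) : Injective (permPoly (k := k) σ) :=
  (IsFractionRing.injective (MvPolynomial (Fin l) k) (RatFn k l)).comp
    (MvPolynomial.rename_injective _ σ.injective)

variable (k) in
/-- The action `(σ α)(z_0, …, z_{l-1}) = α(z_{σ 0}, …, z_{σ (l-1)})`. -/
def permAct (σ : Equiv.Perm (Fin l)) : RatFn k l →ₐ[k] RatFn k l :=
  IsFractionRing.liftAlgHom (g := permPoly (k := k) σ) (permPoly_injective σ)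

theorem permAct_ofPoly (σ : Equiv.Perm (Fin l)) (p : MvPolynomial (Fin l) k) :
    permAct k σ (ofPoly p) = ofPoly (MvPolynomial.rename σ p) := by
  have h : (permAct k σ : RatFn k l →+* RatFn k l) = IsFractionRing.lift (permPoly_injective σ) :=
    rfl
  exact (congrArg (fun f => f (ofPoly p)) h).trans
    (IsFractionRing.lift_algebraMap (permPoly_injective (k := k) σ) p)

/-- The partial derivative `∂α/∂z_i`, by the quotient rule. -/
def pd (i : Fin l) (α : RatFn k l) : RatFn k l :=
  let p := IsFractionRing.num (MvPolynomial (Fin l) k) α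
  let q : MvPolynomial (Fin l) k := (IsFractionRing.den (MvPolynomial (Fin l) k) α).1
  ofPoly (MvPolynomial.pderiv i p * q - p * MvPolynomial.pderiv i q) / ofPoly q ^ 2

/-- The partial derivative can be computed from any presentation of `α` as a quotient. -/
theorem pd_div (i : Fin l) (p q : MvPolynomial (Fin l) k) (hq : q ≠ 0) :
    pd i (ofPoly p / ofPoly q) =
      ofPoly (MvPolynomial.pderiv i p * q - p * MvPolynomial.pderiv i q) / ofPoly q ^ 2 := by
  have inj := IsFractionRing.injective (MvPolynomial (Fin l) k) (RatFn k l)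
  set α : RatFn k l := ofPoly p / ofPoly q with hα
  set p' := IsFractionRing.num (MvPolynomial (Fin l) k) α with hp'
  set q' : MvPolynomial (Fin l) k := (IsFractionRing.den (MvPolynomial (Fin l) k) α).1 with hq'
  have hq'0 : q' ≠ 0 := nonZeroDivisors.coe_ne_zero _
  have h0 : ofPoly q ≠ 0 := fun h => hq (inj (by rw [map_zero]; exact h))
  have h0' : ofPoly q' ≠ 0 := fun h => hq'0 (inj (by rw [map_zero]; exact h))
  have hdiv : ofPoly p' / ofPoly q' = α := by
    have := IsFractionRing.mk'_num_den (MvPolynomial (Fin l) k) α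
    rw [IsFractionRing.mk'_eq_div] at this
    exact this
  have hmul : p' * q = p * q' := by
    rw [hα, div_eq_div_iff h0' h0] at hdiv
    apply inj
    rw [map_mul, map_mul]
    exact hdiv
  have hd := congrArg (MvPolynomial.pderiv i) hmul
  simp only [Derivation.leibniz, smul_eq_mul] at hd
  change ofPoly (MvPolynomial.pderiv i p' * q' - p' * MvPolynomial.pderiv i q') / ofPoly q' ^ 2 = _
  rw [div_eq_div_iff (pow_ne_zero _ h0') (pow_ne_zero _ h0)]
  simp only [ofPoly, ← map_pow, ← map_mul]
  congr 1
  linear_combination (-(q' * MvPolynomial.pderiv i q) - q * MvPolynomial.pderiv i q') * hmul +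
    (q * q') * hd

/-- The operator `Δ = ∑ ∂/∂z_i`. -/
def Delta (α : RatFn k l) : RatFn k l := ∑ i, pd i α

/-- The operator `Δ*(n_0, …, n_{l-1}) = ∑ (z_i² ∂/∂z_i + n_i z_i)`. -/
def DeltaStar (n : Fin l → ℤ) (α : RatFn k l) : RatFn k l :=
  ∑ i, (z i ^ 2 * pd i α + (n i : RatFn k l) * z i * α)

/-! ### Expansions -/

/-- Expansion of polynomials at `z_0 = ∞`: a polynomial in `z_0` with coefficients in
`k[z_1, …, z_l]`, seen as a Laurent series in the parameter `t = z_0⁻¹`. -/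
def polyExpand : MvPolynomial (Fin (l + 1)) k →+* LaurentSeries (RatFn k l) :=
  MvPolynomial.eval₂Hom (HahnSeries.C.comp (algebraMap k (RatFn k l)))
    (Fin.cons (HahnSeries.single (-1) 1) fun i => HahnSeries.C (z i))

theorem polyExpand_injective : Injective (polyExpand (k := k) (l := l)) := by
  let ψ : Polynomial (MvPolynomial (Fin l) k) →+* LaurentSeries (RatFn k l) :=
    Polynomial.eval₂RingHom (HahnSeries.C.comp (algebraMap (MvPolynomial (Fin l) k) (RatFn k l)))
      (HahnSeries.single (-1) 1)
  have hψ : polyExpand (k := k) (l := l) =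
      ψ.comp (MvPolynomial.finSuccEquiv k l : _ →+* Polynomial (MvPolynomial (Fin l) k)) := by
    apply MvPolynomial.ringHom_ext
    · intro r
      simp [polyExpand, ψ, MvPolynomial.finSuccEquiv_apply]
      rfl
    · intro i
      refine Fin.cases ?_ (fun j => ?_) i
      · simp [polyExpand, ψ, MvPolynomial.finSuccEquiv_X_zero]
      · simp [polyExpand, ψ, MvPolynomial.finSuccEquiv_X_succ, z, ofPoly]
  have hψi : Injective ψ := by
    rw [injective_iff_map_eq_zero]
    intro p hp
    ext1 n
    apply IsFractionRing.injective (MvPolynomial (Fin l) k) (RatFn k l)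
    have h := congrArg (fun s : LaurentSeries (RatFn k l) => s.coeff (-(n : ℤ))) hp
    simp only [ψ, Polynomial.coe_eval₂RingHom, Polynomial.eval₂_eq_sum_range,
      HahnSeries.coeff_sum, HahnSeries.coeff_zero, HahnSeries.single_pow, RingHom.comp_apply,
      HahnSeries.C_apply, HahnSeries.single_mul_single, HahnSeries.coeff_single] at h
    rw [Polynomial.coeff_zero, map_zero, ← h]
    by_cases hn : n ∈ Finset.range (p.natDegree + 1)
    · rw [Finset.sum_eq_single_of_mem n hn]
      · simp
      · intro b _ hb
        rw [if_neg]
        simp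
        omega
    · rw [Finset.sum_eq_zero]
      · rw [Polynomial.coeff_eq_zero_of_natDegree_lt, map_zero]
        simp at hn; omega
      · intro b hb
        rw [if_neg]
        rintro hb'
        simp at hb'
        simp at hn hb; omega
  rw [hψ]
  exact hψi.comp (MvPolynomial.finSuccEquiv k l).injective

/-- The expansion of a rational function at `z_0 = ∞`, a Laurent series in `t = z_0⁻¹` whose
coefficients are rational functions of the remaining variables (renumbered from `0`). -/
def expandAtInfty : RatFn k (l + 1) →+* LaurentSeries (RatFn k l) :=
  IsFractionRing.lift (polyExpand_injective (k := k) (l := l))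

theorem expandAtInfty_ofPoly (p : MvPolynomial (Fin (l + 1)) k) :
    expandAtInfty (ofPoly p) = polyExpand p :=
  IsFractionRing.lift_algebraMap _ _

/-- The coefficient `α_n` of `z_0^{-n-1}` in the expansion of `α` at `z_0 = ∞`. -/
def coeffAtInfty (n : ℤ) (α : RatFn k (l + 1)) : RatFn k l := (expandAtInfty α).coeff (n + 1)

/-- The value of a rational function in no variables. -/
def constValue : RatFn k 0 →+* k :=
  IsFractionRing.lift (A := MvPolynomial (Fin 0) k)
    (g := (MvPolynomial.isEmptyAlgEquiv k (Fin 0) : MvPolynomial (Fin 0) k →+* k))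
    (MvPolynomial.isEmptyAlgEquiv k (Fin 0)).injective

theorem constValue_ofPoly (p : MvPolynomial (Fin 0) k) :
    constValue (ofPoly p) = MvPolynomial.isEmptyAlgEquiv k (Fin 0) p :=
  IsFractionRing.lift_algebraMap _ _

/-- The coefficient of `z_0^{-m_0-1} ⋯ z_{l-1}^{-m_{l-1}-1}` in the expansion of `α` in the domain
`|z_0| > |z_1| > ⋯ > |z_{l-1}|`: expand at `z_0 = ∞`, then every coefficient at `z_1 = ∞`, and
so on. -/
def coeffIter : (l : ℕ) → RatFn k l → (Fin l → ℤ) → k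
  | 0, α, _ => constValue α
  | l + 1, α, m => coeffIter l (coeffAtInfty (m 0) α) (Fin.tail m)

/-! ### Vertex algebras -/

variable (k) in
/-- A vertex algebra structure on the vector space `V`; `prod n a b` is the product `a(n)b`. -/
structure VertexAlgebra (V : Type v) [AddCommGroup V] [Module k V] where
  prod : ℤ → V →ₗ[k] V →ₗ[k] V
  one : V
  prod_eq_zero : ∀ a b, ∃ N : ℤ, ∀ n, N ≤ n → prod n a b = 0
  one_prod : ∀ n a, prod n one a = if n = -1 then a else 0
  prod_one_of_nonneg : ∀ n, 0 ≤ n → ∀ a, prod n a one = 0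
  /-- `a(-n-1)1 = Dⁿa / n!`, where `Da = a(-2)1`. -/
  prod_one : ∀ (n : ℕ) (a : V),
    prod (-(n : ℤ) - 1) a one = (n.factorial : k)⁻¹ • (fun x => prod (-2) x one)^[n] a
  /-- `D` is a derivation of all products. -/
  D_prod : ∀ n a b, prod (-2) (prod n a b) one =
    prod n (prod (-2) a one) b + prod n a (prod (-2) b one)
  prod_D : ∀ n a b, prod n (prod (-2) a one) b = -n • prod (n - 1) a b
  /-- The commutator formula; by `prod_eq_zero` the sum is finite. -/
  commutator : ∀ (m n : ℤ) (a b c : V), prod m a (prod n b c) - prod n b (prod m a c) =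
    ∑ᶠ s : ℕ, (Ring.choose m s : ℤ) • prod (m + n - s) (prod s a b) c

variable (k) in
/-- A graded vertex algebra `V = ⊕_d V_d` with `sl₂` structure. -/
structure Sl2VertexAlgebra (V : Type v) [AddCommGroup V] [Module k V] extends
    VertexAlgebra k V where
  /-- The homogeneous component `V_d`. -/
  gr : ℤ → Submodule k V
  isInternal : DirectSum.IsInternal gr
  one_mem : one ∈ gr 0
  prod_mem : ∀ (i j n : ℤ) (a b : V), a ∈ gr i → b ∈ gr j → prod n a b ∈ gr (i + j - n - 1)
  /-- The operator `D*`. -/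
  Dstar : V →ₗ[k] V
  Dstar_mem : ∀ (d : ℤ) (a : V), a ∈ gr d → Dstar a ∈ gr (d - 1)
  Dstar_locallyNilpotent : ∀ a, ∃ n : ℕ, Dstar^[n] a = 0
  Dstar_one : Dstar one = 0
  Dstar_prod : ∀ (d m : ℤ) (a b : V), a ∈ gr d →
    Dstar (prod m a b) - prod m a (Dstar b) =
      (2 * d - m - 2) • prod (m + 1) a b + prod m (Dstar a) b

namespace VertexAlgebra

variable {V : Type v} [AddCommGroup V] [Module k V] (A : VertexAlgebra k V)

/-- The vector `a_0(m_0) a_1(m_1) ⋯ a_{l-1}(m_{l-1}) 1`. -/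
def word : (l : ℕ) → (Fin l → V) → (Fin l → ℤ) → V
  | 0, _, _ => A.one
  | l + 1, a, m => A.prod (m 0) (a 0) (word l (Fin.tail a) (Fin.tail m))

/-- The span `V^a` of all the vectors `a_0(m_0) ⋯ a_{l-1}(m_{l-1}) 1`. -/
def wordSpace (a : Fin l → V) : Submodule k V := Submodule.span k (Set.range (A.word l a))

/-- The set `S` generates the vertex algebra: the only vertex subalgebra containing it is the
whole algebra. -/
def Generates (S : Set V) : Prop :=
  ∀ W : Submodule k V, S ⊆ W → A.one ∈ W → (∀ n a b, a ∈ W → b ∈ W → A.prod n a b ∈ W) → W = ⊤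

end VertexAlgebra

namespace Sl2VertexAlgebra

variable {V : Type v} [AddCommGroup V] [Module k V] (A : Sl2VertexAlgebra k V)

/-- `α` is the correlation function of `a_0, …, a_{l-1}` and the functional `f`: the series
`f(Y(a_0, z_0) ⋯ Y(a_{l-1}, z_{l-1}) 1)` is its expansion in `|z_0| > ⋯ > |z_{l-1}|`. -/
def IsCorrFn (f : V →ₗ[k] k) (a : Fin l → V) (α : RatFn k l) : Prop :=
  α ∈ Phi k l ∧ ∀ m : Fin l → ℤ, coeffIter l α m = f (A.word l a m)

/-- The space of the correlation functions of `a_0, …, a_{l-1}` and functionals of degree `d`, for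
all `d`, that is, functionals which vanish on `V_n` for all `n ≠ d`. -/
def corrSpace (a : Fin l → V) : Submodule k (RatFn k l) :=
  Submodule.span k {α | ∃ (d : ℤ) (f : V →ₗ[k] k),
    (∀ n, n ≠ d → ∀ x ∈ A.gr n, f x = 0) ∧ A.IsCorrFn f a α}

/-- The map `ι` presents a set of homogeneous minimal generators of the given degrees. -/
structure IsMinimalGenerators {G : Type w} (deg : G → ℤ) (ι : G → V) : Prop where
  mem_gr : ∀ a, ι a ∈ A.gr (deg a)
  Dstar_eq_zero : ∀ a, A.Dstar (ι a) = 0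
  generates : A.Generates (Set.range ι)

/-- A homomorphism of graded vertex algebras with `sl₂` structure. -/
structure IsHom {U : Type w} [AddCommGroup U] [Module k U] (B : Sl2VertexAlgebra k U)
    (φ : V →ₗ[k] U) : Prop where
  map_one : φ A.one = B.one
  map_prod : ∀ n a b, φ (A.prod n a b) = B.prod n (φ a) (φ b)
  map_gr : ∀ d, ∀ a ∈ A.gr d, φ a ∈ B.gr d
  map_Dstar : ∀ a, φ (A.Dstar a) = B.Dstar (φ a)

end Sl2VertexAlgebra

/-! ### Vertex coalgebras of rational functions -/

/-- The axioms on a family `Ω` of graded spaces of rational functions, indexed by the finite words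
`a = (a_0, …, a_{l-1})` in `G`. -/
structure IsVertexCoalgebra {G : Type v} (deg : G → ℤ) (loc : G → G → ℤ)
    (Ω : (l : ℕ) → (Fin l → G) → Submodule k (RatFn k l)) : Prop where
  /-- The space is contained in the appropriate space of rational functions. -/
  le_Phi : ∀ {l : ℕ} (a : Fin l → G), ∀ α ∈ Ω l a, α ∈ Phi k l
  /-- The space is the direct sum of its homogeneous components. -/
  graded : ∀ {l : ℕ} (a : Fin l → G),
    Ω l a = Submodule.span k {α | α ∈ Ω l a ∧ ∃ d, IsHomog d α}
  /-- The space of the empty word is `k`. -/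
  empty : ∀ a : Fin 0 → G, ∀ α : RatFn k 0, α ∈ Ω 0 a ↔ ∃ c : k, α = algebraMap k _ c
  /-- The space of a word of length one is `k[z]`. -/
  single : ∀ a : Fin 1 → G, ∀ α : RatFn k 1, α ∈ Ω 1 a ↔ ∃ p, α = ofPoly p
  /-- Pole orders. -/
  ord_ge : ∀ {l : ℕ} (a : Fin l → G), ∀ α ∈ Ω l a, ∀ i j, i < j → OrdGe i j (-loc (a i) (a j)) α
  /-- Permutation symmetry. -/
  perm : ∀ {l : ℕ} (a : Fin l → G) (σ : Equiv.Perm (Fin l)),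
    Ω l a = (Ω l (a ∘ σ)).map (permAct k σ).toLinearMap
  /-- Symmetry in the variables that carry equal letters. -/
  symm : ∀ {l : ℕ} (a : Fin l → G), ∀ i j, a i = a j → ∀ α ∈ Ω l a,
    permAct k (Equiv.swap i j) α = α
  Delta_mem : ∀ {l : ℕ} (a : Fin l → G), ∀ α ∈ Ω l a, Delta α ∈ Ω l a
  DeltaStar_mem : ∀ {l : ℕ} (a : Fin l → G), ∀ α ∈ Ω l a,
    DeltaStar (fun i => 2 * deg (a i)) α ∈ Ω l a
  /-- The coefficients of the expansion at `z_0 = ∞` belong to the space of the word with the first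
  letter removed. -/
  coeff_mem : ∀ {l : ℕ} (a : Fin (l + 1) → G), ∀ α ∈ Ω (l + 1) a, ∀ n : ℤ,
    coeffAtInfty n α ∈ Ω l (Fin.tail a)

/-- The weight `a_0 + ⋯ + a_{l-1} ∈ ℤ₊[G]` of a word. -/
def weight {G : Type v} (a : Fin l → G) : G →₀ ℕ := ∑ i, Finsupp.single (a i) 1

end VertexCoalg

end

/-!
The vertex algebra of `Ω` is found inside a dual space. Call a choice of one function in `Ω` for
every word, equivariant under permutations of the letters, a family (`families`). A letter `a`
acts on families by `contract`: take the functions of the words which begin with `a` and extract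
the coefficient of `z_0 ^ (-n - 1)` at `z_0 = ∞`; as `Ω` is closed under these coefficients, the
result is again a family. The transposed operators act on the dual space, the vacuum being evaluation at the empty
word, and `V` is the span of the words in these operators applied to the vacuum. By construction,
the pairing of a word with a family is a coefficient in the expansion of a member of the family.

The letters are mutually local: a power of `z_0 - z_1` given by the bound on the poles makes the
order of the two outer expansions immaterial (`pow_mul_mem_swapOK`, `dd_iter_of_mem_swapOK`), and
equivariance identifies the two words with interchanged letters (`contract_comm`). A space spanned
by words in mutually local modes, with a vacuum and a translation operator, is a vertex algebra
(`IsGenerating.vertexAlgebra`). This reconstruction rests on Goddard's uniqueness theorem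
(`goddard`), by which a field is determined by its value on the vacuum, and on Dong's lemma, whose
core is `d23_pow_eq_zero`; the products are residues of quotients by `z - w`. The operators `Δ`,
`∑ i, (z i ∂_i + deg a_i)` and `Δ*` on families give `D`, the degree and `D*` (`coeffL_wop`,
`IsField.grading`, `IsField.special`), and counting the occurrences of a letter gives the grading
by weights.

That the correlation functions of `V` are the functions in `Ω` has two halves. A homogeneous
function in `Ω` extends to an equivariant family on the orbit of its word (`exists_family`), and
evaluation at this family is a functional with the given correlation function. Conversely, a
homogeneous functional on `V` involves only finitely many dimensions of functions, since the
homogeneous functions with bounded poles form a finite-dimensional space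
(`finite_of_bounded_poles`); so on a given word it is evaluation at a function in `Ω`.

For the universal property, the matrix coefficients of words in a vertex algebra `U` are expansions
of rational functions (`IsGradedModes.exists_corrFn`), which permute along with the letters
(`IsGradedModes.corrFn_perm`). If they lie in `Ω`, every homogeneous functional on `U` therefore
gives a family, so that a linear relation among words in `V` holds in `U` as well
(`exists_wordMap`). The resulting linear map intertwines the letters, hence all fields, again by
Goddard's theorem (`isHom_of_intertwines`).
-/

noncomputable section

namespace VertexCoalg

/-! ### Mutual locality of families of modes -/

section Locality

variable {M : Type*} [AddCommGroup M] {M' : Type*} [AddCommGroup M']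

/-- Multiplication by `z - w` on the coefficients of a formal distribution in two variables. -/
def dd (f : ℤ → ℤ → M) : ℤ → ℤ → M := fun m n => f (m + 1) n - f m (n + 1)

/-- A distribution in two variables is local if it is killed by a power of `z - w`. -/
def IsLoc (f : ℤ → ℤ → M) : Prop := ∃ N : ℕ, dd^[N] f = 0

theorem dd_add (f g : ℤ → ℤ → M) : dd (f + g) = dd f + dd g := by
  funext m n; simp [dd]; abel

theorem dd_iter_add (N : ℕ) (f g : ℤ → ℤ → M) : dd^[N] (f + g) = dd^[N] f + dd^[N] g := by
  induction N generalizing f g with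
  | zero => rfl
  | succ N ih => rw [iterate_succ_apply, dd_add, ih]; rfl

theorem dd_map (φ : M →+ M') (f : ℤ → ℤ → M) :
    dd (fun m n => φ (f m n)) = fun m n => φ (dd f m n) := by
  funext m n; simp [dd]

theorem dd_iter_map (φ : M →+ M') (N : ℕ) (f : ℤ → ℤ → M) :
    dd^[N] (fun m n => φ (f m n)) = fun m n => φ (dd^[N] f m n) := by
  induction N generalizing f with
  | zero => rfl
  | succ N ih => rw [iterate_succ_apply, dd_map, ih]; rfl

theorem dd_iter_zero (N : ℕ) : dd^[N] (0 : ℤ → ℤ → M) = 0 := by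
  induction N with
  | zero => rfl
  | succ N ih =>
    rw [iterate_succ_apply]
    have : dd (0 : ℤ → ℤ → M) = 0 := by funext m n; simp [dd]
    rw [this, ih]

theorem dd_iter_mono {N N' : ℕ} (h : N ≤ N') {f : ℤ → ℤ → M} (hf : dd^[N] f = 0) :
    dd^[N'] f = 0 := by
  obtain ⟨j, rfl⟩ := Nat.exists_eq_add_of_le' h
  rw [iterate_add_apply, hf, dd_iter_zero]

theorem dd_iter_sub (N : ℕ) (f g : ℤ → ℤ → M) : dd^[N] (f - g) = dd^[N] f - dd^[N] g := by
  have h := dd_iter_add N (f - g) g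
  rw [sub_add_cancel] at h
  rw [h, add_sub_cancel_right]

theorem dd_iter_shift (N : ℕ) (c d : ℤ) (f : ℤ → ℤ → M) :
    dd^[N] (fun m n => f (m + c) (n + d)) = fun m n => dd^[N] f (m + c) (n + d) := by
  induction N generalizing f with
  | zero => rfl
  | succ N ih =>
    rw [iterate_succ_apply, iterate_succ_apply, ← ih]
    congr 1; funext m n; simp [dd, add_right_comm]

theorem IsLoc.zero : IsLoc (0 : ℤ → ℤ → M) := ⟨0, rfl⟩

theorem IsLoc.add {f g : ℤ → ℤ → M} (hf : IsLoc f) (hg : IsLoc g) : IsLoc (f + g) := by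
  obtain ⟨a, ha⟩ := hf
  obtain ⟨b, hb⟩ := hg
  refine ⟨max a b, ?_⟩
  rw [dd_iter_add, dd_iter_mono (le_max_left _ _) ha, dd_iter_mono (le_max_right _ _) hb, add_zero]

theorem IsLoc.map {f : ℤ → ℤ → M} (φ : M →+ M') (hf : IsLoc f) :
    IsLoc (fun m n => φ (f m n)) := by
  obtain ⟨a, ha⟩ := hf
  refine ⟨a, ?_⟩
  rw [dd_iter_map, ha]; funext m n; simp

theorem IsLoc.neg {f : ℤ → ℤ → M} (hf : IsLoc f) : IsLoc (-f) :=
  hf.map (-AddMonoidHom.id M)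

theorem IsLoc.sub {f g : ℤ → ℤ → M} (hf : IsLoc f) (hg : IsLoc g) : IsLoc (f - g) := by
  rw [sub_eq_add_neg]; exact hf.add hg.neg

theorem IsLoc.shift {f : ℤ → ℤ → M} (c d : ℤ) (hf : IsLoc f) :
    IsLoc (fun m n => f (m + c) (n + d)) := by
  obtain ⟨a, ha⟩ := hf
  refine ⟨a, ?_⟩
  rw [dd_iter_shift, ha]; rfl

theorem IsLoc.swap {f : ℤ → ℤ → M} (hf : IsLoc f) : IsLoc (fun m n => f n m) := by
  obtain ⟨a, ha⟩ := hf
  refine ⟨a, ?_⟩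
  induction a generalizing f with
  | zero => simp only [iterate_zero, id] at ha ⊢; subst ha; rfl
  | succ N ih =>
    rw [iterate_succ_apply] at ha ⊢
    have h := ih ha
    have e : dd (fun m n => f n m) = fun m n => (-AddMonoidHom.id M) (dd f n m) := by
      funext m n; simp [dd]
    rw [e, dd_iter_map, h]; funext m n; simp

theorem IsLoc.fst_smul {f : ℤ → ℤ → M} (hf : IsLoc f) : IsLoc (fun m n => m • f m n) := by
  obtain ⟨N, hN⟩ := hf
  refine ⟨N + 1, ?_⟩
  induction N generalizing f with
  | zero => simp only [iterate_zero, id] at hN; subst hN; funext m n; simp [dd]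
  | succ N ih =>
    have e : dd (fun m n => m • f m n) =
        (fun m n => m • dd f m n) + fun m n => f (m + 1) (n + 0) := by
      funext m n; simp [dd, add_smul, smul_sub]; abel
    rw [iterate_succ_apply, e, dd_iter_add, dd_iter_shift, hN,
      ih (by rw [← iterate_succ_apply]; exact hN)]
    funext m n; simp

theorem IsLoc.snd_smul {f : ℤ → ℤ → M} (hf : IsLoc f) : IsLoc (fun m n => n • f m n) :=
  hf.swap.fst_smul.swap

theorem eq_zero_of_dd_eq_zero {f : ℤ → ℤ → M} (M₀ : ℤ) (h : ∀ m n, M₀ ≤ n → f m n = 0)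
    (hd : dd f = 0) : f = 0 := by
  have h1 : ∀ m n, f m n = f (m - 1) (n + 1) := by
    intro m n
    have := congrFun (congrFun hd (m - 1)) n
    simpa [dd, sub_eq_zero] using this
  have h2 : ∀ (j : ℕ) m n, f m n = f (m - j) (n + j) := by
    intro j
    induction j with
    | zero => simp
    | succ j ih =>
      intro m n
      rw [ih, h1]; push_cast; congr 1 <;> ring
  funext m n
  rw [h2 (M₀ - n).toNat]
  exact h _ _ (by have := Int.self_le_toNat (M₀ - n); omega)

theorem dd_iter_vanish {f : ℤ → ℤ → M} {M₀ : ℤ} (h : ∀ m n, M₀ ≤ n → f m n = 0) (N : ℕ) :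
    ∀ m n, M₀ ≤ n → dd^[N] f m n = 0 := by
  induction N generalizing f with
  | zero => exact h
  | succ N ih =>
    rw [iterate_succ_apply]
    exact ih fun m n hn => by simp [dd, h _ _ hn, h _ (n + 1) (by omega)]

/-- A local distribution with coefficients `0` for large second index vanishes. -/
theorem IsLoc.eq_zero {f : ℤ → ℤ → M} (hf : IsLoc f) (M₀ : ℤ) (h : ∀ m n, M₀ ≤ n → f m n = 0) :
    f = 0 := by
  obtain ⟨N, hN⟩ := hf
  induction N with
  | zero => exact hN
  | succ N ih =>
    rw [iterate_succ_apply'] at hN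
    exact ih (eq_zero_of_dd_eq_zero M₀ (dd_iter_vanish h N) hN)

/-- If `f` has vanishing coefficients for large second index, and `(z - w)^N f` for large first
index, then each row of `f` has vanishing coefficients for large first index. -/
theorem eventually_zero_of_dd_iter {f : ℤ → ℤ → M} {N : ℕ} {M₀ N₀ : ℤ}
    (h : ∀ m n, M₀ ≤ n → f m n = 0) (hd : ∀ m n, N₀ ≤ m → dd^[N] f m n = 0) (n : ℤ) :
    ∃ N₁ : ℤ, ∀ m, N₁ ≤ m → f m n = 0 := by
  induction N generalizing f n with
  | zero => exact ⟨N₀, fun m hm => hd m n hm⟩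
  | succ N ih =>
    have hdf := ih (f := dd f) (dd_iter_vanish h 1) hd
    have key : ∀ j : ℕ, ∃ N₁ : ℤ, ∀ m, N₁ ≤ m → f m (M₀ - j) = 0 := by
      intro j
      induction j with
      | zero => exact ⟨0, fun m _ => h _ _ (by simp)⟩
      | succ j ihj =>
        obtain ⟨a, ha⟩ := ihj
        obtain ⟨b, hb⟩ := hdf (M₀ - (j + 1 : ℕ))
        refine ⟨max a b + 1, fun m hm => ?_⟩
        have h1 := hb (m - 1) (by have := le_max_right a b; omega)
        have h2 := ha (m - 1) (by have := le_max_left a b; omega)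
        simp only [dd, sub_add_cancel] at h1
        rw [show M₀ - ((j + 1 : ℕ) : ℤ) + 1 = M₀ - j by push_cast; ring, h2, sub_zero] at h1
        exact h1
    by_cases hn : M₀ ≤ n
    · exact ⟨0, fun m _ => h _ _ hn⟩
    · obtain ⟨a, ha⟩ := key (M₀ - n).toNat
      refine ⟨a, fun m hm => ?_⟩
      have := ha m hm
      rwa [show M₀ - ((M₀ - n).toNat : ℤ) = n by omega] at this

/-- Newton's interpolation formula: a local distribution is a combination of derivatives of the
delta function, with coefficients given by residues. -/
theorem newton {f : ℤ → ℤ → M} {N : ℕ} (hf : dd^[N] f = 0) (m n : ℤ) :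
    f m n = ∑ s ∈ Finset.range N, (Ring.choose m s : ℤ) • dd^[s] f 0 (m + n - s) := by
  induction N generalizing f m n with
  | zero => simpa using congrFun (congrFun hf m) n
  | succ N ih =>
    set r : ℤ → ℤ → M := fun m n =>
      ∑ s ∈ Finset.range (N + 1), (Ring.choose m s : ℤ) • dd^[s] f 0 (m + n - s) with hr
    have hrd : dd r = dd f := by
      funext m n
      rw [ih (f := dd f) (by rw [← iterate_succ_apply]; exact hf) m n]
      simp only [dd, hr]
      rw [← Finset.sum_sub_distrib, Finset.sum_range_succ']
      simp only [Ring.choose_zero_right, Ring.choose_succ_succ]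
      rw [show m + 1 + n = m + (n + 1) by ring, sub_self, add_zero]
      refine Finset.sum_congr rfl fun s _ => ?_
      rw [← sub_smul, add_sub_cancel_right, ← iterate_succ_apply]
      rw [show m + (n + 1) - ((s + 1 : ℕ) : ℤ) = m + n - s by push_cast; ring]
    have h0 : ∀ n, r 0 n = f 0 n := by
      intro n
      simp only [hr]
      rw [Finset.sum_range_succ']
      simp [Ring.choose_zero_succ]
    have h1 : ∀ m n, f (m + 1) n - r (m + 1) n = f m (n + 1) - r m (n + 1) := by
      intro m n
      have := congrFun (congrFun hrd m) n
      simp only [dd] at this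
      rw [sub_eq_iff_eq_add] at this
      rw [this]
      abel
    have h2 : ∀ m n, f m n - r m n = 0 := by
      intro m
      induction m using Int.induction_on with
      | zero => intro n; rw [h0, sub_self]
      | succ i hi => intro n; rw [h1]; exact hi _
      | pred i hi =>
        intro n
        have := h1 (-i - 1) (n - 1)
        rw [sub_add_cancel, sub_add_cancel, hi] at this
        exact this.symm
    exact sub_eq_zero.mp (h2 m n)

end Locality

/-! ### Dong's lemma -/

section Dong

variable (M : Type*) [AddCommGroup M]

/-- Multiplication by `z - w` on distributions in three variables `z, w, u`. -/
def d12 : Module.End ℤ (ℤ → ℤ → ℤ → M) where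
  toFun f p q r := f (p + 1) q r - f p (q + 1) r
  map_add' f g := by funext p q r; simp; abel
  map_smul' c f := by funext p q r; simp [smul_sub]

/-- Multiplication by `z - u` on distributions in three variables `z, w, u`. -/
def d13 : Module.End ℤ (ℤ → ℤ → ℤ → M) where
  toFun f p q r := f (p + 1) q r - f p q (r + 1)
  map_add' f g := by funext p q r; simp; abel
  map_smul' c f := by funext p q r; simp [smul_sub]

/-- Multiplication by `w - u` on distributions in three variables `z, w, u`. -/
def d23 : Module.End ℤ (ℤ → ℤ → ℤ → M) where
  toFun f p q r := f p (q + 1) r - f p q (r + 1)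
  map_add' f g := by funext p q r; simp; abel
  map_smul' c f := by funext p q r; simp [smul_sub]

variable {M}

theorem d12_apply (f : ℤ → ℤ → ℤ → M) (p q r : ℤ) :
    d12 M f p q r = f (p + 1) q r - f p (q + 1) r := rfl
theorem d13_apply (f : ℤ → ℤ → ℤ → M) (p q r : ℤ) :
    d13 M f p q r = f (p + 1) q r - f p q (r + 1) := rfl
theorem d23_apply (f : ℤ → ℤ → ℤ → M) (p q r : ℤ) :
    d23 M f p q r = f p (q + 1) r - f p q (r + 1) := rfl

theorem commute_d12_d13 : Commute (d12 M) (d13 M) := by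
  ext f p q r; simp [d12_apply, d13_apply]; abel
theorem commute_d12_d23 : Commute (d12 M) (d23 M) := by
  ext f p q r; simp [d12_apply, d23_apply]; abel
theorem commute_d13_d23 : Commute (d13 M) (d23 M) := by
  ext f p q r; simp [d13_apply, d23_apply]; abel

theorem d13_pow_apply (N : ℕ) (f : ℤ → ℤ → ℤ → M) (p q r : ℤ) :
    (d13 M ^ N) f p q r = dd^[N] (fun p r => f p q r) p r := by
  induction N generalizing f with
  | zero => rfl
  | succ N ih => rw [pow_succ, Module.End.mul_apply, ih]; rfl
theorem d23_pow_apply (N : ℕ) (f : ℤ → ℤ → ℤ → M) (p q r : ℤ) :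
    (d23 M ^ N) f p q r = dd^[N] (f p) q r := by
  induction N generalizing f with
  | zero => rfl
  | succ N ih => rw [pow_succ, Module.End.mul_apply, ih]; rfl

theorem d13_swap (f : ℤ → ℤ → ℤ → M) :
    d13 M (fun p q r => f q p r) = fun p q r => d23 M f q p r := rfl
theorem d23_swap (f : ℤ → ℤ → ℤ → M) :
    d23 M (fun p q r => f q p r) = fun p q r => d13 M f q p r := rfl
theorem d13_pow_swap (N : ℕ) (f : ℤ → ℤ → ℤ → M) :
    (d13 M ^ N) (fun p q r => f q p r) = fun p q r => (d23 M ^ N) f q p r := by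
  induction N generalizing f with
  | zero => rfl
  | succ N ih => rw [pow_succ, Module.End.mul_apply, d13_swap, ih, pow_succ]; rfl
theorem d23_pow_swap (N : ℕ) (f : ℤ → ℤ → ℤ → M) :
    (d23 M ^ N) (fun p q r => f q p r) = fun p q r => (d13 M ^ N) f q p r := by
  induction N generalizing f with
  | zero => rfl
  | succ N ih => rw [pow_succ, Module.End.mul_apply, d23_swap, ih, pow_succ]; rfl

/-- The algebraic core of Dong's lemma: `w - u = (z - u) - (z - w)`. -/
theorem d23_pow_eq_zero {X : ℤ → ℤ → ℤ → M} {L N : ℕ} (h : (d12 M ^ L) X = 0)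
    (h' : (d13 M ^ N) ((d23 M ^ N) X) = 0) : (d23 M ^ (N + L + N)) X = 0 := by
  have e : d23 M = d13 M + -(d12 M) := by
    ext f p q r; simp [d12_apply, d13_apply, d23_apply]
  set Y := (d23 M ^ N) X with hY
  have hY12 : (d12 M ^ L) Y = 0 := by
    rw [hY, ← Module.End.mul_apply, (commute_d12_d23.pow_pow L N).eq, Module.End.mul_apply, h,
      map_zero]
  rw [pow_add, Module.End.mul_apply, ← hY]
  nth_rewrite 1 [e]
  rw [(commute_d12_d13 (M := M)).symm.neg_right.add_pow, LinearMap.sum_apply]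
  refine Finset.sum_eq_zero fun i hi => ?_
  rw [Module.End.mul_apply, Module.End.natCast_apply, map_nsmul, Module.End.mul_apply]
  rw [Finset.mem_range] at hi
  have key : (d13 M ^ i) (((-(d12 M)) ^ (N + L - i)) Y) = 0 := by
    by_cases hN : N ≤ i
    · rw [← Module.End.mul_apply,
        ((commute_d12_d13 (M := M)).symm.neg_right.pow_pow i _).eq, Module.End.mul_apply]
      obtain ⟨j, rfl⟩ := Nat.exists_eq_add_of_le' hN
      rw [pow_add, Module.End.mul_apply, h', map_zero, map_zero]
    · obtain ⟨j, hj⟩ := Nat.exists_eq_add_of_le' (show L ≤ N + L - i by omega)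
      rw [hj, neg_pow, pow_add (d12 M), Module.End.mul_apply, Module.End.mul_apply, hY12]
      simp
  rw [key, smul_zero]

end Dong

/-! ### Fields -/

section Fields

variable {k : Type u} [Field k] {V : Type v} [AddCommGroup V] [Module k V]

/-- The commutator of two families of modes. -/
def cm (A B : ℤ → Module.End k V) : ℤ → ℤ → Module.End k V :=
  fun m n => A m * B n - B n * A m

theorem cm_swap (A B : ℤ → Module.End k V) : cm B A = -fun m n => cm A B n m := by
  funext m n; simp [cm]

theorem IsLoc.cm_symm {A B : ℤ → Module.End k V} (h : IsLoc (cm A B)) : IsLoc (cm B A) := by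
  rw [cm_swap]; exact h.swap.neg

/-- The commutator of a family of products of modes in two variables with a third field. -/
def cm₃ (P : ℤ → ℤ → Module.End k V) (C : ℤ → Module.End k V) : ℤ → ℤ → ℤ → Module.End k V :=
  fun p q r => P p q * C r - C r * P p q

/-- If `A` and `B` are local to `C`, then `(z - u) ^ N (w - u) ^ N` annihilates the commutator of
`A(z) B(w)` with `C(u)`. -/
theorem cm₃_prod {A B C : ℤ → Module.End k V} {N : ℕ} (hA : dd^[N] (cm A C) = 0)
    (hB : dd^[N] (cm B C) = 0) :
    (d13 (Module.End k V) ^ N) ((d23 (Module.End k V) ^ N) (cm₃ (fun p q => A p * B q) C)) = 0 := by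
  have e : cm₃ (fun p q => A p * B q) C =
      (fun p q r => A p * cm B C q r) + fun p q r => cm A C p r * B q := by
    funext p q r; simp [cm₃, cm]; noncomm_ring
  have h1 : (d23 (Module.End k V) ^ N) (fun p q r => A p * cm B C q r) = 0 := by
    funext p q r
    rw [d23_pow_apply]
    have := dd_iter_map (AddMonoidHom.mulLeft (A p)) N (cm B C)
    simp only [AddMonoidHom.coe_mulLeft] at this
    rw [this, hB]; simp
  have h2 : (d13 (Module.End k V) ^ N) (fun p q r => cm A C p r * B q) = 0 := by
    funext p q r
    rw [d13_pow_apply]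
    have := dd_iter_map (AddMonoidHom.mulRight (B q)) N (cm A C)
    simp only [AddMonoidHom.coe_mulRight] at this
    rw [this, hA]; simp
  rw [e, map_add, map_add, h1, map_zero, zero_add, ← Module.End.mul_apply,
    (commute_d13_d23.pow_pow N N).eq, Module.End.mul_apply, h2, map_zero]

theorem cm₃_swap_prod {A B C : ℤ → Module.End k V} {N : ℕ} (hA : dd^[N] (cm A C) = 0)
    (hB : dd^[N] (cm B C) = 0) :
    (d13 (Module.End k V) ^ N) ((d23 (Module.End k V) ^ N) (cm₃ (fun p q => B q * A p) C)) = 0 := by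
  have := cm₃_prod hB hA
  have e : cm₃ (fun p q => B q * A p) C =
    fun p q r => cm₃ (fun p q => B p * A q) C q p r := rfl
  rw [e, d23_pow_swap, d13_pow_swap, ← Module.End.mul_apply, ← (commute_d13_d23.pow_pow N N).eq,
    Module.End.mul_apply, this]
  rfl

/-- The two-variable distribution `P` is local relative to `C`. -/
def LocRel (P : ℤ → ℤ → Module.End k V) (C : ℤ → Module.End k V) : Prop :=
  ∃ N : ℕ, (d13 (Module.End k V) ^ N) ((d23 (Module.End k V) ^ N) (cm₃ P C)) = 0

theorem cm₃_dd (P : ℤ → ℤ → Module.End k V) (C : ℤ → Module.End k V) :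
    cm₃ (dd P) C = d12 (Module.End k V) (cm₃ P C) := by
  funext p q r; simp [cm₃, dd, d12_apply]; noncomm_ring

theorem cm₃_dd_iter (N : ℕ) (P : ℤ → ℤ → Module.End k V) (C : ℤ → Module.End k V) :
    cm₃ (dd^[N] P) C = (d12 (Module.End k V) ^ N) (cm₃ P C) := by
  induction N with
  | zero => rfl
  | succ N ih => rw [iterate_succ_apply', cm₃_dd, ih, pow_succ', Module.End.mul_apply]

theorem LocRel.cm {A B C : ℤ → Module.End k V} (hA : IsLoc (cm A C)) (hB : IsLoc (cm B C)) :
    LocRel (cm A B) C := by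
  obtain ⟨a, ha⟩ := hA
  obtain ⟨b, hb⟩ := hB
  have ha' := dd_iter_mono (le_max_left a b) ha
  have hb' := dd_iter_mono (le_max_right a b) hb
  refine ⟨max a b, ?_⟩
  have e : cm₃ (VertexCoalg.cm A B) C =
      cm₃ (fun p q => A p * B q) C - cm₃ (fun p q => B q * A p) C := by
    funext p q r; simp [cm₃, VertexCoalg.cm]; noncomm_ring
  rw [e, map_sub, map_sub, cm₃_prod ha' hb', cm₃_swap_prod ha' hb', sub_zero]

theorem LocRel.dd_iter {P : ℤ → ℤ → Module.End k V} {C : ℤ → Module.End k V} (h : LocRel P C)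
    (n : ℕ) : LocRel (dd^[n] P) C := by
  obtain ⟨N, hN⟩ := h
  refine ⟨N, ?_⟩
  rw [cm₃_dd_iter]
  simp only [← Module.End.mul_apply]
  rw [← (commute_d12_d23.pow_pow n N).eq, ← mul_assoc,
    ← (commute_d12_d13.pow_pow n N).eq, mul_assoc, Module.End.mul_apply, Module.End.mul_apply, hN,
    map_zero]

/-- Dong's lemma for the residue in the first variable. -/
theorem LocRel.slice {P : ℤ → ℤ → Module.End k V} {C : ℤ → Module.End k V} (h : LocRel P C)
    (hP : IsLoc P) : IsLoc (VertexCoalg.cm (P 0) C) := by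
  obtain ⟨N, hN⟩ := h
  obtain ⟨L, hL⟩ := hP
  refine ⟨N + L + N, ?_⟩
  have h12 : (d12 (Module.End k V) ^ L) (cm₃ P C) = 0 := by
    rw [← cm₃_dd_iter, hL]; funext p q r; simp [cm₃]
  have := d23_pow_eq_zero h12 hN
  funext q r
  have h0 := congrFun (congrFun (congrFun this 0) q) r
  rw [d23_pow_apply] at h0
  exact h0

/-- An infinite sum of endomorphisms, all but finitely many of which kill a given vector. -/
def lsum (h : ℕ → Module.End k V) (hh : ∀ v, ∃ N : ℕ, ∀ j, N ≤ j → h j v = 0) :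
    Module.End k V :=
  have fin : ∀ v, (support fun j => h j v).Finite := fun v => by
    obtain ⟨N, hN⟩ := hh v
    refine (Finset.range N).finite_toSet.subset fun j hj => ?_
    by_contra hc
    exact hj (hN j (by simpa using hc))
  { toFun := fun v => ∑ᶠ j, h j v
    map_add' := fun v w => by simp only [map_add]; exact finsum_add_distrib (fin v) (fin w)
    map_smul' := fun c v => by simp only [map_smul]; exact (smul_finsum' c (fin v)).symm }

theorem lsum_apply (h : ℕ → Module.End k V) (hh : ∀ v, ∃ N : ℕ, ∀ j, N ≤ j → h j v = 0) {v : V}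
    {N : ℕ} (hN : ∀ j, N ≤ j → h j v = 0) : lsum h hh v = ∑ j ∈ Finset.range N, h j v := by
  change ∑ᶠ j, h j v = _
  refine finsum_eq_sum_of_support_subset _ fun j hj => ?_
  by_contra hc
  exact hj (hN j (by simpa using hc))

/-- The modes in the family `A` kill each vector, for large index. -/
def Trunc (A : ℤ → Module.End k V) : Prop := ∀ v, ∃ N : ℤ, ∀ n, N ≤ n → A n v = 0

/-- Division of `A(z) B(w)` by `z - w`, expanded in `|z| > |w|`. -/
def divProd (A B : ℤ → Module.End k V) (hB : Trunc B) (p q : ℤ) : Module.End k V :=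
  lsum (fun j => A (p - 1 - j) * B (q + j)) fun v => by
    obtain ⟨N, hN⟩ := hB v
    refine ⟨(N - q).toNat, fun j hj => ?_⟩
    rw [Module.End.mul_apply, hN _ (by omega), map_zero]

theorem divProd_vanish (A B : ℤ → Module.End k V) (hB : Trunc B) {v : V} {N : ℤ}
    (hN : ∀ n, N ≤ n → B n v = 0) (p q : ℤ) (hq : N ≤ q) : divProd A B hB p q v = 0 := by
  rw [divProd, lsum_apply (N := 0)]
  · simp
  · intro j _
    rw [Module.End.mul_apply, hN _ (by omega), map_zero]

theorem divProd_succ (A B : ℤ → Module.End k V) (hB : Trunc B) (p q : ℤ) :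
    divProd A B hB (p + 1) q = divProd A B hB p (q + 1) + A p * B q := by
  ext v
  obtain ⟨N, hN⟩ := hB v
  set j₀ := (N - q).toNat
  rw [LinearMap.add_apply, divProd, divProd, lsum_apply (N := j₀ + 1), lsum_apply (N := j₀),
    Finset.sum_range_succ']
  · congr 1
    · refine Finset.sum_congr rfl fun j _ => ?_
      rw [show p + 1 - 1 - ((j + 1 : ℕ) : ℤ) = p - 1 - j by push_cast; ring,
        show q + ((j + 1 : ℕ) : ℤ) = q + 1 + j by push_cast; ring]
    · simp
  · intro j hj; rw [Module.End.mul_apply, hN _ (by omega), map_zero]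
  · intro j hj; rw [Module.End.mul_apply, hN _ (by omega), map_zero]

theorem dd_divProd (A B : ℤ → Module.End k V) (hB : Trunc B) :
    dd (divProd A B hB) = fun p q => A p * B q := by
  funext p q; rw [dd, divProd_succ]; abel

theorem end_eq_zero_of_dd {f : ℤ → ℤ → Module.End k V}
    (h : ∀ v, ∃ M₀ : ℤ, ∀ m n, M₀ ≤ n → f m n v = 0) (hd : dd f = 0) : f = 0 := by
  funext m n; ext v
  obtain ⟨M₀, hM⟩ := h v
  have e : dd (fun m n => f m n v) = 0 := by
    funext m n
    exact congrArg (fun a : Module.End k V => a v) (congrFun (congrFun hd m) n)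
  exact congrFun (congrFun (eq_zero_of_dd_eq_zero M₀ hM e) m) n

/-- A vanishing condition in the second variable, uniform in the first one. -/
def Vanish₂ (X : ℤ → ℤ → ℤ → Module.End k V) : Prop :=
  ∀ v r, ∃ M₀ : ℤ, ∀ p q, M₀ ≤ q → X p q r v = 0

theorem Vanish₂.d13 {X : ℤ → ℤ → ℤ → Module.End k V} (h : Vanish₂ X) : Vanish₂ (d13 (Module.End k V) X) := by
  intro v r
  obtain ⟨a, ha⟩ := h v r
  obtain ⟨b, hb⟩ := h v (r + 1)
  refine ⟨max a b, fun p q hq => ?_⟩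
  rw [d13_apply, LinearMap.sub_apply, ha _ _ ((le_max_left _ _).trans hq),
    hb _ _ ((le_max_right _ _).trans hq), sub_zero]

theorem Vanish₂.d23 {X : ℤ → ℤ → ℤ → Module.End k V} (h : Vanish₂ X) : Vanish₂ (d23 (Module.End k V) X) := by
  intro v r
  obtain ⟨a, ha⟩ := h v r
  obtain ⟨b, hb⟩ := h v (r + 1)
  refine ⟨max a b, fun p q hq => ?_⟩
  have := le_max_left a b
  have := le_max_right a b
  rw [d23_apply, LinearMap.sub_apply, ha _ _ (by omega), hb _ _ (by omega), sub_zero]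

theorem Vanish₂.pow {X : ℤ → ℤ → ℤ → Module.End k V} (h : Vanish₂ X) (a b : ℕ) :
    Vanish₂ ((VertexCoalg.d13 (Module.End k V) ^ a) ((VertexCoalg.d23 (Module.End k V) ^ b) X)) := by
  have h1 : Vanish₂ ((VertexCoalg.d23 (Module.End k V) ^ b) X) := by
    induction b with
    | zero => exact h
    | succ b ih => rw [pow_succ', Module.End.mul_apply]; exact ih.d23
  induction a with
  | zero => exact h1
  | succ a ih => rw [pow_succ', Module.End.mul_apply]; exact ih.d13

/-- The relation of `cm₃_prod` passes to the quotient of `A(z) B(w)` by `z - w`, because multiplication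
by `z - w` is injective on families which satisfy `Vanish₂`. -/
theorem divProd_locRel {A B C : ℤ → Module.End k V} (hB : Trunc B) {N : ℕ}
    (hA : dd^[N] (cm A C) = 0) (hB' : dd^[N] (cm B C) = 0) :
    (d13 (Module.End k V) ^ N) ((d23 (Module.End k V) ^ N) (cm₃ (divProd A B hB) C)) = 0 := by
  have hv : Vanish₂ (cm₃ (divProd A B hB) C) := by
    intro v r
    obtain ⟨a, ha⟩ := hB v
    obtain ⟨b, hb⟩ := hB (C r v)
    refine ⟨max a b, fun p q hq => ?_⟩
    rw [cm₃, LinearMap.sub_apply, Module.End.mul_apply, Module.End.mul_apply,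
      divProd_vanish A B hB ha p q ((le_max_left _ _).trans hq),
      divProd_vanish A B hB hb p q ((le_max_right _ _).trans hq)]
    simp
  have hv' := hv.pow N N
  set Y := (d13 (Module.End k V) ^ N) ((d23 (Module.End k V) ^ N) (cm₃ (divProd A B hB) C)) with hY
  have h12 : d12 (Module.End k V) Y = 0 := by
    have h1 := cm₃_prod hA hB'
    rw [← dd_divProd A B hB, cm₃_dd] at h1
    rw [hY, ← h1]
    simp only [← Module.End.mul_apply]
    have c1 := ((commute_d12_d13 (M := Module.End k V)).pow_right N).eq
    have c2 := ((commute_d12_d23 (M := Module.End k V)).pow_right N).eq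
    rw [← mul_assoc, c1, mul_assoc, c2, ← mul_assoc]
  funext p q r
  have := end_eq_zero_of_dd (f := fun p q => Y p q r) (fun v => hv' v r) (by
    funext p q
    exact congrFun (congrFun (congrFun h12 p) q) r)
  exact congrFun (congrFun this p) q

/-- Division of `[A(z), B(w)]` by `z - w`, where the two products are expanded in their respective
domains. Its residue in `z` is the normally ordered product. -/
def normProd (A B : ℤ → Module.End k V) (hA : Trunc A) (hB : Trunc B) (p q : ℤ) :
    Module.End k V :=
  divProd A B hB p q + divProd B A hA q p

theorem dd_normProd (A B : ℤ → Module.End k V) (hA : Trunc A) (hB : Trunc B) :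
    dd (normProd A B hA hB) = cm A B := by
  funext p q
  simp only [dd, normProd, divProd_succ, cm]
  abel

theorem normProd_isLoc {A B : ℤ → Module.End k V} (hA : Trunc A) (hB : Trunc B)
    (h : IsLoc (cm A B)) : IsLoc (normProd A B hA hB) := by
  obtain ⟨N, hN⟩ := h
  exact ⟨N + 1, by rw [iterate_succ_apply, dd_normProd, hN]⟩

theorem normProd_locRel {A B C : ℤ → Module.End k V} (hA : Trunc A) (hB : Trunc B)
    (hAC : IsLoc (cm A C)) (hBC : IsLoc (cm B C)) : LocRel (normProd A B hA hB) C := by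
  obtain ⟨a, ha⟩ := hAC
  obtain ⟨b, hb⟩ := hBC
  have ha' := dd_iter_mono (le_max_left a b) ha
  have hb' := dd_iter_mono (le_max_right a b) hb
  refine ⟨max a b, ?_⟩
  have e : cm₃ (normProd A B hA hB) C = cm₃ (divProd A B hB) C +
      fun p q r => cm₃ (divProd B A hA) C q p r := by
    funext p q r; simp [cm₃, normProd]; noncomm_ring
  rw [e, map_add, map_add, divProd_locRel hB ha' hb', d23_pow_swap, d13_pow_swap,
    ← Module.End.mul_apply, ← (commute_d13_d23.pow_pow _ _).eq, Module.End.mul_apply,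
    divProd_locRel hA hb' ha', zero_add]
  rfl

end Fields

/-! ### Reconstruction of a vertex algebra from mutually local generating fields -/

section Goddard

variable {k : Type u} [Field k] {V : Type v} [AddCommGroup V] [Module k V]
  {U : Type w} [AddCommGroup U] [Module k U] {G : Type*}

/-- Mutually local families of modes on `V` with a vacuum vector `one` and a translation operator
`D`, such that `V` is spanned by the vectors obtained from the vacuum by applying modes. -/
structure IsGenerating (g : G → ℤ → Module.End k V) (one : V) (D : Module.End k V) : Prop where
  loc : ∀ a b, IsLoc (cm (g a) (g b))
  create : ∀ a n, 0 ≤ n → g a n one = 0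
  D_one : D one = 0
  D_comm : ∀ a n, D * g a n - g a n * D = -n • g a (n - 1)
  span : ∀ P : Submodule k V, one ∈ P → (∀ a n, ∀ v ∈ P, g a n v ∈ P) → P = ⊤

/-- Modes which are mutually local and annihilate the vacuum for nonnegative indices are fields on
the subspace generated by the vacuum. -/
theorem eventually_zero_of_loc {g : G → ℤ → Module.End k V} {one : V}
    (loc : ∀ a b, IsLoc (cm (g a) (g b))) (create : ∀ a n, 0 ≤ n → g a n one = 0)
    (P : Submodule k V)
    (hP : ∀ Q : Submodule k V, one ∈ Q → (∀ a n, ∀ v ∈ Q, g a n v ∈ Q) → P ≤ Q) :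
    ∀ v ∈ P, ∀ a, ∃ N : ℤ, ∀ n, N ≤ n → g a n v = 0 := by
  let Q : Submodule k V :=
    { carrier := {v | ∀ a, ∃ N : ℤ, ∀ n, N ≤ n → g a n v = 0}
      zero_mem' := fun a => ⟨0, fun n _ => map_zero _⟩
      add_mem' := by
        intro v w hv hw a
        obtain ⟨N, hN⟩ := hv a
        obtain ⟨N', hN'⟩ := hw a
        refine ⟨max N N', fun n hn => ?_⟩
        rw [map_add, hN n ((le_max_left _ _).trans hn), hN' n ((le_max_right _ _).trans hn),
          add_zero]
      smul_mem' := by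
        intro c v hv a
        obtain ⟨N, hN⟩ := hv a
        exact ⟨N, fun n hn => by rw [map_smul, hN n hn, smul_zero]⟩ }
  refine hP Q (fun a => ⟨0, fun n hn => create a n hn⟩) fun b m v hv a => ?_
  obtain ⟨N, hN⟩ := loc a b
  obtain ⟨N₀, hN₀⟩ := hv a
  obtain ⟨M₀, hM₀⟩ := hv b
  refine eventually_zero_of_dd_iter (f := fun n m => g a n (g b m v)) (N := N) (N₀ := N₀)
    (M₀ := M₀) (fun n m hm => by rw [hM₀ m hm, map_zero]) (fun n m hn => ?_) m
  have e : (fun n m => g a n (g b m v)) =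
      (fun n m => cm (g a) (g b) n m v) + fun n m => g b m (g a n v) := by
    funext n m; simp [cm]
  have h1 := dd_iter_map (LinearMap.applyₗ' (M₂ := V) ℕ v).toAddMonoidHom N (cm (g a) (g b))
  have h1' : dd^[N] (fun n m => cm (g a) (g b) n m v) = 0 := by
    refine h1.trans ?_
    rw [hN]; funext n m; simp
  rw [e, dd_iter_add, h1', zero_add]
  have hsw : ∀ (j : ℕ) (f : ℤ → ℤ → V), (∀ n m, N₀ ≤ n → f n m = 0) →
      ∀ n m, N₀ ≤ n → dd^[j] f n m = 0 := by
    intro j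
    induction j with
    | zero => exact fun f h => h
    | succ j ih =>
      intro f h
      rw [iterate_succ_apply]
      exact ih _ fun n m hn => by simp [dd, h (n + 1) m (by omega), h n _ hn]
  exact hsw N _ (fun n m hn => by rw [hN₀ n hn, map_zero]) n m hn

/-- Goddard's uniqueness theorem: a field which is local relative to the generating fields and
annihilates the vacuum vanishes. -/
theorem goddard {g : G → ℤ → Module.End k V} {one : V} {D : Module.End k V}
    (hg : IsGenerating g one D) (gU : G → ℤ → Module.End k U) (E : ℤ → V →ₗ[k] U)
    (hE : ∀ a, IsLoc (fun n m => E n ∘ₗ g a m - gU a m ∘ₗ E n)) (h1 : ∀ n, E n one = 0) :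
    E = 0 := by
  have hP : ∀ v, ∀ n, E n v = 0 := by
    let P : Submodule k V := ⨅ n, LinearMap.ker (E n)
    have hPtop : P = ⊤ := by
      refine hg.span P (by simpa [P] using h1) fun a m v hv => ?_
      have hv' : ∀ n, E n v = 0 := by simpa [P] using hv
      obtain ⟨N₀, hN₀⟩ := eventually_zero_of_loc hg.loc hg.create ⊤
        (fun Q h1 h2 => (hg.span Q h1 h2).ge) v trivial a
      have := ((hE a).map (LinearMap.applyₗ' (M₂ := U) ℕ v).toAddMonoidHom).eq_zero N₀
        (fun n m hm => by simp [hN₀ m hm, hv'])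
      simp only [P, Submodule.mem_iInf, LinearMap.mem_ker]
      intro n
      simpa [hv'] using congrFun (congrFun this n) m
    intro v
    have : v ∈ P := hPtop ▸ Submodule.mem_top
    simpa [P] using this
  funext n; ext v; exact hP v n

end Goddard

section Reconstruction

variable {k : Type u} [Field k] {V : Type v} [AddCommGroup V] [Module k V] {G : Type w}
  {g : G → ℤ → Module.End k V} {one : V} {D : Module.End k V}

variable (g one D) in
/-- The family of modes `X` is a translation covariant field, local relative to the generating
fields, which creates the state `x` from the vacuum. -/
structure IsField (X : ℤ → Module.End k V) (x : V) : Prop where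
  trunc : Trunc X
  loc : ∀ a, IsLoc (cm X (g a))
  create : ∀ n, 0 ≤ n → X n one = 0
  state : X (-1) one = x
  D_comm : ∀ n, D * X n - X n * D = -n • X (n - 1)

theorem IsGenerating.trunc (hg : IsGenerating g one D) (a : G) : Trunc (g a) := fun v =>
  eventually_zero_of_loc hg.loc hg.create ⊤ (fun Q h1 h2 => (hg.span Q h1 h2).ge) v trivial a

theorem IsGenerating.isField (hg : IsGenerating g one D) (a : G) :
    IsField g one D (g a) (g a (-1) one) where
  trunc := hg.trunc a
  loc := hg.loc a
  create := hg.create a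
  state := rfl
  D_comm := hg.D_comm a

/-- The modes of a translation covariant field act on the vacuum by `X(-n-1)1 = Dⁿx / n!`. -/
theorem IsField.apply_one [CharZero k] (hD : D one = 0) {X : ℤ → Module.End k V} {x : V}
    (hX : IsField g one D X x) (n : ℕ) :
    X (-(n : ℤ) - 1) one = (n.factorial : k)⁻¹ • (D^[n]) x := by
  induction n with
  | zero => simp [hX.state]
  | succ n ih =>
    have h := congrArg (fun f : Module.End k V => f one) (hX.D_comm (-(n : ℤ) - 1))
    simp only [LinearMap.sub_apply, Module.End.mul_apply, hD, map_zero, sub_zero,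
      LinearMap.smul_apply, ih, map_smul] at h
    rw [iterate_succ_apply', show -((n + 1 : ℕ) : ℤ) - 1 = -(n : ℤ) - 1 - 1 by push_cast; ring]
    rw [Nat.factorial_succ, Nat.cast_mul, mul_inv, mul_smul, h,
      show -(-(n : ℤ) - 1) = ((n + 1 : ℕ) : ℤ) by push_cast; ring, natCast_zsmul,
      ← Nat.cast_smul_eq_nsmul k, smul_smul, inv_mul_cancel₀ (Nat.cast_ne_zero.mpr n.succ_ne_zero), one_smul]

theorem IsField.unique [CharZero k] (hg : IsGenerating g one D) {X X' : ℤ → Module.End k V} {x : V}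
    (hX : IsField g one D X x) (hX' : IsField g one D X' x) : X = X' := by
  rw [← sub_eq_zero]
  refine goddard hg g _ (fun a => ?_) fun n => ?_
  · convert (hX.loc a).sub (hX'.loc a) using 1
    funext m n
    simp only [cm, Pi.sub_apply, ← Module.End.mul_eq_comp]
    noncomm_ring
  · by_cases hn : 0 ≤ n
    · simp [hX.create n hn, hX'.create n hn]
    · obtain ⟨j, hj⟩ := Int.eq_ofNat_of_zero_le (show 0 ≤ -n - 1 by omega)
      obtain rfl : n = -(j : ℤ) - 1 := by omega
      simp [hX.apply_one hg.D_one, hX'.apply_one hg.D_one]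

theorem IsField.zero : IsField g one D 0 0 where
  trunc := fun v => ⟨0, fun n _ => rfl⟩
  loc := fun a => by
    have : cm 0 (g a) = 0 := by funext m n; simp [cm]
    rw [this]; exact IsLoc.zero
  create := fun n _ => rfl
  state := rfl
  D_comm := fun n => by simp

theorem cm_add (A B C : ℤ → Module.End k V) : cm (A + B) C = cm A C + cm B C := by
  funext m n; simp [cm]; noncomm_ring

theorem cm_smul (c : k) (A C : ℤ → Module.End k V) : cm (c • A) C = c • cm A C := by
  funext m n; simp [cm, smul_sub]

theorem IsLoc.smul (c : k) {f : ℤ → ℤ → Module.End k V} (hf : IsLoc f) : IsLoc (c • f) :=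
  hf.map (DistribSMul.toAddMonoidHom (Module.End k V) c)

theorem Trunc.add {A B : ℤ → Module.End k V} (hA : Trunc A) (hB : Trunc B) : Trunc (A + B) := by
  intro v
  obtain ⟨a, ha⟩ := hA v
  obtain ⟨b, hb⟩ := hB v
  refine ⟨max a b, fun n hn => ?_⟩
  simp [ha n ((le_max_left _ _).trans hn), hb n ((le_max_right _ _).trans hn)]

theorem IsField.add {X Y : ℤ → Module.End k V} {x y : V} (hX : IsField g one D X x)
    (hY : IsField g one D Y y) : IsField g one D (X + Y) (x + y) where
  trunc := hX.trunc.add hY.trunc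
  loc := fun a => by rw [cm_add]; exact (hX.loc a).add (hY.loc a)
  create := fun n hn => by simp [hX.create n hn, hY.create n hn]
  state := by simp [hX.state, hY.state]
  D_comm := fun n => by
    have := congrArg₂ (· + ·) (hX.D_comm n) (hY.D_comm n)
    simp only [Pi.add_apply, smul_add, ← this]
    noncomm_ring

theorem IsField.smul {X : ℤ → Module.End k V} {x : V} (c : k) (hX : IsField g one D X x) :
    IsField g one D (c • X) (c • x) where
  trunc := fun v => by
    obtain ⟨a, ha⟩ := hX.trunc v
    exact ⟨a, fun n hn => by simp [ha n hn]⟩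
  loc := fun a => by rw [cm_smul]; exact (hX.loc a).smul c
  create := fun n hn => by simp [hX.create n hn]
  state := by simp [hX.state]
  D_comm := fun n => by
    have := congrArg (c • ·) (hX.D_comm n)
    simp only [Pi.smul_apply, mul_smul_comm, smul_mul_assoc, ← smul_sub]
    rw [smul_comm]
    exact this

/-- The modes of the identity field. -/
def idField : ℤ → Module.End k V := fun n => if n = -1 then 1 else 0

theorem cm_idField (C : ℤ → Module.End k V) : cm idField C = 0 := by
  funext m n; by_cases h : m = -1 <;> simp [cm, idField, h]

theorem IsField.id : IsField g one D idField one where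
  trunc := fun v => ⟨0, fun n hn => by simp [idField, show n ≠ -1 by omega]⟩
  loc := fun a => by rw [cm_idField]; exact IsLoc.zero
  create := fun n hn => by simp [idField, show n ≠ -1 by omega]
  state := by simp [idField]
  D_comm := fun n => by
    by_cases h : n = -1
    · simp [idField, h]
    · by_cases h0 : n = 0
      · simp [idField, h0]
      · simp [idField, h, show n - 1 ≠ -1 by omega]

/-- The modes of the derivative of a field. -/
def derivField (X : ℤ → Module.End k V) : ℤ → Module.End k V := fun n => -n • X (n - 1)

theorem IsLoc.derivField {X C : ℤ → Module.End k V} (h : IsLoc (cm X C)) :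
    IsLoc (cm (derivField X) C) := by
  have h1 := (((h.fst_smul).add h).shift (-1) 0).neg
  convert h1 using 1
  funext m n
  simp only [cm, VertexCoalg.derivField, Pi.neg_apply, Pi.add_apply, ← sub_eq_add_neg, add_zero]
  rw [sub_smul, one_smul, sub_add_cancel]
  simp only [smul_mul_assoc, mul_smul_comm]
  module

theorem IsField.deriv (hD : D one = 0) {X : ℤ → Module.End k V} {x : V}
    (hX : IsField g one D X x) : IsField g one D (derivField X) (D x) where
  trunc := fun v => by
    obtain ⟨a, ha⟩ := hX.trunc v
    exact ⟨a + 1, fun n hn => by simp [derivField, ha (n - 1) (by omega)]⟩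
  loc := fun a => (hX.loc a).derivField
  create := fun n hn => by
    rcases hn.eq_or_lt with rfl | hn
    · simp [derivField]
    · simp [derivField, hX.create (n - 1) (by omega)]
  state := by
    have h := congrArg (fun f : Module.End k V => f one) (hX.D_comm (-1))
    simp only [LinearMap.sub_apply, Module.End.mul_apply, hD, map_zero, sub_zero, hX.state] at h
    rw [h]; rfl
  D_comm := fun n => by
    have := hX.D_comm (n - 1)
    simp only [derivField, mul_smul_comm, smul_mul_assoc, ← smul_sub, this]

/-- The residue in the first variable of a suitable distribution in two variables is a field. -/
theorem IsField.slice {P : ℤ → ℤ → Module.End k V} (hloc : IsLoc P)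
    (hrel : ∀ a, LocRel P (g a))
    (htr : ∀ v p, ∃ M : ℤ, ∀ q, M ≤ q → P p q v = 0)
    (hD : ∀ p q, D * P p q - P p q * D = -p • P (p - 1) q + -q • P p (q - 1))
    (hcr : ∀ q, 0 ≤ q → P 0 q one = 0) : IsField g one D (P 0) (P 0 (-1) one) where
  trunc := fun v => htr v 0
  loc := fun a => (hrel a).slice hloc
  create := hcr
  state := rfl
  D_comm := fun n => by simpa using hD 0 n

theorem cov_dd {P : ℤ → ℤ → Module.End k V}
    (hD : ∀ p q, D * P p q - P p q * D = -p • P (p - 1) q + -q • P p (q - 1)) (p q : ℤ) :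
    D * dd P p q - dd P p q * D = -p • dd P (p - 1) q + -q • dd P p (q - 1) := by
  have h1 := hD (p + 1) q
  have h2 := hD p (q + 1)
  have e : D * dd P p q - dd P p q * D =
    (D * P (p + 1) q - P (p + 1) q * D) - (D * P p (q + 1) - P p (q + 1) * D) := by
    simp only [dd]; noncomm_ring
  rw [e, h1, h2]
  simp only [dd, sub_add_cancel, add_sub_cancel_right]
  module

theorem cov_cm {A B : ℤ → Module.End k V} (hA : ∀ n, D * A n - A n * D = -n • A (n - 1))
    (hB : ∀ n, D * B n - B n * D = -n • B (n - 1)) (p q : ℤ) :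
    D * cm A B p q - cm A B p q * D = -p • cm A B (p - 1) q + -q • cm A B p (q - 1) := by
  have e : D * cm A B p q - cm A B p q * D =
      (D * A p - A p * D) * B q + A p * (D * B q - B q * D)
      - ((D * B q - B q * D) * A p + B q * (D * A p - A p * D)) := by
    simp only [cm]; noncomm_ring
  rw [e, hA, hB]
  simp only [cm, smul_mul_assoc, mul_smul_comm]
  module

theorem trunc_dd {P : ℤ → ℤ → Module.End k V}
    (htr : ∀ v p, ∃ M : ℤ, ∀ q, M ≤ q → P p q v = 0) :
    ∀ v p, ∃ M : ℤ, ∀ q, M ≤ q → dd P p q v = 0 := by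
  intro v p
  obtain ⟨a, ha⟩ := htr v (p + 1)
  obtain ⟨b, hb⟩ := htr v p
  refine ⟨max a b, fun q hq => ?_⟩
  have := le_max_left a b
  have := le_max_right a b
  simp [dd, ha q (by omega), hb (q + 1) (by omega)]

theorem cov_dd_iter {P : ℤ → ℤ → Module.End k V}
    (hD : ∀ p q, D * P p q - P p q * D = -p • P (p - 1) q + -q • P p (q - 1)) (n : ℕ) :
    ∀ p q, D * dd^[n] P p q - dd^[n] P p q * D =
      -p • dd^[n] P (p - 1) q + -q • dd^[n] P p (q - 1) := by
  induction n with
  | zero => exact hD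
  | succ n ih => rw [iterate_succ_apply']; exact cov_dd ih

theorem trunc_dd_iter {P : ℤ → ℤ → Module.End k V}
    (htr : ∀ v p, ∃ M : ℤ, ∀ q, M ≤ q → P p q v = 0) (n : ℕ) :
    ∀ v p, ∃ M : ℤ, ∀ q, M ≤ q → dd^[n] P p q v = 0 := by
  induction n with
  | zero => exact htr
  | succ n ih => rw [iterate_succ_apply']; exact trunc_dd ih

theorem trunc_cm {A B : ℤ → Module.End k V} (hB : Trunc B) :
    ∀ v p, ∃ M : ℤ, ∀ q, M ≤ q → cm A B p q v = 0 := by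
  intro v p
  obtain ⟨a, ha⟩ := hB v
  obtain ⟨b, hb⟩ := hB (A p v)
  refine ⟨max a b, fun q hq => ?_⟩
  have := le_max_left a b
  have := le_max_right a b
  simp [cm, ha q (by omega), hb q (by omega)]

theorem dd_iter_corner {M : Type*} [AddCommGroup M] {f : ℤ → ℤ → M}
    (h : ∀ p q, 0 ≤ p → 0 ≤ q → f p q = 0) (n : ℕ) :
    (∀ p q, 0 ≤ p → 0 ≤ q → dd^[n] f p q = 0) ∧ ∀ p, 0 ≤ p → dd^[n] f p (-1) = f (p + n) (-1) := by
  induction n with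
  | zero => exact ⟨h, fun p _ => by simp⟩
  | succ n ih =>
    obtain ⟨h1, h2⟩ := ih
    rw [iterate_succ_apply']
    refine ⟨fun p q hp hq => ?_, fun p hp => ?_⟩
    · simp [dd, h1 (p + 1) q (by omega) hq, h1 p (q + 1) hp (by omega)]
    · simp only [dd, h2 (p + 1) (by omega), h1 p (-1 + 1) hp (by omega), sub_zero]
      congr 1; push_cast; ring

/-- The `n`-th product of two mutually local fields for `n ≥ 0`. -/
theorem IsField.natProd {A B : ℤ → Module.End k V} {a b : V} (hA : IsField g one D A a)
    (hB : IsField g one D B b) (hAB : IsLoc (cm A B)) (n : ℕ) :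
    IsField g one D (dd^[n] (cm A B) 0) (A n b) := by
  have hc : ∀ p q, 0 ≤ p → 0 ≤ q → cm A B p q one = 0 := fun p q hp hq => by
    simp [cm, hA.create p hp, hB.create q hq]
  have hev : ∀ p q, dd^[n] (cm A B) p q one = dd^[n] (fun p q => cm A B p q one) p q := by
    intro p q
    have := dd_iter_map (LinearMap.applyₗ' (M₂ := V) ℕ one).toAddMonoidHom n (cm A B)
    exact (congrFun (congrFun this p) q).symm
  have hst : dd^[n] (cm A B) 0 (-1) one = A n b := by
    rw [hev, (dd_iter_corner hc n).2 0 le_rfl]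
    simp [cm, hB.state, hA.create (n : ℤ) (by omega)]
  rw [← hst]
  refine IsField.slice ?_ (fun c => ?_) ?_ ?_ ?_
  · obtain ⟨N, hN⟩ := hAB
    refine ⟨N, ?_⟩
    rw [← iterate_add_apply, add_comm, iterate_add_apply, hN, dd_iter_zero]
  · exact (LocRel.cm (hA.loc c) (hB.loc c)).dd_iter n
  · exact trunc_dd_iter (trunc_cm hB.trunc) n
  · exact cov_dd_iter (cov_cm hA.D_comm hB.D_comm) n
  · intro q hq
    rw [hev]
    exact (dd_iter_corner hc n).1 0 q le_rfl hq

theorem divProd_cov {A B : ℤ → Module.End k V} (hBt : Trunc B)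
    (hA : ∀ n, D * A n - A n * D = -n • A (n - 1))
    (hB : ∀ n, D * B n - B n * D = -n • B (n - 1)) (p q : ℤ) :
    D * divProd A B hBt p q - divProd A B hBt p q * D =
      -p • divProd A B hBt (p - 1) q + -q • divProd A B hBt p (q - 1) := by
  set Q := divProd A B hBt
  have hQ : ∀ p q, Q (p + 1) q = Q p (q + 1) + A p * B q := divProd_succ A B hBt
  rw [← sub_eq_zero]
  refine congrFun (congrFun (end_eq_zero_of_dd (f := fun p q => D * Q p q - Q p q * D -
    (-p • Q (p - 1) q + -q • Q p (q - 1))) (fun v => ?_) ?_) p) q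
  · obtain ⟨a, ha⟩ := hBt v
    obtain ⟨b, hb⟩ := hBt (D v)
    refine ⟨max a b + 1, fun m n hn => ?_⟩
    have := le_max_left a b
    have := le_max_right a b
    have h1 : ∀ m n, a ≤ n → Q m n v = 0 := divProd_vanish A B hBt ha
    have h2 : ∀ m n, b ≤ n → Q m n (D v) = 0 := divProd_vanish A B hBt hb
    simp [h1 m n (by omega), h2 m n (by omega), h1 (m - 1) n (by omega),
      h1 m (n - 1) (by omega)]
  · funext p q
    have e1 := hQ p q
    have e2 := hQ (p - 1) q
    have e3 := hQ p (q - 1)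
    rw [sub_add_cancel] at e2 e3
    simp only [dd, add_sub_cancel_right, Pi.zero_apply]
    rw [e1, e3, e2]
    have e4 : D * (Q p (q + 1) + A p * B q) - (Q p (q + 1) + A p * B q) * D =
      (D * Q p (q + 1) - Q p (q + 1) * D) + ((D * A p - A p * D) * B q +
      A p * (D * B q - B q * D)) := by noncomm_ring
    rw [e4, hA, hB]
    simp only [smul_mul_assoc, mul_smul_comm]
    module

/-- The normally ordered product of two mutually local fields. -/
theorem IsField.normProd {A B : ℤ → Module.End k V} {a b : V} (hA : IsField g one D A a)
    (hB : IsField g one D B b) (hAB : IsLoc (cm A B)) :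
    IsField g one D (normProd A B hA.trunc hB.trunc 0) (A (-1) b) := by
  have hz : ∀ q, 0 ≤ q → VertexCoalg.normProd A B hA.trunc hB.trunc 0 q one = 0 := by
    intro q hq
    rw [VertexCoalg.normProd, LinearMap.add_apply,
      divProd_vanish A B hB.trunc hB.create 0 q hq,
      divProd_vanish B A hA.trunc hA.create q 0 le_rfl, add_zero]
  have hst : VertexCoalg.normProd A B hA.trunc hB.trunc 0 (-1) one = A (-1) b := by
    have := divProd_succ A B hB.trunc (-1) (-1)
    rw [show (-1 : ℤ) + 1 = 0 by norm_num] at this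
    rw [VertexCoalg.normProd, LinearMap.add_apply, this, LinearMap.add_apply,
      divProd_vanish A B hB.trunc hB.create (-1) 0 le_rfl,
      divProd_vanish B A hA.trunc hA.create (-1) 0 le_rfl, Module.End.mul_apply, hB.state]
    simp
  rw [← hst]
  refine IsField.slice (normProd_isLoc _ _ hAB) (fun c => normProd_locRel _ _ (hA.loc c) (hB.loc c))
    (fun v p => ?_) (fun p q => ?_) hz
  · obtain ⟨N, hN⟩ := hB.trunc v
    obtain ⟨N', hN'⟩ := hA.trunc v
    choose M hM using fun j : ℕ => hB.trunc (A (p + j) v)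
    obtain ⟨M', hM'⟩ := ((Finset.range (N' - p).toNat).image fun j => M j + j + 1).bddAbove
    refine ⟨max N M', fun q hq => ?_⟩
    rw [VertexCoalg.normProd, LinearMap.add_apply,
      divProd_vanish A B hB.trunc hN p q ((le_max_left _ _).trans hq), zero_add, divProd,
      lsum_apply (N := (N' - p).toNat)]
    · refine Finset.sum_eq_zero fun j hj => ?_
      have h1 : M j + j + 1 ≤ M' := hM' (by
        simp only [Finset.coe_image]; exact ⟨j, by simpa using hj, rfl⟩)
      have := le_max_right N M'
      rw [Module.End.mul_apply, hM j _ (by omega)]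
    · intro j hj
      rw [Module.End.mul_apply, hN' _ (by omega), map_zero]
  · have h1 := divProd_cov hB.trunc hA.D_comm hB.D_comm p q
    have h2 := divProd_cov hA.trunc hB.D_comm hA.D_comm q p
    simp only [VertexCoalg.normProd]
    rw [mul_add, add_mul, add_sub_add_comm, h1, h2]
    module

variable [CharZero k]

/-- Every vector is the state of a field, which is moreover local relative to any given field `C`
in the same class. -/
theorem IsGenerating.exists_isField (hg : IsGenerating g one D) {C : ℤ → Module.End k V} {c : V}
    (hC : IsField g one D C c) (x : V) : ∃ X, IsField g one D X x ∧ IsLoc (cm X C) := by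
  let P : Submodule k V :=
    { carrier := {x | ∃ X, IsField g one D X x ∧ IsLoc (cm X C)}
      zero_mem' := ⟨0, IsField.zero, by
        have : cm 0 C = 0 := by funext m n; simp [cm]
        rw [this]; exact IsLoc.zero⟩
      add_mem' := by
        rintro x y ⟨X, hX, hX'⟩ ⟨Y, hY, hY'⟩
        exact ⟨X + Y, hX.add hY, by rw [cm_add]; exact hX'.add hY'⟩
      smul_mem' := by
        rintro r x ⟨X, hX, hX'⟩
        exact ⟨r • X, hX.smul r, by rw [cm_smul]; exact hX'.smul r⟩ }
  have hDP : ∀ x ∈ P, D x ∈ P := by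
    rintro x ⟨X, hX, hX'⟩
    exact ⟨derivField X, hX.deriv hg.D_one, hX'.derivField⟩
  have hnat : ∀ a (n : ℕ), ∀ x ∈ P, g a n x ∈ P := by
    rintro a n x ⟨X, hX, hX'⟩
    have hl := (hX.loc a).cm_symm
    refine ⟨_, (hg.isField a).natProd hX hl n, ?_⟩
    refine LocRel.slice ((LocRel.cm (hC.loc a).cm_symm hX').dd_iter n) ?_
    obtain ⟨N, hN⟩ := hl
    refine ⟨N, ?_⟩
    rw [← iterate_add_apply, add_comm, iterate_add_apply, hN, dd_iter_zero]
  have hneg : ∀ (n : ℕ) a, ∀ x ∈ P, g a (-(n : ℤ) - 1) x ∈ P := by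
    intro n a
    induction n with
    | zero =>
      rintro x ⟨X, hX, hX'⟩
      have hl := (hX.loc a).cm_symm
      exact ⟨_, by simpa using (hg.isField a).normProd hX hl,
        LocRel.slice (normProd_locRel _ _ (hC.loc a).cm_symm hX') (normProd_isLoc _ _ hl)⟩
    | succ n ih =>
      intro x hx
      -- The mode `a(-n-2)` is a multiple of the commutator of `D` with `a(-n-1)`.
      have h := congrArg (fun f : Module.End k V => f x) (hg.D_comm a (-(n : ℤ) - 1))
      simp only [LinearMap.sub_apply, Module.End.mul_apply, LinearMap.smul_apply] at h
      rw [show -(-(n : ℤ) - 1) = ((n + 1 : ℕ) : ℤ) by push_cast; ring, natCast_zsmul,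
        ← Nat.cast_smul_eq_nsmul k] at h
      have h2 : ((n + 1 : ℕ) : k) • g a (-(n : ℤ) - 1 - 1) x ∈ P := by
        rw [← h]; exact P.sub_mem (hDP _ (ih x hx)) (ih _ (hDP x hx))
      rw [show -((n + 1 : ℕ) : ℤ) - 1 = -(n : ℤ) - 1 - 1 by push_cast; ring]
      exact (P.smul_mem_iff (Nat.cast_ne_zero.mpr n.succ_ne_zero)).mp h2
  have hP : P = ⊤ := by
    refine hg.span P ⟨idField, IsField.id, by rw [cm_idField]; exact IsLoc.zero⟩ fun a n v hv => ?_
    by_cases hn : 0 ≤ n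
    · obtain ⟨j, rfl⟩ := Int.eq_ofNat_of_zero_le hn
      exact hnat a j v hv
    · obtain ⟨j, hj⟩ := Int.eq_ofNat_of_zero_le (show 0 ≤ -n - 1 by omega)
      obtain rfl : n = -(j : ℤ) - 1 := by omega
      exact hneg j a v hv
  have : x ∈ P := hP ▸ Submodule.mem_top
  exact this

/-- The state-field correspondence. -/
def stateField (hg : IsGenerating g one D) (x : V) : ℤ → Module.End k V :=
  (hg.exists_isField IsField.id x).choose

theorem stateField_isField (hg : IsGenerating g one D) (x : V) :
    IsField g one D (stateField hg x) x :=
  (hg.exists_isField IsField.id x).choose_spec.1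

theorem stateField_loc (hg : IsGenerating g one D) (x y : V) :
    IsLoc (cm (stateField hg x) (stateField hg y)) := by
  obtain ⟨X, hX, hX'⟩ := hg.exists_isField (stateField_isField hg y) x
  rwa [IsField.unique hg (stateField_isField hg x) hX]

theorem IsField.eq_stateField {X : ℤ → Module.End k V} {x : V} (hX : IsField g one D X x)
    (hg : IsGenerating g one D) : X = stateField hg x :=
  hX.unique hg (stateField_isField hg x)

theorem stateField_gen (hg : IsGenerating g one D) (a : G) :
    stateField hg (g a (-1) one) = g a :=
  ((hg.isField a).eq_stateField hg).symm

theorem stateField_commutator (hg : IsGenerating g one D) (m n : ℤ) (a b : V) :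
    ∃ N : ℕ, cm (stateField hg a) (stateField hg b) m n =
      ∑ s ∈ Finset.range N, (Ring.choose m s : ℤ) • stateField hg (stateField hg a s b) (m + n - s)
      ∧ ∀ s, N ≤ s → stateField hg (stateField hg a s b) = 0 := by
  have hl := stateField_loc hg a b
  have hs : ∀ s : ℕ, stateField hg (stateField hg a s b) =
      dd^[s] (cm (stateField hg a) (stateField hg b)) 0 := fun s =>
    (((stateField_isField hg a).natProd (stateField_isField hg b) hl s).eq_stateField hg).symm
  obtain ⟨N, hN⟩ := hl
  refine ⟨N, ?_, fun s hs' => ?_⟩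
  · rw [newton hN m n]
    exact Finset.sum_congr rfl fun s _ => by rw [hs]
  · rw [hs, dd_iter_mono hs' hN]; rfl

/-- The vertex algebra structure determined by generating fields. -/
def IsGenerating.vertexAlgebra (hg : IsGenerating g one D) : VertexAlgebra k V where
  prod n :=
    { toFun := fun x => stateField hg x n
      map_add' := fun x y => by
        rw [← ((stateField_isField hg x).add (stateField_isField hg y)).eq_stateField hg]; rfl
      map_smul' := fun c x => by
        rw [← ((stateField_isField hg x).smul c).eq_stateField hg]; rfl }
  one := one
  prod_eq_zero a b := (stateField_isField hg a).trunc b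
  one_prod n a := by
    change stateField hg one n a = _
    rw [← IsField.id.eq_stateField hg, idField]
    split_ifs <;> simp
  prod_one_of_nonneg n hn a := (stateField_isField hg a).create n hn
  prod_one n a := by
    have h : ∀ x, stateField hg x (-2) one = D x := fun x => by
      have := (stateField_isField hg x).apply_one hg.D_one 1
      simpa using this
    change stateField hg a _ one = _ • (fun x => stateField hg x (-2) one)^[n] a
    rw [(stateField_isField hg a).apply_one hg.D_one n]
    simp only [h]
  D_prod n a b := by
    have h : ∀ x, stateField hg x (-2) one = D x := fun x => by
      have := (stateField_isField hg x).apply_one hg.D_one 1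
      simpa using this
    change stateField hg (stateField hg a n b) (-2) one =
      stateField hg (stateField hg a (-2) one) n b + stateField hg a n (stateField hg b (-2) one)
    rw [h, h, h]
    have h1 := congrArg (fun f : Module.End k V => f b) ((stateField_isField hg a).D_comm n)
    simp only [LinearMap.sub_apply, Module.End.mul_apply] at h1
    rw [sub_eq_iff_eq_add] at h1
    rw [h1, ← ((stateField_isField hg a).deriv hg.D_one).eq_stateField hg]
    rfl
  prod_D n a b := by
    have h : ∀ x, stateField hg x (-2) one = D x := fun x => by
      have := (stateField_isField hg x).apply_one hg.D_one 1
      simpa using this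
    change stateField hg (stateField hg a (-2) one) n b = _
    rw [h, ← ((stateField_isField hg a).deriv hg.D_one).eq_stateField hg]
    rfl
  commutator m n a b c := by
    obtain ⟨N, h1, h2⟩ := stateField_commutator hg m n a b
    change stateField hg a m (stateField hg b n c) - stateField hg b n (stateField hg a m c) =
      ∑ᶠ s : ℕ, (Ring.choose m s : ℤ) • stateField hg (stateField hg a s b) (m + n - s) c
    rw [finsum_eq_sum_of_support_subset (s := Finset.range N)]
    · have := congrArg (fun f : Module.End k V => f c) h1
      simpa [cm] using this
    · intro s hs
      by_contra hc
      exact hs (by simp [h2 s (by simpa using hc)])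

theorem IsGenerating.prod_isField (hg : IsGenerating g one D) (x : V) :
    IsField g one D (fun n => hg.vertexAlgebra.prod n x) x :=
  stateField_isField hg x

theorem IsGenerating.prod_gen (hg : IsGenerating g one D) (a : G) (n : ℤ) :
    hg.vertexAlgebra.prod n (g a (-1) one) = g a n :=
  congrFun (stateField_gen hg a) n

theorem IsField.eq_prod {X : ℤ → Module.End k V} {x : V} (hX : IsField g one D X x)
    (hg : IsGenerating g one D) (n : ℤ) : hg.vertexAlgebra.prod n x = X n :=
  (congrFun (hX.eq_stateField hg) n).symm

end Reconstruction

/-! ### Operators compatible with the generating fields -/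

section Operators

variable {k : Type u} [Field k] {V : Type v} [AddCommGroup V] [Module k V]
  {G : Type w} {g : G → ℤ → Module.End k V} {one : V} {D : Module.End k V}

theorem IsGenerating.end_eq_zero (hg : IsGenerating g one D) {φ : Module.End k V}
    (h1 : φ one = 0) (h : ∀ a n, φ * g a n = g a n * φ) : φ = 0 := by
  have : LinearMap.ker φ = ⊤ := hg.span _ h1 fun a n v hv => by
    rw [LinearMap.mem_ker] at hv ⊢
    rw [← Module.End.mul_apply, h, Module.End.mul_apply, hv, map_zero]
  exact LinearMap.ker_eq_top.mp this

/-- An operator which acts on the generating fields as a grading acts on the translation operator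
accordingly. -/
theorem IsGenerating.grading_comm (hg : IsGenerating g one D) {δ : Module.End k V} {c : G → ℤ}
    {ε : ℤ} (h1 : δ one = 0) (hδ : ∀ a n, δ * g a n - g a n * δ = (c a - ε * (n + 1)) • g a n) :
    δ * D - D * δ = ε • D := by
  rw [← sub_eq_zero]
  refine hg.end_eq_zero (by simp [h1, hg.D_one]) fun a n => ?_
  rw [← sub_eq_zero]
  have e : (δ * D - D * δ - ε • D) * g a n - g a n * (δ * D - D * δ - ε • D) =
      δ * (D * g a n - g a n * D) - (D * g a n - g a n * D) * δ
      - (D * (δ * g a n - g a n * δ) - (δ * g a n - g a n * δ) * D)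
      - ε • (D * g a n - g a n * D) := by
    simp only [sub_mul, mul_sub, smul_mul_assoc, mul_smul_comm, smul_sub, mul_assoc]
    abel
  rw [e, hg.D_comm, hδ]
  have e2 : δ * (-n • g a (n - 1)) - (-n • g a (n - 1)) * δ =
      -n • (δ * g a (n - 1) - g a (n - 1) * δ) := by
    rw [mul_smul_comm, smul_mul_assoc, smul_sub]
  have e3 : D * ((c a - ε * (n + 1)) • g a n) - ((c a - ε * (n + 1)) • g a n) * D =
      (c a - ε * (n + 1)) • (D * g a n - g a n * D) := by
    rw [mul_smul_comm, smul_mul_assoc, smul_sub]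
  rw [e2, e3, hδ, hg.D_comm]
  module

/-- A derivation of the generating fields which is homogeneous in the mode number maps fields to
fields. Together with the uniqueness of fields, this makes it act on all products as on the
generators. The cases `ε = 1` and `ε = 0` serve for the degree and for the counting operators. -/
theorem IsField.grading (hg : IsGenerating g one D) {δ : Module.End k V} {c : G → ℤ}
    {ε : ℤ} (h1 : δ one = 0) (hδ : ∀ a n, δ * g a n - g a n * δ = (c a - ε * (n + 1)) • g a n)
    {X : ℤ → Module.End k V} {x : V} (hX : IsField g one D X x) :
    IsField g one D (fun n => δ * X n - X n * δ + (ε * (n + 1)) • X n) (δ x) where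
  trunc v := by
    obtain ⟨a, ha⟩ := hX.trunc v
    obtain ⟨b, hb⟩ := hX.trunc (δ v)
    refine ⟨max a b, fun n hn => ?_⟩
    simp [ha n ((le_max_left _ _).trans hn), hb n ((le_max_right _ _).trans hn)]
  loc a := by
    have hl := hX.loc a
    -- The commutator with `g a` is a combination of local distributions.
    have h2 := ((hl.map (AddMonoidHom.mulLeft δ)).sub (hl.map (AddMonoidHom.mulRight δ))).add
      ((((hl.fst_smul.add hl.snd_smul).add hl).add hl).map
        (DistribSMul.toAddMonoidHom (Module.End k V) ε))
    have h3 := h2.sub (hl.map (DistribSMul.toAddMonoidHom (Module.End k V) (c a)))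
    convert h3 using 1
    funext m n
    have hδ' := hδ a n
    simp only [cm, Pi.add_apply, Pi.sub_apply, AddMonoidHom.coe_mulLeft, AddMonoidHom.coe_mulRight,
      DistribSMul.toAddMonoidHom_apply]
    have e : (δ * X m - X m * δ + (ε * (m + 1)) • X m) * g a n -
        g a n * (δ * X m - X m * δ + (ε * (m + 1)) • X m) =
        δ * (X m * g a n - g a n * X m) - (X m * g a n - g a n * X m) * δ
        - (X m * (δ * g a n - g a n * δ) - (δ * g a n - g a n * δ) * X m)
        + (ε * (m + 1)) • (X m * g a n - g a n * X m) := by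
      generalize ε * (m + 1) = t
      simp only [add_mul, mul_add, sub_mul, mul_sub, smul_mul_assoc, mul_smul_comm, smul_sub,
        mul_assoc]
      abel
    rw [e, hδ', mul_smul_comm, smul_mul_assoc]
    module
  create n hn := by simp [h1, hX.create n hn]
  state := by simp [h1, hX.state]
  D_comm n := by
    have hD := hX.D_comm n
    have hc := hg.grading_comm h1 hδ
    have e : D * (δ * X n - X n * δ + (ε * (n + 1)) • X n) -
        (δ * X n - X n * δ + (ε * (n + 1)) • X n) * D =
        δ * (D * X n - X n * D) - (D * X n - X n * D) * δ -
        ((δ * D - D * δ) * X n - X n * (δ * D - D * δ)) +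
        (ε * (n + 1)) • (D * X n - X n * D) := by
      generalize ε * (n + 1) = t
      simp only [add_mul, mul_add, sub_mul, mul_sub, smul_mul_assoc, mul_smul_comm, smul_sub,
        mul_assoc]
      abel
    have e2 : (ε • D) * X n - X n * (ε • D) = ε • (D * X n - X n * D) := by
      rw [mul_smul_comm, smul_mul_assoc, smul_sub]
    rw [e, hc, e2, hD, mul_smul_comm, smul_mul_assoc]
    module

theorem IsGenerating.special_comm (hg : IsGenerating g one D) {H E : Module.End k V} {c : G → ℤ}
    (hH1 : H one = 0) (hH : ∀ a n, H * g a n - g a n * H = (c a - (n + 1)) • g a n)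
    (hE1 : E one = 0) (hE : ∀ a n, E * g a n - g a n * E = (2 * c a - n - 2) • g a (n + 1)) :
    E * D - D * E = (2 : ℤ) • H := by
  rw [← sub_eq_zero]
  refine hg.end_eq_zero (by simp [hE1, hg.D_one, hH1]) fun a n => ?_
  rw [← sub_eq_zero]
  have e : (E * D - D * E - (2 : ℤ) • H) * g a n - g a n * (E * D - D * E - (2 : ℤ) • H) =
      E * (D * g a n - g a n * D) - (D * g a n - g a n * D) * E
      - (D * (E * g a n - g a n * E) - (E * g a n - g a n * E) * D)
      - (2 : ℤ) • (H * g a n - g a n * H) := by noncomm_ring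
  rw [e, hg.D_comm, hE, hH]
  have e2 : E * (-n • g a (n - 1)) - (-n • g a (n - 1)) * E =
      -n • (E * g a (n - 1) - g a (n - 1) * E) := by
    rw [mul_smul_comm, smul_mul_assoc, smul_sub]
  have e3 : D * ((2 * c a - n - 2) • g a (n + 1)) - ((2 * c a - n - 2) • g a (n + 1)) * D =
      (2 * c a - n - 2) • (D * g a (n + 1) - g a (n + 1) * D) := by
    rw [mul_smul_comm, smul_mul_assoc, smul_sub]
  rw [e2, e3, hE, hg.D_comm]
  simp only [sub_add_cancel, add_sub_cancel_right]
  module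

/-- The analogue of `IsField.grading` for `D*`, on fields which are homogeneous of degree `d`. -/
theorem IsField.special (hg : IsGenerating g one D) {H E : Module.End k V} {c : G → ℤ}
    (hH1 : H one = 0) (hH : ∀ a n, H * g a n - g a n * H = (c a - (n + 1)) • g a n)
    (hE1 : E one = 0) (hE : ∀ a n, E * g a n - g a n * E = (2 * c a - n - 2) • g a (n + 1))
    {X : ℤ → Module.End k V} {x : V} (hX : IsField g one D X x) {d : ℤ}
    (hHX : ∀ n, H * X n - X n * H = (d - (n + 1)) • X n) :
    IsField g one D (fun n => E * X n - X n * E - (2 * d - n - 2) • X (n + 1)) (E x) where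
  trunc v := by
    obtain ⟨a, ha⟩ := hX.trunc v
    obtain ⟨b, hb⟩ := hX.trunc (E v)
    refine ⟨max a b, fun n hn => ?_⟩
    have := le_max_left a b
    have := le_max_right a b
    simp [ha n (by omega), hb n (by omega), ha (n + 1) (by omega)]
  loc a := by
    have hl := hX.loc a
    have h1 := (hl.map (AddMonoidHom.mulLeft E)).sub (hl.map (AddMonoidHom.mulRight E))
    have h2 := (hl.shift 0 1).map (DistribSMul.toAddMonoidHom (Module.End k V) (2 * c a - 2))
    have h3 := (hl.shift 0 1).snd_smul
    have h4 := (hl.shift 1 0).map (DistribSMul.toAddMonoidHom (Module.End k V) (2 * d - 2))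
    have h5 := (hl.shift 1 0).fst_smul
    convert (h1.sub (h2.sub h3)).sub (h4.sub h5) using 1
    funext m n
    simp only [cm, Pi.sub_apply, AddMonoidHom.coe_mulLeft, AddMonoidHom.coe_mulRight,
      DistribSMul.toAddMonoidHom_apply, add_zero]
    have e : (E * X m - X m * E - (2 * d - m - 2) • X (m + 1)) * g a n -
        g a n * (E * X m - X m * E - (2 * d - m - 2) • X (m + 1)) =
        E * (X m * g a n - g a n * X m) - (X m * g a n - g a n * X m) * E
        - (X m * (E * g a n - g a n * E) - (E * g a n - g a n * E) * X m)
        - (2 * d - m - 2) • (X (m + 1) * g a n - g a n * X (m + 1)) := by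
      rw [sub_mul _ (_ • _), mul_sub _ _ (_ • _), smul_mul_assoc, mul_smul_comm,
        smul_sub (2 * d - m - 2)]
      noncomm_ring
    rw [e, hE, mul_smul_comm, smul_mul_assoc]
    module
  create n hn := by simp [hE1, hX.create n hn, hX.create (n + 1) (by omega)]
  state := by simp [hE1, hX.state, hX.create 0 le_rfl]
  D_comm n := by
    have hD := hX.D_comm n
    have hD1 := hX.D_comm (n + 1)
    have hc := hg.special_comm hH1 hH hE1 hE
    have e : D * (E * X n - X n * E - (2 * d - n - 2) • X (n + 1)) -
        (E * X n - X n * E - (2 * d - n - 2) • X (n + 1)) * D =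
        E * (D * X n - X n * D) - (D * X n - X n * D) * E -
        ((E * D - D * E) * X n - X n * (E * D - D * E)) -
        (2 * d - n - 2) • (D * X (n + 1) - X (n + 1) * D) := by
      rw [sub_mul _ (_ • _), mul_sub _ _ (_ • _), smul_mul_assoc, mul_smul_comm,
        smul_sub (2 * d - n - 2)]
      noncomm_ring
    have e2 : ((2 : ℤ) • H) * X n - X n * ((2 : ℤ) • H) = (2 : ℤ) • (H * X n - X n * H) := by
      rw [mul_smul_comm, smul_mul_assoc, smul_sub]
    rw [e, hc, e2, hD, hD1, hHX, mul_smul_comm, smul_mul_assoc]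
    simp only [sub_add_cancel, add_sub_cancel_right]
    module

variable [CharZero k]

/-- Operators which act on the generating fields as a grading are derivations of all products, up
to the shift of the degree. -/
theorem IsGenerating.grading_prod (hg : IsGenerating g one D) {δ : Module.End k V} {c : G → ℤ}
    {ε : ℤ} (h1 : δ one = 0) (hδ : ∀ a n, δ * g a n - g a n * δ = (c a - ε * (n + 1)) • g a n)
    (n : ℤ) (x y : V) : δ (hg.vertexAlgebra.prod n x y) =
      hg.vertexAlgebra.prod n (δ x) y + hg.vertexAlgebra.prod n x (δ y)
        - (ε * (n + 1)) • hg.vertexAlgebra.prod n x y := by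
  rw [((hg.prod_isField x).grading hg h1 hδ).eq_prod hg]
  simp only [LinearMap.sub_apply, LinearMap.add_apply, Module.End.mul_apply, LinearMap.smul_apply]
  module

theorem IsGenerating.grading_eigen (hg : IsGenerating g one D) {δ : Module.End k V} {c : G → ℤ}
    {ε : ℤ} (h1 : δ one = 0) (hδ : ∀ a n, δ * g a n - g a n * δ = (c a - ε * (n + 1)) • g a n)
    {i j : ℤ} {x y : V} (hx : δ x = i • x) (hy : δ y = j • y) (n : ℤ) :
    δ (hg.vertexAlgebra.prod n x y) = (i + j - ε * (n + 1)) • hg.vertexAlgebra.prod n x y := by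
  rw [hg.grading_prod h1 hδ, hx, hy]
  simp only [map_zsmul, LinearMap.smul_apply]
  module

/-- An operator which acts on the generating fields as `D*` on fields of minimal vectors satisfies
the commutation relation of `D*` with all homogeneous fields. -/
theorem IsGenerating.special_prod (hg : IsGenerating g one D) {H E : Module.End k V} {c : G → ℤ}
    (hH1 : H one = 0) (hH : ∀ a n, H * g a n - g a n * H = (c a - (n + 1)) • g a n)
    (hE1 : E one = 0) (hE : ∀ a n, E * g a n - g a n * E = (2 * c a - n - 2) • g a (n + 1))
    {d : ℤ} {x : V} (hx : H x = d • x) (m : ℤ) (y : V) :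
    E (hg.vertexAlgebra.prod m x y) - hg.vertexAlgebra.prod m x (E y) =
      (2 * d - m - 2) • hg.vertexAlgebra.prod (m + 1) x y + hg.vertexAlgebra.prod m (E x) y := by
  have hH' : ∀ a n, H * g a n - g a n * H = (c a - 1 * (n + 1)) • g a n := by simpa using hH
  have hX : ∀ n, H * hg.vertexAlgebra.prod n x - hg.vertexAlgebra.prod n x * H =
      (d - (n + 1)) • hg.vertexAlgebra.prod n x := by
    intro n
    ext y
    have := hg.grading_prod hH1 hH' n x y
    simp only [LinearMap.sub_apply, Module.End.mul_apply, this, hx, map_zsmul,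
      LinearMap.smul_apply]
    module
  rw [((hg.prod_isField x).special hg hH1 hH hE1 hE hX).eq_prod hg]
  simp only [LinearMap.sub_apply, Module.End.mul_apply, LinearMap.smul_apply]
  abel

end Operators

/-! ### Rational functions and their expansions -/

section RationalFunctions

variable {k : Type u} [Field k] {l : ℕ}

theorem ofPoly_injective : Injective (ofPoly (k := k) (l := l)) :=
  IsFractionRing.injective (MvPolynomial (Fin l) k) (RatFn k l)

theorem ofPoly_mul (p q : MvPolynomial (Fin l) k) : ofPoly (p * q) = ofPoly p * ofPoly q :=
  map_mul _ _ _
theorem ofPoly_add (p q : MvPolynomial (Fin l) k) : ofPoly (p + q) = ofPoly p + ofPoly q :=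
  map_add _ _ _
theorem ofPoly_sub (p q : MvPolynomial (Fin l) k) : ofPoly (p - q) = ofPoly p - ofPoly q :=
  map_sub _ _ _
theorem ofPoly_pow (p : MvPolynomial (Fin l) k) (n : ℕ) : ofPoly (p ^ n) = ofPoly p ^ n :=
  map_pow _ _ _
theorem ofPoly_one : ofPoly (1 : MvPolynomial (Fin l) k) = 1 := map_one _
theorem ofPoly_zero : ofPoly (0 : MvPolynomial (Fin l) k) = 0 := map_zero _
theorem ofPoly_C (c : k) : ofPoly (MvPolynomial.C c : MvPolynomial (Fin l) k) =
    algebraMap k (RatFn k l) c :=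
  (IsScalarTower.algebraMap_apply k (MvPolynomial (Fin l) k) (RatFn k l) c).symm
theorem ofPoly_X (i : Fin l) : ofPoly (MvPolynomial.X i : MvPolynomial (Fin l) k) = z i := rfl

theorem ofPoly_ne_zero {p : MvPolynomial (Fin l) k} (hp : p ≠ 0) : ofPoly p ≠ 0 := fun h =>
  hp (ofPoly_injective (h.trans ofPoly_zero.symm))

theorem exists_eq_div (α : RatFn k l) :
    ∃ p q : MvPolynomial (Fin l) k, q ≠ 0 ∧ α = ofPoly p / ofPoly q := by
  obtain ⟨p, q, hq, h⟩ := IsFractionRing.div_surjective (A := MvPolynomial (Fin l) k) α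
  exact ⟨p, q, nonZeroDivisors.ne_zero hq, h.symm⟩

theorem permAct_z (σ : Equiv.Perm (Fin l)) (i : Fin l) : permAct k σ (z i) = z (σ i) := by
  rw [z, permAct_ofPoly, MvPolynomial.rename_X]; rfl

theorem permAct_mul (σ τ : Equiv.Perm (Fin l)) (α : RatFn k l) :
    permAct k (σ * τ) α = permAct k σ (permAct k τ α) := by
  obtain ⟨p, q, -, rfl⟩ := exists_eq_div α
  simp only [map_div₀, permAct_ofPoly, MvPolynomial.rename_rename]
  rfl

theorem permAct_one (α : RatFn k l) : permAct k 1 α = α := by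
  obtain ⟨p, q, -, rfl⟩ := exists_eq_div α
  simp only [map_div₀, permAct_ofPoly]
  simp [Equiv.Perm.coe_one, MvPolynomial.rename_id]

theorem permAct_inv_apply (σ : Equiv.Perm (Fin l)) (α : RatFn k l) :
    permAct k σ⁻¹ (permAct k σ α) = α := by
  rw [← permAct_mul, inv_mul_cancel, permAct_one]

/-! #### Partial derivatives -/

theorem pd_ofPoly (i : Fin l) (p : MvPolynomial (Fin l) k) :
    pd i (ofPoly p) = ofPoly (MvPolynomial.pderiv i p) := by
  have := pd_div i p 1 one_ne_zero
  simpa [ofPoly_one, ofPoly_sub, ofPoly_zero] using this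

theorem pd_add (i : Fin l) (α β : RatFn k l) : pd i (α + β) = pd i α + pd i β := by
  obtain ⟨p, q, hq, rfl⟩ := exists_eq_div α
  obtain ⟨r, s, hs, rfl⟩ := exists_eq_div β
  have hq' := ofPoly_ne_zero hq
  have hs' := ofPoly_ne_zero hs
  rw [div_add_div _ _ hq' hs', ← ofPoly_mul, ← ofPoly_mul, ← ofPoly_mul, ← ofPoly_add,
    pd_div i _ _ (mul_ne_zero hq hs), pd_div i _ _ hq, pd_div i _ _ hs]
  simp only [Derivation.leibniz, smul_eq_mul, map_add, ofPoly_sub, ofPoly_mul, ofPoly_add]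
  field_simp
  ring

theorem pd_mul (i : Fin l) (α β : RatFn k l) : pd i (α * β) = pd i α * β + α * pd i β := by
  obtain ⟨p, q, hq, rfl⟩ := exists_eq_div α
  obtain ⟨r, s, hs, rfl⟩ := exists_eq_div β
  have hq' := ofPoly_ne_zero hq
  have hs' := ofPoly_ne_zero hs
  rw [div_mul_div_comm, ← ofPoly_mul, ← ofPoly_mul,
    pd_div i _ _ (mul_ne_zero hq hs), pd_div i _ _ hq, pd_div i _ _ hs]
  simp only [Derivation.leibniz, smul_eq_mul, ofPoly_sub, ofPoly_mul, ofPoly_add]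
  field_simp
  ring

theorem pd_algebraMap (i : Fin l) (c : k) : pd i (algebraMap k (RatFn k l) c) = 0 := by
  rw [← ofPoly_C, pd_ofPoly, MvPolynomial.pderiv_C, ofPoly_zero]

theorem pd_smul (i : Fin l) (c : k) (α : RatFn k l) : pd i (c • α) = c • pd i α := by
  rw [Algebra.smul_def, pd_mul, pd_algebraMap, zero_mul, zero_add, ← Algebra.smul_def]

theorem pd_z (i j : Fin l) : pd i (z j : RatFn k l) = if i = j then 1 else 0 := by
  rw [z, pd_ofPoly, MvPolynomial.pderiv_X]
  by_cases h : i = j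
  · subst h; simp [ofPoly_one]
  · simp [h, eq_comm, ofPoly_zero]

theorem permAct_pd (σ : Equiv.Perm (Fin l)) (i : Fin l) (α : RatFn k l) :
    permAct k σ (pd i α) = pd (σ i) (permAct k σ α) := by
  obtain ⟨p, q, hq, rfl⟩ := exists_eq_div α
  have hq' : MvPolynomial.rename σ q ≠ 0 := fun h =>
    hq (MvPolynomial.rename_injective _ σ.injective (h.trans (map_zero _).symm))
  rw [map_div₀, permAct_ofPoly, permAct_ofPoly, pd_div _ _ _ hq', pd_div _ _ _ hq, map_div₀,
    map_pow, permAct_ofPoly, permAct_ofPoly, map_sub, map_mul, map_mul,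
    MvPolynomial.pderiv_rename σ.injective, MvPolynomial.pderiv_rename σ.injective]

/-! #### Adding a variable -/

/-- Shift of the variables of a polynomial, with values in rational functions. -/
def embPoly : MvPolynomial (Fin l) k →ₐ[k] RatFn k (l + 1) :=
  (IsScalarTower.toAlgHom k (MvPolynomial (Fin (l + 1)) k) (RatFn k (l + 1))).comp
    (MvPolynomial.rename Fin.succ)

theorem embPoly_injective : Injective (embPoly (k := k) (l := l)) :=
  (IsFractionRing.injective (MvPolynomial (Fin (l + 1)) k) (RatFn k (l + 1))).comp
    (MvPolynomial.rename_injective _ (Fin.succ_injective l))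

/-- Rational functions in `z_1, …, z_l`, as rational functions in `z_0, …, z_l`. -/
def emb : RatFn k l →ₐ[k] RatFn k (l + 1) :=
  IsFractionRing.liftAlgHom (g := embPoly (k := k) (l := l)) embPoly_injective

theorem emb_ofPoly (p : MvPolynomial (Fin l) k) :
    emb (ofPoly p) = ofPoly (MvPolynomial.rename Fin.succ p) := by
  have h : (emb : RatFn k l →ₐ[k] RatFn k (l + 1)).toRingHom =
      IsFractionRing.lift (embPoly_injective (k := k) (l := l)) := rfl
  exact (congrArg (fun f => f (ofPoly p)) h).trans
    (IsFractionRing.lift_algebraMap (embPoly_injective (k := k)) p)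

theorem emb_z (i : Fin l) : emb (z i : RatFn k l) = z i.succ := by
  rw [z, emb_ofPoly, MvPolynomial.rename_X]; rfl

theorem expandAtInfty_z_zero :
    expandAtInfty (z 0 : RatFn k (l + 1)) = HahnSeries.single (-1) 1 := by
  rw [z, expandAtInfty_ofPoly]; simp [polyExpand]

theorem expandAtInfty_emb (r : RatFn k l) : expandAtInfty (emb r) = HahnSeries.C r := by
  have h : ∀ p : MvPolynomial (Fin l) k,
      expandAtInfty (emb (ofPoly p)) = HahnSeries.C (ofPoly p) := by
    intro p
    rw [emb_ofPoly, expandAtInfty_ofPoly]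
    induction p using MvPolynomial.induction_on with
    | C a => simp [polyExpand, ofPoly_C]
    | add p q hp hq => rw [map_add, map_add, hp, hq, ofPoly_add, map_add]
    | mul_X p i hp =>
      rw [map_mul, map_mul, hp, ofPoly_mul, map_mul, MvPolynomial.rename_X]
      simp [polyExpand, z]
  obtain ⟨p, q, -, rfl⟩ := exists_eq_div r
  rw [map_div₀, map_div₀, map_div₀, h, h]

theorem expandAtInfty_injective : Injective (expandAtInfty (k := k) (l := l)) :=
  RingHom.injective _

theorem coeffAtInfty_add (n : ℤ) (α β : RatFn k (l + 1)) :
    coeffAtInfty n (α + β) = coeffAtInfty n α + coeffAtInfty n β := by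
  simp [coeffAtInfty]

theorem coeffAtInfty_emb_mul (n : ℤ) (r : RatFn k l) (α : RatFn k (l + 1)) :
    coeffAtInfty n (emb r * α) = r * coeffAtInfty n α := by
  simp [coeffAtInfty, expandAtInfty_emb]

variable (k l) in
/-- The coefficient of `z_0^{-n-1}`, as a linear map. -/
def coeffL (n : ℤ) : RatFn k (l + 1) →ₗ[k] RatFn k l where
  toFun := coeffAtInfty n
  map_add' := coeffAtInfty_add n
  map_smul' c α := by
    rw [Algebra.smul_def, ← AlgHom.commutes emb, coeffAtInfty_emb_mul, ← Algebra.smul_def]; rfl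

theorem coeffL_apply (n : ℤ) (α : RatFn k (l + 1)) : coeffL k l n α = coeffAtInfty n α := rfl

theorem coeffL_emb_mul (n : ℤ) (r : RatFn k l) (α : RatFn k (l + 1)) :
    coeffL k l n (emb r * α) = r * coeffL k l n α := coeffAtInfty_emb_mul n r α

theorem coeffL_z_zero_mul (n : ℤ) (α : RatFn k (l + 1)) :
    coeffL k l n (z 0 * α) = coeffL k l (n + 1) α := by
  simp only [coeffL_apply, coeffAtInfty, map_mul, expandAtInfty_z_zero, HahnSeries.coeff_single_mul]
  rw [one_mul]; congr 1

theorem coeffL_z_succ_mul (n : ℤ) (i : Fin l) (α : RatFn k (l + 1)) :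
    coeffL k l n (z i.succ * α) = z i * coeffL k l n α := by
  rw [← emb_z, coeffL_emb_mul]

theorem coeffL_emb (n : ℤ) (r : RatFn k l) :
    coeffL k l n (emb r) = if n = -1 then r else 0 := by
  simp only [coeffL_apply, coeffAtInfty, expandAtInfty_emb, HahnSeries.C_apply,
    HahnSeries.coeff_single]
  by_cases h : n = -1
  · simp [h]
  · rw [if_neg h, if_neg (by omega)]

theorem coeffL_ext {α β : RatFn k (l + 1)} (h : ∀ n, coeffL k l n α = coeffL k l n β) : α = β := by
  apply expandAtInfty_injective
  ext n
  have := h (n - 1)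
  simpa [coeffL_apply, coeffAtInfty] using this

theorem coeffL_vanish (α : RatFn k (l + 1)) : ∃ n₀ : ℤ, ∀ n, n < n₀ → coeffL k l n α = 0 := by
  refine ⟨(expandAtInfty α).order - 1, fun n hn => ?_⟩
  change (expandAtInfty α).coeff (n + 1) = 0
  exact HahnSeries.coeff_eq_zero_of_lt_order (by omega)

theorem constValue_algebraMap (c : k) : constValue (algebraMap k (RatFn k 0) c) = c := by
  rw [← ofPoly_C, constValue_ofPoly]
  exact (MvPolynomial.isEmptyAlgEquiv k (Fin 0)).commutes c

variable (k) in
/-- An iterated expansion coefficient, as a linear map. -/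
def coeffIterL (m : Fin l → ℤ) : RatFn k l →ₗ[k] k where
  toFun α := coeffIter l α m
  map_add' α β := by
    induction l with
    | zero => exact map_add _ _ _
    | succ l ih => simp only [coeffIter, coeffAtInfty_add, ih]
  map_smul' c α := by
    induction l with
    | zero =>
      change constValue _ = c * constValue _
      rw [Algebra.smul_def, map_mul, constValue_algebraMap]
    | succ l ih =>
      have : coeffAtInfty (m 0) (c • α) = c • coeffAtInfty (m 0) α := (coeffL k l (m 0)).map_smul c α
      simp only [coeffIter, this, ih]

theorem coeffIterL_apply (m : Fin l → ℤ) (α : RatFn k l) : coeffIterL k m α = coeffIter l α m := rfl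

theorem coeffIterL_succ (m : Fin (l + 1) → ℤ) (α : RatFn k (l + 1)) :
    coeffIterL k m α = coeffIterL k (Fin.tail m) (coeffL k l (m 0) α) := rfl

theorem coeffIterL_cons (n : ℤ) (m : Fin l → ℤ) (α : RatFn k (l + 1)) :
    coeffIterL k (Fin.cons n m : Fin (l + 1) → ℤ) α = coeffIterL k m (coeffL k l n α) := by
  rw [coeffIterL_succ, Fin.tail_cons, Fin.cons_zero]

theorem eq_algebraMap_of_zero (α : RatFn k 0) : α = algebraMap k _ (constValue α) := by
  obtain ⟨p, q, hq, rfl⟩ := exists_eq_div α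
  obtain ⟨a, rfl⟩ := MvPolynomial.C_surjective (R := k) (Fin 0) p
  obtain ⟨b, rfl⟩ := MvPolynomial.C_surjective (R := k) (Fin 0) q
  rw [map_div₀, ofPoly_C, ofPoly_C, constValue_algebraMap, constValue_algebraMap, map_div₀]

theorem coeffIterL_ext {α β : RatFn k l} (h : ∀ m, coeffIterL k m α = coeffIterL k m β) :
    α = β := by
  induction l with
  | zero =>
    rw [eq_algebraMap_of_zero α, eq_algebraMap_of_zero β]
    exact congrArg _ (h 0)
  | succ l ih =>
    refine coeffL_ext fun n => ih fun m => ?_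
    rw [← coeffIterL_cons, ← coeffIterL_cons, h]

theorem coeffIterL_z_mul (i : Fin l) (α : RatFn k l) (m : Fin l → ℤ) :
    coeffIterL k m (z i * α) = coeffIterL k (m + Pi.single i 1) α := by
  induction l with
  | zero => exact i.elim0
  | succ l ih =>
    rw [coeffIterL_succ, coeffIterL_succ]
    induction i using Fin.cases with
    | zero =>
      rw [coeffL_z_zero_mul]
      have : Fin.tail (m + Pi.single 0 1) = Fin.tail m := by
        funext j; simp [Fin.tail]
      rw [this]; simp
    | succ i =>
      rw [coeffL_z_succ_mul, ih]
      have : Fin.tail (m + Pi.single i.succ 1) = Fin.tail m + Pi.single i 1 := by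
        funext j; simp [Fin.tail, Pi.single_apply]
      rw [this]; simp [(Fin.succ_ne_zero i).symm]

/-! #### Expansions, permutations and derivatives -/

/-- The extension of a permutation of `z_1, …, z_l` to a permutation of `z_0, …, z_l`. -/
def extPerm (σ : Equiv.Perm (Fin l)) : Equiv.Perm (Fin (l + 1)) :=
  Equiv.Perm.decomposeFin.symm (0, σ)

theorem extPerm_zero (σ : Equiv.Perm (Fin l)) : extPerm σ 0 = 0 := by simp [extPerm]
theorem extPerm_succ (σ : Equiv.Perm (Fin l)) (i : Fin l) : extPerm σ i.succ = (σ i).succ := by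
  simp [extPerm]

theorem permAct_emb (σ : Equiv.Perm (Fin l)) (r : RatFn k l) :
    permAct k (extPerm σ) (emb r) = emb (permAct k σ r) := by
  obtain ⟨p, q, -, rfl⟩ := exists_eq_div r
  simp only [map_div₀, emb_ofPoly, permAct_ofPoly, MvPolynomial.rename_rename]
  have : extPerm σ ∘ Fin.succ = Fin.succ ∘ σ := by funext i; simp [extPerm_succ]
  rw [this]

/-- Induction for polynomials in `z_0, …, z_l`: these are generated by `z_0` and the functions of the
other variables. -/
theorem polyGen_induction {P : RatFn k (l + 1) → Prop} (hadd : ∀ α β, P α → P β → P (α + β))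
    (hmul : ∀ α β, P α → P β → P (α * β)) (hemb : ∀ r, P (emb r)) (hz : P (z 0))
    (p : MvPolynomial (Fin (l + 1)) k) : P (ofPoly p) := by
  induction p using MvPolynomial.induction_on with
  | C a => rw [ofPoly_C, ← AlgHom.commutes emb]; exact hemb _
  | add p q hp hq => rw [ofPoly_add]; exact hadd _ _ hp hq
  | mul_X p i hp =>
    rw [ofPoly_mul]
    refine hmul _ _ hp ?_
    induction i using Fin.cases with
    | zero => exact hz
    | succ i => rw [ofPoly_X, ← emb_z]; exact hemb _

theorem expandAtInfty_permAct (σ : Equiv.Perm (Fin l)) (α : RatFn k (l + 1)) :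
    expandAtInfty (permAct k (extPerm σ) α) = (expandAtInfty α).map (permAct k σ) := by
  have hm : ∀ x y : LaurentSeries (RatFn k l), (x * y).map (permAct k σ) =
      x.map (permAct k σ) * y.map (permAct k σ) := fun x y =>
    HahnSeries.map_mul ((permAct k σ : RatFn k l →+* RatFn k l) : RatFn k l →ₙ+* RatFn k l)
  have key : ∀ p : MvPolynomial (Fin (l + 1)) k, expandAtInfty (permAct k (extPerm σ) (ofPoly p)) =
      (expandAtInfty (ofPoly p)).map (permAct k σ) := by
    refine polyGen_induction (P := fun β => expandAtInfty (permAct k (extPerm σ) β) =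
      (expandAtInfty β).map (permAct k σ)) (fun α β h1 h2 => ?_) (fun α β h1 h2 => ?_)
      (fun r => ?_) ?_
    · rw [map_add, map_add, h1, h2, map_add]; ext n; simp
    · rw [map_mul, map_mul, h1, h2, map_mul, hm]
    · rw [permAct_emb, expandAtInfty_emb, expandAtInfty_emb]
      ext n; by_cases h : n = 0 <;> simp [h]
    · rw [permAct_z, extPerm_zero, expandAtInfty_z_zero]
      ext n; by_cases h : n = -1 <;> simp [h]
  obtain ⟨p, q, hq, rfl⟩ := exists_eq_div α
  have hq' := ofPoly_ne_zero hq
  have h0 : expandAtInfty (permAct k (extPerm σ) (ofPoly q)) ≠ 0 := by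
    simpa using hq'
  apply mul_right_cancel₀ h0
  rw [← map_mul, ← map_mul, div_mul_cancel₀ _ hq', key, key, ← hm, ← map_mul,
    div_mul_cancel₀ _ hq']

theorem coeffL_permAct (σ : Equiv.Perm (Fin l)) (n : ℤ) (α : RatFn k (l + 1)) :
    coeffL k l n (permAct k (extPerm σ) α) = permAct k σ (coeffL k l n α) := by
  simp only [coeffL_apply, coeffAtInfty, expandAtInfty_permAct]
  rfl

/-- Apply additive maps to the coefficients of a Laurent series. -/
def mapCoeff (d : ℤ → RatFn k l →+ RatFn k l) (x : LaurentSeries (RatFn k l)) :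
    LaurentSeries (RatFn k l) where
  coeff i := d i (x.coeff i)
  isPWO_support' := x.isPWO_support.mono fun i hi h => hi (by simp [h])

theorem mapCoeff_mul {d : ℤ → RatFn k l →+ RatFn k l}
    (hd : ∀ i j a b, d (i + j) (a * b) = d i a * b + a * d j b) (x y : LaurentSeries (RatFn k l)) :
    mapCoeff d (x * y) = mapCoeff d x * y + x * mapCoeff d y := by
  ext n
  have hx : (mapCoeff d x).support ⊆ x.support := fun i hi h => hi (by simp [mapCoeff, h])
  have hy : (mapCoeff d y).support ⊆ y.support := fun i hi h => hi (by simp [mapCoeff, h])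
  rw [HahnSeries.coeff_add, HahnSeries.coeff_mul_left' x.isPWO_support hx,
    HahnSeries.coeff_mul_right' y.isPWO_support hy]
  change d n ((x * y).coeff n) = _
  rw [HahnSeries.coeff_mul, map_sum, ← Finset.sum_add_distrib]
  refine Finset.sum_congr rfl fun ij hij => ?_
  have := (Finset.mem_antidiagonal.mp hij).2.2
  rw [← this, hd]
  rfl

/-- A derivation which agrees on the generators with a derivation of Laurent series agrees with it
on all rational functions. -/
theorem expandAtInfty_derivation (θ : RatFn k (l + 1) → RatFn k (l + 1))
    (hadd : ∀ α β, θ (α + β) = θ α + θ β) (hmul : ∀ α β, θ (α * β) = θ α * β + α * θ β)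
    {d : ℤ → RatFn k l →+ RatFn k l}
    (hd : ∀ i j a b, d (i + j) (a * b) = d i a * b + a * d j b)
    (hemb : ∀ r, expandAtInfty (θ (emb r)) = mapCoeff d (expandAtInfty (emb r)))
    (hz : expandAtInfty (θ (z 0)) = mapCoeff d (expandAtInfty (z 0))) (α : RatFn k (l + 1)) :
    expandAtInfty (θ α) = mapCoeff d (expandAtInfty α) := by
  have key : ∀ p : MvPolynomial (Fin (l + 1)) k,
      expandAtInfty (θ (ofPoly p)) = mapCoeff d (expandAtInfty (ofPoly p)) := by
    refine polyGen_induction (P := fun β => expandAtInfty (θ β) = mapCoeff d (expandAtInfty β))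
      (fun α β h1 h2 => ?_) (fun α β h1 h2 => ?_) hemb hz
    · rw [hadd, map_add, h1, h2]; ext n; simp [mapCoeff]
    · rw [hmul, map_add, map_mul, map_mul, h1, h2, map_mul, mapCoeff_mul hd]
  obtain ⟨p, q, hq, rfl⟩ := exists_eq_div α
  have hq' := ofPoly_ne_zero hq
  set α := ofPoly p / ofPoly q with hα
  have hp : α * ofPoly q = ofPoly p := div_mul_cancel₀ _ hq'
  have h1 := key p
  rw [← hp, hmul, map_mul, map_add, map_mul, map_mul, mapCoeff_mul hd, key q, add_left_inj] at h1
  exact mul_right_cancel₀ (by simpa using hq') h1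

theorem pd_emb (i : Fin l) (r : RatFn k l) : pd i.succ (emb r) = emb (pd i r) := by
  obtain ⟨p, q, hq, rfl⟩ := exists_eq_div r
  have hq' : MvPolynomial.rename Fin.succ q ≠ 0 := fun h =>
    hq (MvPolynomial.rename_injective _ (Fin.succ_injective l) (h.trans (map_zero _).symm))
  rw [map_div₀, emb_ofPoly, emb_ofPoly, pd_div _ _ _ hq', pd_div _ _ _ hq, map_div₀,
    map_pow, emb_ofPoly, emb_ofPoly, map_sub, map_mul, map_mul,
    MvPolynomial.pderiv_rename (Fin.succ_injective l),
    MvPolynomial.pderiv_rename (Fin.succ_injective l)]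

theorem pd_zero_emb (r : RatFn k l) : pd 0 (emb r) = 0 := by
  have h : ∀ p : MvPolynomial (Fin l) k,
      MvPolynomial.pderiv 0 (MvPolynomial.rename Fin.succ p) = 0 := by
    intro p
    induction p using MvPolynomial.induction_on with
    | C a => simp
    | add p q hp hq => simp [hp, hq]
    | mul_X p i hp =>
      simp [Derivation.leibniz, hp, MvPolynomial.pderiv_X, Fin.succ_ne_zero]
  obtain ⟨p, q, hq, rfl⟩ := exists_eq_div r
  have hq' : MvPolynomial.rename Fin.succ q ≠ 0 := fun h =>
    hq (MvPolynomial.rename_injective _ (Fin.succ_injective l) (h.trans (map_zero _).symm))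
  rw [map_div₀, emb_ofPoly, emb_ofPoly, pd_div _ _ _ hq', h, h]
  simp [ofPoly_zero]

theorem coeffL_pd_succ (i : Fin l) (n : ℤ) (α : RatFn k (l + 1)) :
    coeffL k l n (pd i.succ α) = pd i (coeffL k l n α) := by
  have := expandAtInfty_derivation (fun α => pd i.succ α) (pd_add _) (pd_mul _)
    (d := fun _ => AddMonoidHom.mk' (fun a => pd i a) (pd_add i)) (fun _ _ a b => pd_mul i a b)
    (fun r => by
      simp only [pd_emb, expandAtInfty_emb]
      ext n
      have h0 : pd i (0 : RatFn k l) = 0 := (AddMonoidHom.mk' (fun a => pd i a) (pd_add i)).map_zero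
      by_cases h : n = 0 <;> simp [mapCoeff, HahnSeries.coeff_single, h, h0])
    (by
      have h0 : pd i (0 : RatFn k l) = 0 := (AddMonoidHom.mk' (fun a => pd i a) (pd_add i)).map_zero
      have h1 : pd i (1 : RatFn k l) = 0 := by
        rw [← map_one (algebraMap k (RatFn k l)), pd_algebraMap]
      simp only [pd_z, Fin.succ_ne_zero, if_false, map_zero, expandAtInfty_z_zero]
      ext n
      by_cases h : n = -1 <;> simp [mapCoeff, HahnSeries.coeff_single, h, h0, h1]) α
  exact congrArg (fun x => HahnSeries.coeff x (n + 1)) this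

theorem coeffL_pd_zero (n : ℤ) (α : RatFn k (l + 1)) :
    coeffL k l n (pd 0 α) = -n • coeffL k l (n - 1) α := by
  have := expandAtInfty_derivation (fun α => z 0 * pd 0 α) (fun α β => by rw [pd_add, mul_add])
    (fun α β => by rw [pd_mul]; ring)
    (d := fun i => AddMonoidHom.mk' (fun a => -i • a) (smul_add _)) (fun i j a b => by
      simp only [AddMonoidHom.mk'_apply, zsmul_eq_mul]
      push_cast; ring)
    (fun r => by
      simp only [pd_zero_emb, mul_zero, map_zero, expandAtInfty_emb]
      ext n
      by_cases h : n = 0 <;> simp [mapCoeff, HahnSeries.coeff_single, h])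
    (by
      simp only [pd_z, if_true, mul_one, expandAtInfty_z_zero]
      ext n
      by_cases h : n = -1 <;> simp [mapCoeff, HahnSeries.coeff_single, h]) α
  have h2 := congrArg (fun x => HahnSeries.coeff x n) this
  have h3 := coeffL_z_zero_mul (n - 1) (pd 0 α)
  rw [sub_add_cancel] at h3
  rw [← h3]
  simpa [coeffL_apply, coeffAtInfty, mapCoeff] using h2

end RationalFunctions

/-! ### The `sl₂` operators on rational functions -/

section Sl2Operators

variable {k : Type u} [Field k] {l : ℕ}

/-- The operator `∑ (z_i^s ∂/∂z_i + s n_i z_i^{s-1})`. For `s = 0` it is `Δ`, for `s = 2` it is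
`Δ*(2n_0, …, 2n_{l-1})`, and for `s = 1` the Euler operator shifted by `∑ n_i`. -/
def wop (s : ℕ) (n : Fin l → ℤ) : RatFn k l →ₗ[k] RatFn k l where
  toFun α := ∑ i, (z i ^ s * pd i α + ((s * n i : ℤ) : RatFn k l) * z i ^ (s - 1) * α)
  map_add' α β := by
    rw [← Finset.sum_add_distrib]
    refine Finset.sum_congr rfl fun i _ => ?_
    rw [pd_add]; ring
  map_smul' c α := by
    rw [RingHom.id_apply, Finset.smul_sum]
    refine Finset.sum_congr rfl fun i _ => ?_
    rw [pd_smul, smul_add, mul_smul_comm, mul_smul_comm]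

theorem wop_apply (s : ℕ) (n : Fin l → ℤ) (α : RatFn k l) : wop s n α =
    ∑ i, (z i ^ s * pd i α + ((s * n i : ℤ) : RatFn k l) * z i ^ (s - 1) * α) := rfl

theorem wop_zero (n : Fin l → ℤ) (α : RatFn k l) : wop 0 n α = Delta α := by
  simp [wop_apply, Delta]

theorem wop_two (n : Fin l → ℤ) (α : RatFn k l) :
    wop 2 n α = DeltaStar (fun i => 2 * n i) α := by
  simp [wop_apply, DeltaStar]

theorem coeffL_z_zero_pow_mul (s : ℕ) (n : ℤ) (α : RatFn k (l + 1)) :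
    coeffL k l n (z 0 ^ s * α) = coeffL k l (n + s) α := by
  induction s generalizing n with
  | zero => simp
  | succ s ih =>
    rw [pow_succ', mul_assoc, coeffL_z_zero_mul, ih]
    congr 2; push_cast; ring

theorem coeffL_z_succ_pow_mul (s : ℕ) (n : ℤ) (i : Fin l) (α : RatFn k (l + 1)) :
    coeffL k l n (z i.succ ^ s * α) = z i ^ s * coeffL k l n α := by
  rw [← emb_z, ← map_pow, coeffL_emb_mul]

theorem coeffL_intCast_mul (c n : ℤ) (α : RatFn k (l + 1)) :
    coeffL k l n ((c : RatFn k (l + 1)) * α) = (c : RatFn k l) * coeffL k l n α := by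
  rw [← zsmul_eq_mul, map_zsmul, zsmul_eq_mul]

/-- Taking the coefficient at `z_0 = ∞` commutes with the `sl₂` operators up to the term which the
variable `z_0` contributes. This becomes the commutator of a mode with `D`, the degree, and `D*`. -/
theorem coeffL_wop (s : ℕ) (n : Fin (l + 1) → ℤ) (m : ℤ) (α : RatFn k (l + 1)) :
    coeffL k l m (wop s n α) = wop s (Fin.tail n) (coeffL k l m α) +
      (s * n 0 - m - s) • coeffL k l (m + s - 1) α := by
  rw [wop_apply, Fin.sum_univ_succ, map_add, map_add, map_sum, add_comm]
  congr 1
  · rw [wop_apply]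
    refine Finset.sum_congr rfl fun i _ => ?_
    rw [map_add, coeffL_z_succ_pow_mul, coeffL_pd_succ, mul_assoc, coeffL_intCast_mul,
      coeffL_z_succ_pow_mul, mul_assoc]
    rfl
  · rw [coeffL_z_zero_pow_mul, coeffL_pd_zero, mul_assoc, coeffL_intCast_mul,
      coeffL_z_zero_pow_mul, ← zsmul_eq_mul]
    rcases s with _ | s
    · simp
    · rw [show m + ((s + 1 - 1 : ℕ) : ℤ) = m + ((s + 1 : ℕ) : ℤ) - 1 by push_cast; ring]
      module

theorem permAct_wop (s : ℕ) (n : Fin l → ℤ) (σ : Equiv.Perm (Fin l)) (α : RatFn k l) :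
    permAct k σ (wop s (n ∘ σ) α) = wop s n (permAct k σ α) := by
  rw [wop_apply, wop_apply, map_sum, ← Equiv.sum_comp σ fun i => z i ^ s *
    pd i (permAct k σ α) + ((s * n i : ℤ) : RatFn k l) * z i ^ (s - 1) * permAct k σ α]
  refine Finset.sum_congr rfl fun i _ => ?_
  simp [permAct_pd, permAct_z]

/-- The Euler operator. -/
def euler (α : RatFn k l) : RatFn k l := ∑ i, z i * pd i α

theorem wop_one (n : Fin l → ℤ) (α : RatFn k l) :
    wop 1 n α = euler α + (∑ i, n i) • α := by
  rw [wop_apply, euler, Finset.sum_add_distrib]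
  simp [Finset.sum_smul]

theorem euler_eq_wop (α : RatFn k l) : euler α = wop 1 0 α := by
  rw [wop_one]; simp

theorem euler_mul (α β : RatFn k l) : euler (α * β) = euler α * β + α * euler β := by
  simp only [euler, pd_mul, Finset.sum_mul, Finset.mul_sum, ← Finset.sum_add_distrib]
  exact Finset.sum_congr rfl fun i _ => by ring

theorem euler_ofPoly {p : MvPolynomial (Fin l) k} {n : ℕ} (hp : p.IsHomogeneous n) :
    euler (ofPoly p) = n • ofPoly p := by
  have h := congrArg (ofPoly (k := k) (l := l)) hp.sum_X_mul_pderiv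
  simp only [ofPoly, map_sum, map_mul, map_nsmul] at h
  rw [euler]
  refine Eq.trans ?_ h
  exact Finset.sum_congr rfl fun i _ => by rw [pd_ofPoly]; rfl

theorem IsHomog.euler {d : ℤ} {α : RatFn k l} (h : IsHomog d α) : euler α = d • α := by
  obtain ⟨p, q, m, n, hp, hq, hq0, rfl, hα⟩ := h
  have hq' := ofPoly_ne_zero hq0
  have h1 : α * ofPoly q = ofPoly p := by rw [hα, div_mul_cancel₀ _ hq']
  have h2 := euler_ofPoly hp
  rw [← h1, euler_mul, euler_ofPoly hq] at h2
  apply mul_right_cancel₀ hq'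
  simp only [sub_smul, natCast_zsmul, sub_mul, smul_mul_assoc]
  rw [← h2]
  simp only [nsmul_eq_mul]
  ring

theorem coeffL_euler {d : ℤ} {α : RatFn k (l + 1)} (h : euler α = d • α) (n : ℤ) :
    euler (coeffL k l n α) = (d + n + 1) • coeffL k l n α := by
  have h1 := coeffL_wop 1 0 n α
  rw [← euler_eq_wop, h, map_zsmul] at h1
  have : Fin.tail (0 : Fin (l + 1) → ℤ) = 0 := rfl
  rw [this, ← euler_eq_wop] at h1
  simp only [Pi.zero_apply, mul_zero, Nat.cast_one, add_sub_cancel_right, zero_sub] at h1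
  rw [add_assoc, add_smul, h1]
  module

theorem coeffIterL_eq_zero [CharZero k] {d : ℤ} {α : RatFn k l} (h : euler α = d • α) {m : Fin l → ℤ}
    (hm : d + ∑ i, (m i + 1) ≠ 0) : coeffIterL k m α = 0 := by
  induction l generalizing d with
  | zero =>
    have h0 : d • α = 0 := by rw [← h]; simp [euler]
    have hd : d ≠ 0 := by simpa using hm
    have hα : α = 0 := by
      rw [← Int.cast_smul_eq_zsmul k] at h0
      exact (smul_eq_zero.mp h0).resolve_left (Int.cast_ne_zero.mpr hd)
    rw [hα, map_zero]
  | succ l ih =>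
    rw [coeffIterL_succ]
    refine ih (coeffL_euler h (m 0)) ?_
    rw [Fin.sum_univ_succ] at hm
    intro hc
    apply hm
    rw [← hc]
    simp only [Fin.tail]
    ring

end Sl2Operators

/-! ### Poles along the diagonals -/

section Poles

variable {k : Type u} [Field k] {l : ℕ}

variable (l) in
/-- The pairs of indices `i < j`. -/
def pairs : Finset (Fin l × Fin l) := Finset.univ.filter fun x => x.1 < x.2

theorem mem_pairs {x : Fin l × Fin l} : x ∈ pairs l ↔ x.1 < x.2 := by simp [pairs]

theorem prod_pairs {M : Type*} [CommMonoid M] (f : Fin l → Fin l → M) :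
    ∏ i, ∏ j ∈ Finset.Ioi i, f i j = ∏ x ∈ pairs l, f x.1 x.2 := by
  rw [pairs, Finset.prod_filter, Fintype.prod_prod_type]
  refine Finset.prod_congr rfl fun i _ => ?_
  rw [← Finset.prod_filter]
  congr 1
  ext j; simp

theorem X_sub_X_ne_zero {i j : Fin l} (h : i ≠ j) :
    (MvPolynomial.X i - MvPolynomial.X j : MvPolynomial (Fin l) k) ≠ 0 := by
  rw [sub_ne_zero]
  exact fun h' => h (MvPolynomial.X_injective h')

theorem z_sub_z_ne_zero {i j : Fin l} (h : i ≠ j) : (z i - z j : RatFn k l) ≠ 0 := by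
  rw [z, z, ← ofPoly_sub]
  exact ofPoly_ne_zero (X_sub_X_ne_zero h)

theorem prime_X_sub_X {i j : Fin l} (h : i ≠ j) :
    Prime (MvPolynomial.X i - MvPolynomial.X j : MvPolynomial (Fin l) k) := by
  refine Irreducible.prime ?_
  have hc : (MvPolynomial.X i - MvPolynomial.X j : MvPolynomial (Fin l) k).coeff
      (Finsupp.single i 1) = 1 := by
    rw [MvPolynomial.coeff_sub, MvPolynomial.coeff_X, MvPolynomial.coeff_X, if_pos rfl, if_neg,
      sub_zero]
    intro h'
    exact h ((Finsupp.single_left_injective one_ne_zero) h').symm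
  refine MvPolynomial.irreducible_of_totalDegree_eq_one (le_antisymm ?_ ?_) fun x hx => ?_
  · refine (MvPolynomial.totalDegree_sub _ _).trans ?_
    simp
  · have := MvPolynomial.le_totalDegree (p := (MvPolynomial.X i - MvPolynomial.X j :
      MvPolynomial (Fin l) k)) (s := Finsupp.single i 1) (by
        rw [MvPolynomial.mem_support_iff, hc]; exact one_ne_zero)
    simpa using this
  · have := hx (Finsupp.single i 1)
    rw [hc] at this
    exact isUnit_of_dvd_one this

variable (k l) in
/-- The product of all `z_i - z_j` with `i < j`. -/
def vdm : MvPolynomial (Fin l) k := ∏ x ∈ pairs l, (MvPolynomial.X x.1 - MvPolynomial.X x.2)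

theorem ofPoly_vdm : ofPoly (vdm k l) = ∏ x ∈ pairs l, (z x.1 - z x.2) := by
  rw [vdm, ofPoly, map_prod]
  exact Finset.prod_congr rfl fun x _ => by rw [map_sub]; rfl

theorem ofPoly_vdm_ne_zero : ofPoly (vdm k l) ≠ 0 := by
  rw [ofPoly_vdm]
  exact Finset.prod_ne_zero_iff.mpr fun x hx => z_sub_z_ne_zero (mem_pairs.mp hx).ne

theorem mem_Phi_iff {α : RatFn k l} :
    α ∈ Phi k l ↔ ∃ (M : ℕ) (p : MvPolynomial (Fin l) k), ofPoly (vdm k l) ^ M * α = ofPoly p := by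
  constructor
  · rintro ⟨p, e, rfl⟩
    set M : ℕ := ∑ x ∈ pairs l, (e x.1 x.2).natAbs
    refine ⟨M, p * ∏ x ∈ pairs l,
      (MvPolynomial.X x.1 - MvPolynomial.X x.2) ^ ((M : ℤ) + e x.1 x.2).toNat, ?_⟩
    rw [prod_pairs, ofPoly_vdm, ofPoly_mul, mul_left_comm, ← Finset.prod_pow,
      ← Finset.prod_mul_distrib]
    congr 1
    rw [ofPoly, map_prod]
    refine Finset.prod_congr rfl fun x hx => ?_
    have h0 := z_sub_z_ne_zero (k := k) (mem_pairs.mp hx).ne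
    have hM : (e x.1 x.2).natAbs ≤ M :=
      Finset.single_le_sum (f := fun x : Fin l × Fin l => (e x.1 x.2).natAbs)
        (fun _ _ => Nat.zero_le _) hx
    rw [map_pow, map_sub, ← zpow_natCast, ← zpow_natCast, ← zpow_add₀ h0,
      Int.toNat_of_nonneg (by omega)]
    rfl
  · rintro ⟨M, p, h⟩
    refine ⟨p, fun _ _ => -(M : ℤ), ?_⟩
    rw [prod_pairs, Finset.prod_zpow, ← ofPoly_vdm, ← h, zpow_neg, zpow_natCast, mul_comm _ α,
      mul_assoc, mul_inv_cancel₀ (pow_ne_zero _ ofPoly_vdm_ne_zero), mul_one]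

variable (k l) in
/-- The functions with poles on the diagonals only form an algebra. -/
def phiAlg : Subalgebra k (RatFn k l) where
  carrier := Phi k l
  mul_mem' := by
    intro α β hα hβ
    rw [mem_Phi_iff] at *
    obtain ⟨M, p, hp⟩ := hα
    obtain ⟨N, q, hq⟩ := hβ
    exact ⟨M + N, p * q, by rw [ofPoly_mul, ← hp, ← hq]; ring⟩
  add_mem' := by
    intro α β hα hβ
    rw [mem_Phi_iff] at *
    obtain ⟨M, p, hp⟩ := hα
    obtain ⟨N, q, hq⟩ := hβ
    exact ⟨M + N, vdm k l ^ N * p + vdm k l ^ M * q, by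
      rw [ofPoly_add, ofPoly_mul, ofPoly_mul, ← hp, ← hq, ofPoly_pow, ofPoly_pow]; ring⟩
  algebraMap_mem' c := mem_Phi_iff.mpr ⟨0, MvPolynomial.C c, by rw [ofPoly_C]; simp⟩

theorem ofPoly_mem_phiAlg (p : MvPolynomial (Fin l) k) : ofPoly p ∈ phiAlg k l :=
  mem_Phi_iff.mpr ⟨0, p, by simp⟩

theorem inv_mem_phiAlg {i j : Fin l} (h : i ≠ j) : (z i - z j : RatFn k l)⁻¹ ∈ phiAlg k l := by
  have key : ∀ i j : Fin l, i < j → (z i - z j : RatFn k l)⁻¹ ∈ phiAlg k l := by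
    intro i j hij
    refine mem_Phi_iff.mpr ⟨1, ∏ x ∈ (pairs l).erase (i, j),
      (MvPolynomial.X x.1 - MvPolynomial.X x.2), ?_⟩
    rw [pow_one, vdm, ← Finset.mul_prod_erase _ _ (mem_pairs.mpr hij : (i, j) ∈ pairs l),
      ofPoly_mul, mul_comm, ← mul_assoc, ofPoly_sub, ofPoly_X, ofPoly_X,
      inv_mul_cancel₀ (z_sub_z_ne_zero hij.ne), one_mul]
  rcases lt_or_gt_of_ne h with h | h
  · exact key i j h
  · rw [← neg_sub, inv_neg]
    exact neg_mem (key j i h)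

theorem zpow_mem_phiAlg {i j : Fin l} (h : i ≠ j) (e : ℤ) :
    (z i - z j : RatFn k l) ^ e ∈ phiAlg k l := by
  obtain ⟨n, rfl | rfl⟩ := e.eq_nat_or_neg
  · rw [zpow_natCast]
    exact pow_mem (sub_mem (ofPoly_mem_phiAlg _) (ofPoly_mem_phiAlg _)) n
  · rw [zpow_neg, zpow_natCast, ← inv_pow]
    exact pow_mem (inv_mem_phiAlg h) n

theorem emb_mem_phiAlg {α : RatFn k l} (h : α ∈ phiAlg k l) : emb α ∈ phiAlg k (l + 1) := by
  obtain ⟨p, e, rfl⟩ := h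
  rw [prod_pairs, map_mul, map_prod, emb_ofPoly]
  refine mul_mem (ofPoly_mem_phiAlg _) (prod_mem fun x hx => ?_)
  rw [map_zpow₀, map_sub, emb_z, emb_z]
  exact zpow_mem_phiAlg (fun h => (mem_pairs.mp hx).ne (Fin.succ_injective _ h)) _

/-- A rational function with polynomial multiple `f_1 ⋯ f_r β`, where each `f_i` is prime and does
not divide some denominator of `β`, is a polynomial. -/
theorem exists_eq_ofPoly {β : RatFn k l} (s : Multiset (MvPolynomial (Fin l) k))
    (hs : ∀ f ∈ s, Prime f ∧ ∃ p q, ¬ f ∣ q ∧ β = ofPoly p / ofPoly q)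
    (h : ∃ p, ofPoly s.prod * β = ofPoly p) : ∃ p, β = ofPoly p := by
  induction s using Multiset.induction_on with
  | empty => simpa [ofPoly_one] using h
  | cons f s ih =>
    refine ih (fun g hg => hs g (Multiset.mem_cons_of_mem hg)) ?_
    obtain ⟨r, hr⟩ := h
    obtain ⟨hf, p, q, hq, hβ⟩ := hs f (Multiset.mem_cons_self f s)
    have hq0 : q ≠ 0 := fun h0 => hq (h0 ▸ dvd_zero f)
    have hq' := ofPoly_ne_zero hq0
    rw [Multiset.prod_cons, ofPoly_mul] at hr
    have h1 : f * (s.prod * p) = r * q := by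
      apply ofPoly_injective
      rw [ofPoly_mul, ofPoly_mul, ofPoly_mul, ← hr, hβ]
      field_simp
    obtain ⟨t, rfl⟩ := (hf.dvd_or_dvd (Dvd.intro _ h1)).resolve_right hq
    refine ⟨t, mul_left_cancel₀ (ofPoly_ne_zero hf.ne_zero) ?_⟩
    rw [← mul_assoc, hr, ofPoly_mul]

theorem OrdGe.exists_div {i j : Fin l} (hij : i ≠ j) {L : ℤ} {α : RatFn k l}
    (h : OrdGe i j (-L) α) {N : ℕ} (hN : L ≤ N) (r : MvPolynomial (Fin l) k) :
    ∃ p q : MvPolynomial (Fin l) k, ¬ (MvPolynomial.X i - MvPolynomial.X j) ∣ q ∧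
      ofPoly ((MvPolynomial.X i - MvPolynomial.X j) ^ N * r) * α = ofPoly p / ofPoly q := by
  obtain ⟨p, q, hq, rfl⟩ := h
  refine ⟨(MvPolynomial.X i - MvPolynomial.X j) ^ ((N : ℤ) - L).toNat * r * p, q, hq, ?_⟩
  have h0 := z_sub_z_ne_zero (k := k) hij
  rw [ofPoly_mul, ofPoly_mul, ofPoly_mul, ofPoly_pow, ofPoly_pow, ofPoly_sub, ofPoly_X, ofPoly_X,
    ← zpow_natCast, ← zpow_natCast, Int.toNat_of_nonneg (by omega), sub_eq_add_neg (N : ℤ),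
    zpow_add₀ h0]
  ring

/-- A uniform bound on the poles along all diagonals gives a uniform denominator. -/
theorem exists_ofPoly_of_ordGe {α : RatFn k l} (hα : α ∈ Phi k l) {N : ℕ}
    (h : ∀ i j, i < j → ∃ L : ℤ, L ≤ N ∧ OrdGe i j (-L) α) :
    ∃ p, ofPoly (vdm k l ^ N) * α = ofPoly p := by
  obtain ⟨M, p, hp⟩ := mem_Phi_iff.mp hα
  refine exists_eq_ofPoly (M • (pairs l).val.map fun x => MvPolynomial.X x.1 - MvPolynomial.X x.2)
    (fun f hf => ?_) ⟨vdm k l ^ N * p, ?_⟩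
  · obtain ⟨x, hx, rfl⟩ := Multiset.mem_map.mp (Multiset.mem_of_mem_nsmul hf)
    have hx' := mem_pairs.mp (Finset.mem_val.mp hx)
    refine ⟨prime_X_sub_X hx'.ne, ?_⟩
    obtain ⟨L, hL, hord⟩ := h x.1 x.2 hx'
    rw [vdm, ← Finset.mul_prod_erase _ _ (Finset.mem_val.mp hx), mul_pow]
    exact hord.exists_div hx'.ne hL _
  · rw [Multiset.prod_nsmul]
    change ofPoly (vdm k l ^ M) * _ = _
    rw [mul_left_comm, ofPoly_mul, ← hp, ofPoly_pow (vdm k l) M]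

theorem sum_X_mul_pderiv_coeff (p : MvPolynomial (Fin l) k) (s : Fin l →₀ ℕ) :
    (∑ i, MvPolynomial.X i * MvPolynomial.pderiv i p).coeff s = (∑ i, s i) • p.coeff s := by
  induction p using MvPolynomial.induction_on' with
  | monomial t a =>
    simp only [MvPolynomial.X_mul_pderiv_monomial, ← Finset.sum_smul, MvPolynomial.coeff_smul,
      MvPolynomial.coeff_monomial]
    by_cases h : t = s
    · subst h; simp
    · simp [h]
  | add p q hp hq =>
    simp only [map_add, mul_add, Finset.sum_add_distrib, MvPolynomial.coeff_add, hp, hq, smul_add]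

/-- A polynomial which is an eigenvector of the Euler operator is homogeneous, its degree being the
eigenvalue. -/
theorem totalDegree_le_of_euler [CharZero k] {p : MvPolynomial (Fin l) k} {d : ℤ}
    (h : euler (ofPoly p) = d • ofPoly p) : p.totalDegree ≤ d.toNat := by
  have h1 : ∑ i, MvPolynomial.X i * MvPolynomial.pderiv i p = d • p := by
    apply ofPoly_injective
    rw [ofPoly, ofPoly, map_zsmul, map_sum]
    refine Eq.trans (Finset.sum_congr rfl fun i _ => ?_) h
    rw [map_mul, pd_ofPoly]; rfl
  refine Finset.sup_le fun s hs => ?_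
  have h2 := sum_X_mul_pderiv_coeff p s
  rw [h1, MvPolynomial.coeff_smul, zsmul_eq_mul, nsmul_eq_mul] at h2
  have h3 := mul_right_cancel₀ (MvPolynomial.mem_support_iff.mp hs) h2
  have h4 : d = ((∑ i, s i : ℕ) : ℤ) := by exact_mod_cast h3
  rw [h4, Int.toNat_natCast, Finsupp.sum_fintype _ _ fun _ => rfl]

theorem vdm_isHomogeneous : (vdm k l).IsHomogeneous (pairs l).card := by
  have := MvPolynomial.IsHomogeneous.prod (pairs l)
    (fun x => (MvPolynomial.X x.1 - MvPolynomial.X x.2 : MvPolynomial (Fin l) k)) (fun _ => 1)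
    (fun x _ => (MvPolynomial.isHomogeneous_X k x.1).sub (MvPolynomial.isHomogeneous_X k x.2))
  simpa [vdm] using this

/-- The homogeneous functions of given degree with bounded poles along the diagonals form a
finite-dimensional space. -/
theorem finite_of_bounded_poles [CharZero k] (S : Submodule k (RatFn k l)) (N : ℕ) (d : ℤ)
    (hS : ∀ α ∈ S, (∃ p, ofPoly (vdm k l ^ N) * α = ofPoly p) ∧ euler α = d • α) :
    Module.Finite k S := by
  set D : ℤ := ((pairs l).card * N : ℕ) + d
  let ψ : MvPolynomial (Fin l) k →ₗ[k] RatFn k l :=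
    (IsScalarTower.toAlgHom k (MvPolynomial (Fin l) k) (RatFn k l)).toLinearMap
  let R := (MvPolynomial.restrictTotalDegree (Fin l) k D.toNat).map ψ
  have hR : ∀ α : S, ofPoly (vdm k l ^ N) * (α : RatFn k l) ∈ R := by
    rintro ⟨α, hα⟩
    obtain ⟨⟨p, hp⟩, he⟩ := hS α hα
    refine ⟨p, ?_, hp.symm⟩
    rw [SetLike.mem_coe, MvPolynomial.mem_restrictTotalDegree]
    apply totalDegree_le_of_euler
    rw [← hp, euler_mul, he, euler_ofPoly (vdm_isHomogeneous.pow N)]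
    simp only [D, add_smul, natCast_zsmul, smul_mul_assoc, mul_smul_comm]
  let φ : S →ₗ[k] R :=
    LinearMap.codRestrict R ((LinearMap.mulLeft k (ofPoly (vdm k l ^ N))).comp S.subtype) hR
  refine Module.Finite.of_injective φ fun α β h => ?_
  have h1 : ofPoly (vdm k l ^ N) * (α : RatFn k l) = ofPoly (vdm k l ^ N) * (β : RatFn k l) :=
    congrArg Subtype.val h
  refine Subtype.ext (mul_left_cancel₀ ?_ h1)
  rw [ofPoly_pow]
  exact pow_ne_zero _ ofPoly_vdm_ne_zero

end Poles

/-! ### Interchanging the two outer expansions -/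

section Interchange

variable {k : Type u} [Field k] {l : ℕ}

variable (k l) in
/-- The functions `β` for which the expansions at `z_0 = ∞`, `z_1 = ∞` may be taken in any
order. -/
def swapOK : Submodule k (RatFn k (l + 2)) where
  carrier := {β | ∀ m n, coeffL k l n (coeffL k (l + 1) m β) =
    coeffL k l m (coeffL k (l + 1) n (permAct k (Equiv.swap 0 1) β))}
  zero_mem' m n := by simp
  add_mem' h h' m n := by simp [h m n, h' m n]
  smul_mem' c β h m n := by simp [h m n]

theorem permAct_swap_swap (i j : Fin l) (β : RatFn k l) :
    permAct k (Equiv.swap i j) (permAct k (Equiv.swap i j) β) = β := by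
  rw [← permAct_mul, Equiv.swap_mul_self, permAct_one]

theorem permAct_mem_swapOK {β : RatFn k (l + 2)} (h : β ∈ swapOK k l) :
    permAct k (Equiv.swap 0 1) β ∈ swapOK k l := by
  intro m n
  rw [permAct_swap_swap]
  exact (h n m).symm

/-- Multiplication by `γ` preserves the space `swapOK`. -/
def SwapMul (γ : RatFn k (l + 2)) : Prop := ∀ β ∈ swapOK k l, γ * β ∈ swapOK k l

theorem SwapMul.one : SwapMul (1 : RatFn k (l + 2)) := fun β hβ => by rwa [one_mul]

theorem SwapMul.mul {γ δ : RatFn k (l + 2)} (h : SwapMul γ) (h' : SwapMul δ) :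
    SwapMul (γ * δ) := fun β hβ => by rw [mul_assoc]; exact h _ (h' _ hβ)

theorem SwapMul.add {γ δ : RatFn k (l + 2)} (h : SwapMul γ) (h' : SwapMul δ) :
    SwapMul (γ + δ) := fun β hβ => by rw [add_mul]; exact add_mem (h _ hβ) (h' _ hβ)

theorem SwapMul.neg {γ : RatFn k (l + 2)} (h : SwapMul γ) : SwapMul (-γ) :=
  fun β hβ => by rw [neg_mul]; exact neg_mem (h _ hβ)

theorem SwapMul.pow {γ : RatFn k (l + 2)} (h : SwapMul γ) (n : ℕ) : SwapMul (γ ^ n) := by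
  induction n with
  | zero => rw [pow_zero]; exact SwapMul.one
  | succ n ih => rw [pow_succ]; exact ih.mul h

theorem SwapMul.prod {ι : Type*} (s : Finset ι) (f : ι → RatFn k (l + 2))
    (h : ∀ i ∈ s, SwapMul (f i)) : SwapMul (∏ i ∈ s, f i) := by
  classical
  induction s using Finset.induction_on with
  | empty => exact SwapMul.one
  | insert i s hi ih =>
    rw [Finset.prod_insert hi]
    exact (h i (Finset.mem_insert_self i s)).mul
      (ih fun j hj => h j (Finset.mem_insert_of_mem hj))

theorem SwapMul.permAct {γ : RatFn k (l + 2)} (h : SwapMul γ) :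
    SwapMul (permAct k (Equiv.swap 0 1) γ) := by
  intro β hβ
  have := permAct_mem_swapOK (h _ (permAct_mem_swapOK hβ))
  rwa [map_mul, permAct_swap_swap] at this

theorem permAct_emb_emb (r : RatFn k l) :
    permAct k (Equiv.swap 0 1) (emb (emb r)) = emb (emb r) := by
  obtain ⟨p, q, -, rfl⟩ := exists_eq_div r
  simp only [map_div₀, emb_ofPoly, permAct_ofPoly, MvPolynomial.rename_rename]
  have : (Equiv.swap (0 : Fin (l + 2)) 1 ∘ Fin.succ) ∘ Fin.succ = Fin.succ ∘ Fin.succ := by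
    funext i
    exact Equiv.swap_apply_of_ne_of_ne (Fin.succ_ne_zero _)
      (fun h => Fin.succ_ne_zero i (Fin.succ_injective _ h))
  rw [← comp_assoc, this]

theorem swapMul_emb_emb (r : RatFn k l) : SwapMul (emb (emb r)) := by
  intro β hβ m n
  rw [map_mul (permAct k _), permAct_emb_emb]
  simp only [coeffL_emb_mul]
  rw [hβ m n]

theorem swapMul_z_zero : SwapMul (z 0 : RatFn k (l + 2)) := by
  intro β hβ m n
  rw [map_mul (permAct k _), permAct_z, Equiv.swap_apply_left, coeffL_z_zero_mul,
    show (1 : Fin (l + 2)) = Fin.succ 0 from rfl, coeffL_z_succ_mul, coeffL_z_zero_mul]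
  exact hβ (m + 1) n

theorem swapMul_z (i : Fin (l + 2)) : SwapMul (z i : RatFn k (l + 2)) := by
  induction i using Fin.cases with
  | zero => exact swapMul_z_zero
  | succ i =>
    induction i using Fin.cases with
    | zero =>
      have := (swapMul_z_zero (k := k) (l := l)).permAct
      rwa [permAct_z, Equiv.swap_apply_left] at this
    | succ i => rw [← emb_z, ← emb_z]; exact swapMul_emb_emb _

theorem swapMul_ofPoly (p : MvPolynomial (Fin (l + 2)) k) : SwapMul (ofPoly p) := by
  induction p using MvPolynomial.induction_on with
  | C a =>
    rw [ofPoly_C, ← AlgHom.commutes emb, ← AlgHom.commutes emb]; exact swapMul_emb_emb _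
  | add p q hp hq => rw [ofPoly_add]; exact hp.add hq
  | mul_X p i hp => rw [ofPoly_mul]; exact hp.mul (swapMul_z i)

theorem eq_zero_of_recursion {M : Type*} [CommRing M] {f : ℤ → M} {a : M}
    (h : ∀ m, f (m + 1) = a * f m) {m₀ : ℤ} (h0 : ∀ m, m < m₀ → f m = 0) (m : ℤ) : f m = 0 := by
  have key : ∀ j : ℕ, f (m₀ - 1 + j) = 0 := by
    intro j
    induction j with
    | zero => exact h0 _ (by simp)
    | succ j ih => rw [show m₀ - 1 + ((j + 1 : ℕ) : ℤ) = m₀ - 1 + j + 1 by push_cast; ring, h, ih,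
        mul_zero]
  by_cases hm : m < m₀
  · exact h0 m hm
  · have := key (m - (m₀ - 1)).toNat
    rwa [Int.toNat_of_nonneg (by omega), add_sub_cancel] at this

theorem swapMul_inv_zero (j : Fin l) : SwapMul (z 0 - z j.succ.succ : RatFn k (l + 2))⁻¹ := by
  intro β hβ m n
  set β' := (z 0 - z j.succ.succ : RatFn k (l + 2))⁻¹ * β with hβ'
  have hne : (z 0 - z j.succ.succ : RatFn k (l + 2)) ≠ 0 :=
    z_sub_z_ne_zero (Fin.succ_ne_zero _).symm
  have h1 : z 0 * β' - z j.succ.succ * β' = β := by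
    rw [← sub_mul, hβ', mul_inv_cancel_left₀ hne]
  have hs : (Equiv.swap (0 : Fin (l + 2)) 1) j.succ.succ = j.succ.succ :=
    Equiv.swap_apply_of_ne_of_ne (Fin.succ_ne_zero _)
      (fun h => Fin.succ_ne_zero j (Fin.succ_injective _ h))
  have h2 : z (Fin.succ 0) * permAct k (Equiv.swap 0 1) β' -
      z j.succ.succ * permAct k (Equiv.swap 0 1) β' = permAct k (Equiv.swap 0 1) β := by
    rw [← h1, map_sub, map_mul (permAct k _) (z 0), map_mul (permAct k _) (z j.succ.succ),
      permAct_z, permAct_z, Equiv.swap_apply_left, hs]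
    rfl
  rw [← sub_eq_zero]
  obtain ⟨a, ha⟩ := coeffL_vanish β'
  obtain ⟨b, hb⟩ := coeffL_vanish (coeffL k (l + 1) n (permAct k (Equiv.swap 0 1) β'))
  -- The difference of the two sides satisfies a recursion of the first order in `m`.
  refine eq_zero_of_recursion (a := z j) (m₀ := min a b) (f := fun m =>
    coeffL k l n (coeffL k (l + 1) m β') -
      coeffL k l m (coeffL k (l + 1) n (permAct k (Equiv.swap 0 1) β'))) (fun m => ?_)
    (fun m hm => ?_) m
  · have e := hβ m n
    rw [← h2, ← h1] at e
    simp only [map_sub, coeffL_z_zero_mul, coeffL_z_succ_mul] at e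
    linear_combination e
  · simp only [ha m (by omega), hb m (by omega), map_zero, sub_zero]

theorem swapMul_inv {i j : Fin (l + 2)} (hij : i < j) (h : (i, j) ≠ (0, 1)) :
    SwapMul (z i - z j : RatFn k (l + 2))⁻¹ := by
  induction j using Fin.cases with
  | zero => exact absurd hij (Fin.not_lt_zero i)
  | succ j =>
    induction j using Fin.cases with
    | zero =>
      have : i = 0 := by
        rw [Fin.lt_def] at hij
        exact Fin.ext (by simpa using hij)
      exact absurd (by rw [this]; rfl) h
    | succ j =>
      induction i using Fin.cases with
      | zero => exact swapMul_inv_zero j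
      | succ i =>
        induction i using Fin.cases with
        | zero =>
          have hs : (Equiv.swap (0 : Fin (l + 2)) 1) j.succ.succ = j.succ.succ :=
            Equiv.swap_apply_of_ne_of_ne (Fin.succ_ne_zero _)
              (fun h => Fin.succ_ne_zero j (Fin.succ_injective _ h))
          have := (swapMul_inv_zero (k := k) j).permAct
          rwa [map_inv₀, map_sub, permAct_z, permAct_z, Equiv.swap_apply_left, hs] at this
        | succ i =>
          have := swapMul_emb_emb (z i - z j : RatFn k l)⁻¹
          simpa only [map_inv₀, map_sub, emb_z] using this

variable (k l) in
/-- The product of all `z_i - z_j` with `i < j` other than `z_0 - z_1`. -/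
def vdm' : MvPolynomial (Fin (l + 2)) k :=
  ∏ x ∈ (pairs (l + 2)).erase (0, 1), (MvPolynomial.X x.1 - MvPolynomial.X x.2)

theorem vdm_eq : vdm k (l + 2) = (MvPolynomial.X 0 - MvPolynomial.X 1) * vdm' k l := by
  rw [vdm, vdm', ← Finset.mul_prod_erase _ _
    (mem_pairs.mpr (by simp) : ((0 : Fin (l + 2)), (1 : Fin (l + 2))) ∈ pairs (l + 2))]

theorem ofPoly_vdm'_ne_zero : ofPoly (vdm' k l) ≠ 0 := by
  intro h
  apply ofPoly_vdm_ne_zero (k := k) (l := l + 2)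
  rw [vdm_eq, ofPoly_mul, h, mul_zero]

theorem swapMul_inv_vdm' : SwapMul (ofPoly (vdm' k l))⁻¹ := by
  rw [vdm', ofPoly, map_prod, ← Finset.prod_inv_distrib]
  refine SwapMul.prod _ _ fun x hx => ?_
  rw [Finset.mem_erase] at hx
  rw [map_sub]
  exact swapMul_inv (mem_pairs.mp hx.2) hx.1

theorem one_mem_swapOK : (1 : RatFn k (l + 2)) ∈ swapOK k l := by
  intro m n
  have h : ∀ (l : ℕ) (m : ℤ), coeffL k l m 1 = if m = -1 then 1 else 0 := fun l m => by
    rw [← map_one emb, coeffL_emb]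
  rw [map_one (permAct k _), h, h]
  split_ifs <;> simp [*]

theorem mem_swapOK_of_vdm' {β : RatFn k (l + 2)} {M : ℕ} {p : MvPolynomial (Fin (l + 2)) k}
    (h : ofPoly (vdm' k l) ^ M * β = ofPoly p) : β ∈ swapOK k l := by
  have e : β = (ofPoly (vdm' k l))⁻¹ ^ M * (ofPoly p * 1) := by
    rw [mul_one, ← h, inv_pow, inv_mul_cancel_left₀ (pow_ne_zero _ ofPoly_vdm'_ne_zero)]
  rw [e]
  exact swapMul_inv_vdm'.pow M _ (swapMul_ofPoly p _ one_mem_swapOK)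

/-- After multiplication by a power of `z_0 - z_1` the two outer expansions commute. -/
theorem exists_pow_mul_mem_swapOK {α : RatFn k (l + 2)} (hα : α ∈ Phi k (l + 2)) :
    ∃ N : ℕ, (z 0 - z 1) ^ N * α ∈ swapOK k l := by
  obtain ⟨M, p, hp⟩ := mem_Phi_iff.mp hα
  refine ⟨M, mem_swapOK_of_vdm' (M := M) (p := p) ?_⟩
  rw [← hp, vdm_eq, ofPoly_mul, mul_pow, ofPoly_sub, ofPoly_X, ofPoly_X]
  ring

/-- After multiplication by a power of `z_0 - z_1` which cancels the pole, the order in which the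
expansions are taken does not matter. -/
theorem pow_mul_mem_swapOK {α : RatFn k (l + 2)} (hα : α ∈ Phi k (l + 2)) {L : ℤ} {N : ℕ}
    (h : OrdGe 0 1 (-L) α) (hN : L ≤ N) : (z 0 - z 1) ^ N * α ∈ swapOK k l := by
  obtain ⟨M, p, hp⟩ := mem_Phi_iff.mp hα
  have h01 : (0 : Fin (l + 2)) ≠ 1 := by simp
  obtain ⟨t, ht⟩ := exists_eq_ofPoly (β := ofPoly (vdm' k l) ^ M * ((z 0 - z 1) ^ N * α))
    (Multiset.replicate M (MvPolynomial.X 0 - MvPolynomial.X 1)) (fun f hf => by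
      rw [Multiset.eq_of_mem_replicate hf]
      refine ⟨prime_X_sub_X h01, ?_⟩
      obtain ⟨p', q', h1, h2⟩ := h.exists_div h01 hN (vdm' k l ^ M)
      refine ⟨p', q', h1, ?_⟩
      rw [← h2, ofPoly_mul, ofPoly_pow, ofPoly_pow, ofPoly_sub, ofPoly_X, ofPoly_X]
      ring) ⟨(MvPolynomial.X 0 - MvPolynomial.X 1) ^ N * p, by
      rw [Multiset.prod_replicate, ofPoly_mul, ← hp, vdm_eq, ofPoly_mul, mul_pow, ofPoly_pow,
        ofPoly_pow, ofPoly_sub, ofPoly_X, ofPoly_X]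
      ring⟩
  exact mem_swapOK_of_vdm' ht

theorem coeffL_coeffL_pow_mul (N : ℕ) (α : RatFn k (l + 2)) (m n : ℤ) :
    coeffL k l n (coeffL k (l + 1) m ((z 0 - z 1) ^ N * α)) =
      dd^[N] (fun m n => coeffL k l n (coeffL k (l + 1) m α)) m n := by
  induction N generalizing α with
  | zero => simp
  | succ N ih =>
    rw [pow_succ, mul_assoc, ih, iterate_succ_apply]
    refine congrFun (congrFun (congrArg (dd^[N]) ?_) m) n
    funext m n
    rw [sub_mul, map_sub, map_sub, coeffL_z_zero_mul, show (1 : Fin (l + 2)) = Fin.succ 0 from rfl,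
      coeffL_z_succ_mul, coeffL_z_zero_mul]
    rfl

theorem coeffL_coeffL_pow_mul' (N : ℕ) (α : RatFn k (l + 2)) (m n : ℤ) :
    coeffL k l m (coeffL k (l + 1) n ((z 1 - z 0) ^ N * α)) =
      dd^[N] (fun m n => coeffL k l m (coeffL k (l + 1) n α)) m n := by
  induction N generalizing α with
  | zero => simp
  | succ N ih =>
    rw [pow_succ, mul_assoc, ih, iterate_succ_apply]
    refine congrFun (congrFun (congrArg (dd^[N]) ?_) m) n
    funext m n
    rw [sub_mul, map_sub, map_sub, coeffL_z_zero_mul, show (1 : Fin (l + 2)) = Fin.succ 0 from rfl,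
      coeffL_z_succ_mul, coeffL_z_zero_mul]
    rfl

/-- Locality for a rational function: multiplied by a power of `z_0 - z_1` which cancels the pole,
the two iterated expansions agree. -/
theorem dd_iter_of_mem_swapOK {N : ℕ} {α : RatFn k (l + 2)}
    (h : (z 0 - z 1) ^ N * α ∈ swapOK k l) :
    dd^[N] (fun m n => coeffL k l n (coeffL k (l + 1) m α)) =
      dd^[N] (fun m n => coeffL k l m (coeffL k (l + 1) n (permAct k (Equiv.swap 0 1) α))) := by
  funext m n
  rw [← coeffL_coeffL_pow_mul, h m n, map_mul, map_pow, map_sub, permAct_z, permAct_z,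
    Equiv.swap_apply_left, Equiv.swap_apply_right, coeffL_coeffL_pow_mul']

end Interchange

/-! ### Correlation functions of graded local fields -/

section Differences

variable {k : Type u} [Field k] {N : Type*} [AddCommGroup N] [Module k N] {N' : Type*}
  [AddCommGroup N'] [Module k N']

/-- Multiplication of the Laurent series `∑ F(n) z^{-n-1}` by `z - T`, for an operator `T` on the
space of its coefficients. -/
def subMul (T : Module.End k N) : Module.End k (ℤ → N) where
  toFun F n := F (n + 1) - T (F n)
  map_add' F F' := by funext n; simp; abel
  map_smul' c F := by funext n; simp [smul_sub]

theorem subMul_apply (T : Module.End k N) (F : ℤ → N) (n : ℤ) :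
    subMul T F n = F (n + 1) - T (F n) := rfl

/-- Multiplication by the product of all `z - T j` for the indices `j` in a list. -/
def subMulList {ι : Type*} (T : ι → Module.End k N) : List ι → Module.End k (ℤ → N)
  | [] => 1
  | j :: js => subMulList T js * subMul (T j)

theorem subMul_comm {S T : Module.End k N} (h : Commute S T) : Commute (subMul S) (subMul T) := by
  refine LinearMap.ext fun F => funext fun n => ?_
  have := LinearMap.congr_fun h (F n)
  simp only [Module.End.mul_apply] at this
  simp only [Module.End.mul_apply, subMul_apply, map_sub, this]
  abel

theorem subMulList_comm {ι : Type*} {T : ι → Module.End k N} (h : ∀ i j, Commute (T i) (T j))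
    (i : ι) (js : List ι) : Commute (subMulList T js) (subMul (T i)) := by
  induction js with
  | nil => exact Commute.one_left _
  | cons j js ih => exact ih.mul_left (subMul_comm (h j i))

theorem subMulList_append {ι : Type*} (T : ι → Module.End k N) (js js' : List ι) :
    subMulList T (js ++ js') = subMulList T js' * subMulList T js := by
  induction js with
  | nil => simp [subMulList]
  | cons j js ih => simp [subMulList, ih, mul_assoc]

theorem subMulList_replicate {ι : Type*} (T : ι → Module.End k N) (i : ι) (r : ℕ) :
    subMulList T (List.replicate r i) = subMul (T i) ^ r := by
  induction r with
  | zero => rfl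
  | succ r ih => rw [List.replicate_succ, subMulList, ih, pow_succ]

theorem subMulList_map {ι ι' : Type*} {T : ι → Module.End k N} {T' : ι' → Module.End k N'}
    (s : ι → ι') (φ : N →ₗ[k] N') (h : ∀ i x, φ (T i x) = T' (s i) (φ x)) (js : List ι)
    (F : ℤ → N) : subMulList T' (js.map s) (fun n => φ (F n)) =
      fun n => φ (subMulList T js F n) := by
  induction js generalizing F with
  | nil => rfl
  | cons j js ih =>
    have e : subMul (T' (s j)) (fun n => φ (F n)) = fun n => φ (subMul (T j) F n) := by
      funext n; simp [subMul_apply, h]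
    simp only [List.map_cons, subMulList, Module.End.mul_apply, e, ih]

theorem subMulList_map_id {ι : Type*} {T : ι → Module.End k N} {T' : ι → Module.End k N'}
    (φ : N →ₗ[k] N') (h : ∀ i x, φ (T i x) = T' i (φ x)) (js : List ι)
    (F : ℤ → N) : subMulList T' js (fun n => φ (F n)) = fun n => φ (subMulList T js F n) := by
  simpa using subMulList_map id φ h js F

theorem subMul_vanish (T : Module.End k N) {F : ℤ → N} {n₀ : ℤ} (h : ∀ n, n < n₀ → F n = 0) :
    ∀ n, n < n₀ - 1 → subMul T F n = 0 := by
  intro n hn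
  rw [subMul_apply, h _ (by omega), h _ (by omega), map_zero, sub_zero]

theorem subMulList_vanish {ι : Type*} (T : ι → Module.End k N) (js : List ι) {F : ℤ → N} {n₀ : ℤ}
    (h : ∀ n, n < n₀ → F n = 0) : ∀ n, n < n₀ - js.length → subMulList T js F n = 0 := by
  induction js generalizing F n₀ with
  | nil => intro n hn; exact h n (by simpa using hn)
  | cons j js ih =>
    intro n hn
    exact ih (subMul_vanish (T j) h) n (by rw [List.length_cons] at hn; push_cast at hn; omega)

theorem eq_zero_of_subMul {T : Module.End k N} {F : ℤ → N} {n₀ : ℤ} (h : ∀ n, n < n₀ → F n = 0)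
    (h0 : subMul T F = 0) : F = 0 := by
  have key : ∀ j : ℕ, F (n₀ - 1 + j) = 0 := by
    intro j
    induction j with
    | zero => exact h _ (by simp)
    | succ j ih =>
      have := congrFun h0 (n₀ - 1 + j)
      rw [subMul_apply, ih, map_zero, sub_zero] at this
      rw [Nat.cast_succ, ← add_assoc]
      exact this
  funext n
  by_cases hn : n < n₀
  · exact h n hn
  · have := key (n - (n₀ - 1)).toNat
    rwa [Int.toNat_of_nonneg (by omega), add_sub_cancel] at this

theorem eq_zero_of_subMulList {ι : Type*} {T : ι → Module.End k N} (js : List ι) {F : ℤ → N}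
    {n₀ : ℤ} (h : ∀ n, n < n₀ → F n = 0) (h0 : subMulList T js F = 0) : F = 0 := by
  induction js generalizing F n₀ with
  | nil => exact h0
  | cons j js ih => exact eq_zero_of_subMul h (ih (subMul_vanish (T j) h) h0)

/-- The shift of the `j`-th index, which is multiplication by the variable `z_j` on coefficients. -/
def shiftIdx (k : Type u) [Field k] (M : Type*) [AddCommGroup M] [Module k M] {l : ℕ} (j : Fin l) :
    Module.End k ((Fin l → ℤ) → M) :=
  LinearMap.funLeft k M fun m => m + Pi.single j 1

theorem shiftIdx_apply {M : Type*} [AddCommGroup M] [Module k M] {l : ℕ} (j : Fin l)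
    (w : (Fin l → ℤ) → M) (m : Fin l → ℤ) : shiftIdx k M j w m = w (m + Pi.single j 1) := rfl

theorem shiftIdx_comm {M : Type*} [AddCommGroup M] [Module k M] {l : ℕ} (i j : Fin l) :
    Commute (shiftIdx k M i) (shiftIdx k M j) := by
  refine LinearMap.ext fun w => funext fun m => ?_
  simp only [Module.End.mul_apply, shiftIdx_apply, add_right_comm]

/-- A Laurent series with rational coefficients that becomes a polynomial after multiplication by
linear factors `z_0 - z_j` is the expansion of a rational function. -/
theorem exists_coeffL_eq {l : ℕ} (js : List (Fin l)) {β : ℤ → RatFn k l} {n₀ : ℤ}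
    (hβ : ∀ n, n < n₀ → β n = 0) (hΦ : ∀ n, β n ∈ phiAlg k l)
    (h : ∀ n, 0 ≤ n → subMulList (fun j => LinearMap.mulLeft k (z j)) js β n = 0) :
    ∃ α ∈ phiAlg k (l + 1), ∀ n, coeffL k l n α = β n := by
  induction js generalizing β n₀ with
  | nil =>
    have h' : ∀ n, 0 ≤ n → β n = 0 := h
    have hz : ∀ (j : ℕ) (n : ℤ) (r : RatFn k l), coeffL k l n (z 0 ^ j * emb r) =
        if n + j = -1 then r else 0 := by
      intro j
      induction j with
      | zero => intro n r; rw [pow_zero, one_mul, coeffL_emb]; simp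
      | succ j ih =>
        intro n r
        rw [pow_succ', mul_assoc, coeffL_z_zero_mul, ih]
        push_cast
        rw [show n + 1 + j = n + (j + 1) by ring]
    refine ⟨∑ n ∈ Finset.Ico n₀ 0, z 0 ^ (-n - 1).toNat * emb (β n), ?_, fun n => ?_⟩
    · exact sum_mem fun n _ => mul_mem (pow_mem (ofPoly_mem_phiAlg _) _) (emb_mem_phiAlg (hΦ n))
    · rw [map_sum]
      by_cases hn : n ∈ Finset.Ico n₀ 0
      · rw [Finset.sum_eq_single_of_mem n hn, hz, if_pos]
        · rw [Finset.mem_Ico] at hn; omega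
        · intro b hb hbn
          rw [hz, if_neg]
          rw [Finset.mem_Ico] at hb; omega
      · rw [Finset.sum_eq_zero]
        · rw [Finset.mem_Ico, not_and_or, not_le, not_lt] at hn
          rcases hn with hn | hn
          · exact (hβ n hn).symm
          · exact (h' n hn).symm
        · intro b hb
          rw [hz, if_neg]
          rintro he
          apply hn
          rw [Finset.mem_Ico] at hb ⊢; omega
  | cons j js ih =>
    obtain ⟨α, hα, hαβ⟩ := ih (subMul_vanish (LinearMap.mulLeft k (z j)) hβ) (fun n => by
      rw [subMul_apply, LinearMap.mulLeft_apply]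
      exact sub_mem (hΦ _) (mul_mem (ofPoly_mem_phiAlg _) (hΦ _))) h
    have hne : (0 : Fin (l + 1)) ≠ j.succ := (Fin.succ_ne_zero j).symm
    refine ⟨(z 0 - z j.succ)⁻¹ * α, mul_mem (inv_mem_phiAlg hne) hα, fun n => ?_⟩
    set γ := (z 0 - z j.succ : RatFn k (l + 1))⁻¹ * α with hγ
    have hγα : z 0 * γ - z j.succ * γ = α := by
      rw [← sub_mul, hγ, mul_inv_cancel_left₀ (z_sub_z_ne_zero hne)]
    obtain ⟨n₁, hn₁⟩ := coeffL_vanish γ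
    have := eq_zero_of_subMul (T := LinearMap.mulLeft k (z j))
      (F := fun n => coeffL k l n γ - β n) (n₀ := min n₀ n₁)
      (fun n hn => by simp only [hβ n (by omega), hn₁ n (by omega), sub_zero]) (by
        funext n
        have e := hαβ n
        rw [← hγα, map_sub, coeffL_z_zero_mul, coeffL_z_succ_mul, subMul_apply,
          LinearMap.mulLeft_apply] at e
        simp only [subMul_apply, LinearMap.mulLeft_apply, Pi.zero_apply]
        linear_combination e)
    exact sub_eq_zero.mp (congrFun this n)

end Differences

section Words

variable {k : Type u} [Field k] {V : Type v} [AddCommGroup V] [Module k V] {G : Type w}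

/-- The vector `a_0(m_0) ⋯ a_{l-1}(m_{l-1}) 1`, for a family of modes `g`. -/
def modeWord (g : G → ℤ → Module.End k V) (one : V) : (l : ℕ) → (Fin l → G) → (Fin l → ℤ) → V
  | 0, _, _ => one
  | l + 1, a, m => g (a 0) (m 0) (modeWord g one l (Fin.tail a) (Fin.tail m))

theorem word_comp (A : VertexAlgebra k V) {G : Type w} (ι : G → V) {l : ℕ} (a : Fin l → G)
    (m : Fin l → ℤ) :
    A.word l (ι ∘ a) m = modeWord (fun a n => A.prod n (ι a)) A.one l a m := by
  induction l with
  | zero => rfl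
  | succ l ih =>
    rw [modeWord, ← ih]; rfl

variable {g : G → ℤ → Module.End k V} {one : V}

/-- After multiplication by suitable factors `z - z_j` the field `a(z)` acts on words `a_0 … a_{l-1}`
without singular terms. -/
theorem exists_subMulList_modeWord (loc : ∀ a b, IsLoc (cm (g a) (g b)))
    (create : ∀ a n, 0 ≤ n → g a n one = 0) (b : G) {l : ℕ} (a : Fin l → G) :
    ∃ js : List (Fin l), ∀ n, 0 ≤ n →
      subMulList (shiftIdx k V) js (fun n m => g b n (modeWord g one l a m)) n = 0 := by
  induction l with
  | zero => exact ⟨[], fun n hn => funext fun m => create b n hn⟩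
  | succ l ih =>
    obtain ⟨js, hjs⟩ := ih (Fin.tail a)
    obtain ⟨N, hN⟩ := loc b (a 0)
    refine ⟨js.map Fin.succ ++ List.replicate N 0, fun n hn => ?_⟩
    -- Split `b(n) a_0(m)` into the commutator and `a_0(m) b(n)`.
    have e : (fun (n : ℤ) (m : Fin (l + 1) → ℤ) => g b n (modeWord g one (l + 1) a m)) =
        (fun n m => cm (g b) (g (a 0)) n (m 0) (modeWord g one l (Fin.tail a) (Fin.tail m))) +
        fun n m => g (a 0) (m 0) (g b n (modeWord g one l (Fin.tail a) (Fin.tail m))) := by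
      funext n m; simp [cm, modeWord]
    have h1 : ∀ (r : ℕ) (f : ℤ → ℤ → Module.End k V), (subMul (shiftIdx k V (0 : Fin (l + 1))) ^ r)
        (fun n m => f n (m 0) (modeWord g one l (Fin.tail a) (Fin.tail m))) =
        fun n m => dd^[r] f n (m 0) (modeWord g one l (Fin.tail a) (Fin.tail m)) := by
      intro r
      induction r with
      | zero => intro f; rfl
      | succ r ih =>
        intro f
        rw [pow_succ, Module.End.mul_apply, iterate_succ_apply, ← ih]
        congr 1
        funext n m
        have ht : Fin.tail (m + Pi.single 0 1) = Fin.tail m := by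
          funext i; simp [Fin.tail]
        simp [subMul_apply, shiftIdx_apply, dd, ht]
    let Ψ : ((Fin l → ℤ) → V) →ₗ[k] ((Fin (l + 1) → ℤ) → V) :=
      LinearMap.pi fun m => g (a 0) (m 0) ∘ₗ LinearMap.proj (Fin.tail m)
    have hΨ : ∀ (j : Fin l) (x : (Fin l → ℤ) → V),
        Ψ (shiftIdx k V j x) = shiftIdx k V j.succ (Ψ x) := by
      intro j x
      funext m
      have ht : Fin.tail (m + Pi.single j.succ 1 : Fin (l + 1) → ℤ) = Fin.tail m + Pi.single j 1 := by
        funext i; simp [Fin.tail, Pi.single_apply]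
      have h0 : (m + Pi.single j.succ 1 : Fin (l + 1) → ℤ) 0 = m 0 := by
        simp
      simp [Ψ, shiftIdx_apply, ht]
    rw [e, map_add, subMulList_append, subMulList_replicate]
    have hcomm : Commute (subMul (shiftIdx k V (0 : Fin (l + 1))) ^ N)
        (subMulList (shiftIdx k V) (js.map Fin.succ)) :=
      (subMulList_comm shiftIdx_comm 0 _).symm.pow_left N
    have e1 : (subMul (shiftIdx k V (0 : Fin (l + 1))) ^ N *
        subMulList (shiftIdx k V) (js.map Fin.succ))
        (fun n m => cm (g b) (g (a 0)) n (m 0) (modeWord g one l (Fin.tail a) (Fin.tail m))) =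
        0 := by
      rw [hcomm.eq, Module.End.mul_apply, h1, hN]
      exact map_zero _
    have e2 : subMulList (shiftIdx k V) (js.map Fin.succ) (fun n m => g (a 0) (m 0)
        (g b n (modeWord g one l (Fin.tail a) (Fin.tail m)))) =
        fun n => Ψ (subMulList (shiftIdx k V) js
          (fun n m => g b n (modeWord g one l (Fin.tail a) m)) n) :=
      subMulList_map Fin.succ Ψ hΨ js fun n m => g b n (modeWord g one l (Fin.tail a) m)
    have h3 : ∀ (r : ℕ) (F : ℤ → (Fin (l + 1) → ℤ) → V), (∀ n, 0 ≤ n → F n = 0) →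
        ∀ n, 0 ≤ n → (subMul (shiftIdx k V (0 : Fin (l + 1))) ^ r) F n = 0 := by
      intro r
      induction r with
      | zero => intro F hF; exact hF
      | succ r ih =>
        intro F hF
        rw [pow_succ, Module.End.mul_apply]
        refine ih _ fun n hn => ?_
        rw [subMul_apply, hF n hn, hF (n + 1) (by omega), map_zero, sub_zero]
    rw [e1, zero_add, Module.End.mul_apply, e2]
    exact h3 N _ (fun n hn => by rw [hjs n hn, map_zero]) n hn

/-- Mutually local families of homogeneous modes on a graded space. -/
structure IsGradedModes (g : G → ℤ → Module.End k V) (one : V) (gr : ℤ → Submodule k V)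
    (deg : G → ℤ) : Prop where
  loc : ∀ a b, IsLoc (cm (g a) (g b))
  create : ∀ a n, 0 ≤ n → g a n one = 0
  one_mem : one ∈ gr 0
  mode_mem : ∀ a n i, ∀ x ∈ gr i, g a n x ∈ gr (deg a + i - n - 1)

/-- The functionals of degree `d`: those which vanish on all components but `V_d`. -/
def IsDegree (gr : ℤ → Submodule k V) (d : ℤ) (f : V →ₗ[k] k) : Prop :=
  ∀ n, n ≠ d → ∀ x ∈ gr n, f x = 0

variable {gr : ℤ → Submodule k V} {deg : G → ℤ}

theorem IsGradedModes.isDegree_comp (hg : IsGradedModes g one gr deg) {d : ℤ} {f : V →ₗ[k] k}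
    (hf : IsDegree gr d f) (a : G) (n : ℤ) : IsDegree gr (d - deg a + n + 1) (f ∘ₗ g a n) := by
  intro i hi x hx
  exact hf _ (by omega) _ (hg.mode_mem a n i x hx)

theorem IsGradedModes.modeWord_mem (hg : IsGradedModes g one gr deg) {l : ℕ} (a : Fin l → G)
    (m : Fin l → ℤ) : modeWord g one l a m ∈ gr (∑ i, (deg (a i) - m i - 1)) := by
  induction l with
  | zero => simpa [modeWord] using hg.one_mem
  | succ l ih =>
    have := hg.mode_mem (a 0) (m 0) _ _ (ih (Fin.tail a) (Fin.tail m))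
    rw [Fin.sum_univ_succ]
    have e : deg (a 0) - m 0 - 1 + ∑ i : Fin l, (deg (a i.succ) - m i.succ - 1) =
        deg (a 0) + ∑ i, (deg (Fin.tail a i) - Fin.tail m i - 1) - m 0 - 1 := by
      simp only [Fin.tail]; ring
    rw [e]
    exact this

/-- The degrees of the non-zero words in given letters are bounded below. -/
theorem IsGradedModes.exists_degree_bound (hg : IsGradedModes g one gr deg) {l : ℕ}
    (a : Fin l → G) : ∃ d₀, ∀ d, d < d₀ → ∀ f : V →ₗ[k] k, IsDegree gr d f →
      ∀ m, f (modeWord g one l a m) = 0 := by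
  induction l with
  | zero => exact ⟨0, fun d hd f hf m => hf 0 hd.ne' _ hg.one_mem⟩
  | succ l ih =>
    obtain ⟨d₀, hd₀⟩ := ih (Fin.tail a)
    obtain ⟨js, hjs⟩ := exists_subMulList_modeWord hg.loc hg.create (a 0) (Fin.tail a)
    refine ⟨d₀ + deg (a 0) - 1 - js.length, fun d hd f hf m => ?_⟩
    let F : ℤ → (Fin l → ℤ) → k := fun n m => f (g (a 0) n (modeWord g one l (Fin.tail a) m))
    have hF : ∀ n, n < d₀ - d + deg (a 0) - 1 → F n = 0 := fun n hn => funext fun m =>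
      hd₀ _ (by omega) _ (hg.isDegree_comp hf (a 0) n) m
    have h0 : subMulList (shiftIdx k k) js F = 0 := by
      funext n
      by_cases hn : 0 ≤ n
      · have := congrFun (subMulList_map_id (T := shiftIdx k V) (T' := shiftIdx k k)
          (f.compLeft (Fin l → ℤ)) (fun _ _ => rfl) js
          (fun n m => g (a 0) n (modeWord g one l (Fin.tail a) m))) n
        refine this.trans ?_
        rw [hjs n hn, map_zero]; rfl
      · exact subMulList_vanish _ js hF n (by omega)
    exact congrFun (congrFun (eq_zero_of_subMulList js hF h0) (m 0)) (Fin.tail m)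

/-- The matrix coefficients of words are the expansions of rational functions. -/
theorem IsGradedModes.exists_corrFn (hg : IsGradedModes g one gr deg) {l : ℕ}
    (a : Fin l → G) {d : ℤ} {f : V →ₗ[k] k} (hf : IsDegree gr d f) :
    ∃ α ∈ phiAlg k l, ∀ m, coeffIterL k m α = f (modeWord g one l a m) := by
  induction l generalizing d f with
  | zero =>
    refine ⟨algebraMap k _ (f one), algebraMap_mem _ _, fun m => ?_⟩
    rw [coeffIterL_apply]
    exact constValue_algebraMap _
  | succ l ih =>
    choose β hβΦ hβ using fun n => ih (Fin.tail a) (hg.isDegree_comp hf (a 0) n)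
    obtain ⟨d₀, hd₀⟩ := hg.exists_degree_bound (Fin.tail a)
    obtain ⟨js, hjs⟩ := exists_subMulList_modeWord hg.loc hg.create (a 0) (Fin.tail a)
    let ci : RatFn k l →ₗ[k] ((Fin l → ℤ) → k) := LinearMap.pi fun m => coeffIterL k m
    obtain ⟨α, hα, hαβ⟩ := exists_coeffL_eq js (β := β) (n₀ := d₀ - d + deg (a 0) - 1)
      (fun n hn => coeffIterL_ext fun m => by
        rw [hβ, map_zero]
        exact hd₀ _ (by omega) _ (hg.isDegree_comp hf (a 0) n) m) hβΦ (fun n hn => by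
        have h1 := congrFun (subMulList_map_id (T := fun j => LinearMap.mulLeft k (z j))
          (T' := shiftIdx k k) ci
          (fun i x => funext fun m => coeffIterL_z_mul i x m) js β) n
        have h2 := congrFun (subMulList_map_id (T := shiftIdx k V) (T' := shiftIdx k k)
          (f.compLeft (Fin l → ℤ)) (fun _ _ => rfl) js
          (fun n m => g (a 0) n (modeWord g one l (Fin.tail a) m))) n
        have e : (fun n => ci (β n)) = fun n => f.compLeft (Fin l → ℤ)
            (fun m => g (a 0) n (modeWord g one l (Fin.tail a) m)) := by
          funext n m; exact hβ n m
        rw [e, h2, hjs n hn, map_zero] at h1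
        refine coeffIterL_ext fun m => ?_
        rw [map_zero]
        exact (congrFun h1 m).symm)
    refine ⟨α, hα, fun m => ?_⟩
    rw [coeffIterL_succ, hαβ, hβ]
    rfl

/-- The effect of exchanging two neighbouring letters on correlation functions. -/
theorem IsGradedModes.corrFn_swap (hg : IsGradedModes g one gr deg) {l : ℕ} (i : Fin l)
    (a : Fin (l + 1) → G) {d : ℤ} {f : V →ₗ[k] k} (hf : IsDegree gr d f) {α α' : RatFn k (l + 1)}
    (hα : ∀ m, coeffIterL k m α = f (modeWord g one _ a m))
    (hα' : ∀ m, coeffIterL k m α' =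
      f (modeWord g one _ (a ∘ Equiv.swap i.castSucc i.succ) m)) :
    permAct k (Equiv.swap i.castSucc i.succ) α' = α := by
  induction l generalizing d f with
  | zero => exact i.elim0
  | succ l ih =>
    induction i using Fin.cases with
    | zero =>
      rw [Fin.castSucc_zero, show Fin.succ (0 : Fin (l + 1)) = 1 from rfl] at *
      have hαΦ : α ∈ Phi k (l + 2) := by
        obtain ⟨γ, hγ, h⟩ := hg.exists_corrFn a hf
        rwa [coeffIterL_ext fun m => (hα m).trans (h m).symm]
      obtain ⟨N, hN⟩ := exists_pow_mul_mem_swapOK hαΦ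
      obtain ⟨N', hN'⟩ := hg.loc (a 0) (a 1)
      have hN2 : (z 0 - z 1) ^ (N + N') * α ∈ swapOK k l := by
        rw [pow_add, mul_comm (_ ^ N), mul_assoc]
        have h01 : SwapMul (z 0 - z 1 : RatFn k (l + 2)) := by
          rw [sub_eq_add_neg]; exact (swapMul_z 0).add (swapMul_z 1).neg
        exact h01.pow N' _ hN
      have h1 := dd_iter_of_mem_swapOK hN2
      have hcm : dd^[N + N'] (cm (g (a 0)) (g (a 1))) = 0 :=
        dd_iter_mono (Nat.le_add_left _ _) hN'
      have ht : Fin.tail (Fin.tail (a ∘ Equiv.swap 0 1)) = Fin.tail (Fin.tail a) := by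
        funext i
        have : (Equiv.swap (0 : Fin (l + 2)) 1) i.succ.succ = i.succ.succ :=
          Equiv.swap_apply_of_ne_of_ne (Fin.succ_ne_zero _)
            (fun h => Fin.succ_ne_zero i (Fin.succ_injective _ h))
        simp [Fin.tail, this]
      -- The two matrix coefficients agree up to a commutator, which is killed by `dd`.
      have h2 : dd^[N + N'] (fun m n => coeffL k l n (coeffL k (l + 1) m α)) =
          dd^[N + N'] (fun m n => coeffL k l m (coeffL k (l + 1) n α')) := by
        rw [← sub_eq_zero, ← dd_iter_sub]
        funext m n
        refine coeffIterL_ext fun p => ?_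
        have h3 := dd_iter_map (coeffIterL k p : RatFn k l →ₗ[k] k).toAddMonoidHom (N + N')
          ((fun m n => coeffL k l n (coeffL k (l + 1) m α)) -
            fun m n => coeffL k l m (coeffL k (l + 1) n α'))
        have h4 := dd_iter_map (f.toAddMonoidHom.comp (LinearMap.applyₗ' (M₂ := V) ℕ
          (modeWord g one l (Fin.tail (Fin.tail a)) p)).toAddMonoidHom) (N + N')
          (cm (g (a 0)) (g (a 1)))
        have e : (fun m n => (coeffIterL k p : RatFn k l →ₗ[k] k).toAddMonoidHom
          (((fun m n => coeffL k l n (coeffL k (l + 1) m α)) -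
            fun m n => coeffL k l m (coeffL k (l + 1) n α')) m n)) =
          fun m n => (f.toAddMonoidHom.comp (LinearMap.applyₗ' (M₂ := V) ℕ
          (modeWord g one l (Fin.tail (Fin.tail a)) p)).toAddMonoidHom)
          (cm (g (a 0)) (g (a 1)) m n) := by
          funext m n
          have hA := hα (Fin.cons m (Fin.cons n p))
          have hB := hα' (Fin.cons n (Fin.cons m p))
          rw [coeffIterL_cons, coeffIterL_cons] at hA hB
          simp only [modeWord, Fin.tail_cons, Fin.cons_zero, ht] at hA hB
          simp only [LinearMap.toAddMonoidHom_coe, Pi.sub_apply, map_sub, hA, hB,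
            AddMonoidHom.comp_apply, cm]
          simp [Fin.tail]
        rw [e, h4] at h3
        have h5 := congrFun (congrFun h3 m) n
        simp only [hcm] at h5
        rw [Pi.zero_apply, Pi.zero_apply, map_zero]
        exact h5.symm.trans (by simp)
      have h6 : (z 1 - z 0) ^ (N + N') * (α' - permAct k (Equiv.swap 0 1) α) = 0 := by
        refine coeffL_ext fun n => coeffL_ext fun m => ?_
        rw [coeffL_coeffL_pow_mul']
        have h7 := sub_eq_zero.mpr (h2.symm.trans h1)
        rw [← dd_iter_sub] at h7
        have h8 := congrFun (congrFun h7 m) n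
        simp only [map_zero, map_sub]
        exact h8
      rw [mul_eq_zero_iff_left (pow_ne_zero _ (z_sub_z_ne_zero (by simp))), sub_eq_zero] at h6
      rw [h6, permAct_swap_swap]
    | succ i =>
      have hs : Equiv.swap i.succ.castSucc i.succ.succ = extPerm (Equiv.swap i.castSucc i.succ) := by
        refine Equiv.ext fun x => ?_
        induction x using Fin.cases with
        | zero =>
          rw [extPerm_zero, Equiv.swap_apply_of_ne_of_ne] <;> simp [Fin.ext_iff]
        | succ x =>
          rw [extPerm_succ, ← Fin.succ_castSucc, Fin.succ_injective _ |>.swap_apply]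
      rw [hs] at hα' ⊢
      refine coeffL_ext fun n => ?_
      rw [coeffL_permAct]
      refine ih i (Fin.tail a) (hg.isDegree_comp hf (a 0) n) (fun m => ?_) (fun m => ?_)
      · rw [← coeffIterL_cons, hα]; rfl
      · rw [← coeffIterL_cons, hα']
        have ht : Fin.tail (a ∘ extPerm (Equiv.swap i.castSucc i.succ)) =
            Fin.tail a ∘ Equiv.swap i.castSucc i.succ := by
          funext x; simp [Fin.tail, extPerm_succ]
        have h0 : (a ∘ extPerm (Equiv.swap i.castSucc i.succ)) 0 = a 0 := by simp [extPerm_zero]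
        simp only [modeWord, Fin.tail_cons, Fin.cons_zero, ht, h0]
        rfl

/-- Permuting a word permutes the variables of its correlation functions. For adjacent transpositions
this is locality, and a rational function is determined by its expansion. -/
theorem IsGradedModes.corrFn_perm (hg : IsGradedModes g one gr deg) {l : ℕ}
    (σ : Equiv.Perm (Fin l)) (a : Fin l → G) {d : ℤ} {f : V →ₗ[k] k} (hf : IsDegree gr d f)
    {α α' : RatFn k l} (hα : ∀ m, coeffIterL k m α = f (modeWord g one _ a m))
    (hα' : ∀ m, coeffIterL k m α' = f (modeWord g one _ (a ∘ σ) m)) :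
    permAct k σ α' = α := by
  cases l with
  | zero =>
    have : σ = 1 := Subsingleton.elim _ _
    subst this
    rw [permAct_one]
    exact coeffIterL_ext fun m => (hα' m).trans (hα m).symm
  | succ l =>
    have hσ : σ ∈ Submonoid.closure (Set.range fun i : Fin l ↦ Equiv.swap i.castSucc i.succ) := by
      rw [Equiv.Perm.mclosure_swap_castSucc_succ]; trivial
    induction hσ using Submonoid.closure_induction generalizing a α α' with
    | mem σ hσ =>
      obtain ⟨i, rfl⟩ := hσ
      exact hg.corrFn_swap i a hf hα hα'
    | one =>
      rw [permAct_one]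
      exact coeffIterL_ext fun m => (hα' m).trans (hα m).symm
    | mul σ τ _ _ ih ih' =>
      obtain ⟨γ, -, hγ⟩ := hg.exists_corrFn (a ∘ σ) hf
      rw [permAct_mul, ih' (a ∘ σ) hγ hα', ih a hα hγ]

end Words

section ModesOfVertexAlgebra

variable {k : Type u} [Field k] {V : Type v} [AddCommGroup V] [Module k V]

theorem isLoc_choose_smul {M : Type*} [AddCommGroup M] (s : ℕ) (h : ℤ → M) :
    IsLoc (fun m n => (Ring.choose m s : ℤ) • h (m + n)) := by
  refine ⟨s + 1, ?_⟩
  induction s generalizing h with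
  | zero =>
    funext m n
    simp [dd, add_right_comm, add_assoc]
  | succ s ih =>
    rw [iterate_succ_apply]
    have e : dd (fun m n => (Ring.choose m (s + 1) : ℤ) • h (m + n)) =
        fun m n => (Ring.choose m s : ℤ) • h (m + n + 1) := by
      funext m n
      simp only [dd]
      rw [Ring.choose_succ_succ, add_smul, show m + 1 + n = m + n + 1 by ring, ← add_assoc]
      abel
    rw [e]
    exact ih fun n => h (n + 1)

/-- The commutator formula implies locality. -/
theorem VertexAlgebra.isLoc (A : VertexAlgebra k V) (x y : V) :
    IsLoc (cm (fun n => A.prod n x) (fun n => A.prod n y)) := by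
  obtain ⟨N, hN⟩ := A.prod_eq_zero x y
  have e : cm (fun n => A.prod n x) (fun n => A.prod n y) =
      ∑ s ∈ Finset.range N.toNat, fun m n =>
        (Ring.choose m s : ℤ) • A.prod (m + n - s) (A.prod s x y) := by
    funext m n
    refine LinearMap.ext fun c => ?_
    simp only [cm, LinearMap.sub_apply, Module.End.mul_apply, Finset.sum_apply,
      LinearMap.sum_apply, LinearMap.smul_apply]
    rw [A.commutator]
    refine finsum_eq_sum_of_support_subset _ fun s hs => ?_
    rw [Finset.coe_range, Set.mem_Iio]
    by_contra h
    apply hs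
    simp only
    rw [hN s (by omega), map_zero, LinearMap.zero_apply, smul_zero]
  rw [e]
  refine Finset.sum_induction _ IsLoc (fun _ _ => IsLoc.add) IsLoc.zero fun s _ => ?_
  exact isLoc_choose_smul s fun p => A.prod (p - s) (A.prod s x y)

theorem Sl2VertexAlgebra.isGradedModes (A : Sl2VertexAlgebra k V) {G : Type w} {deg : G → ℤ}
    {j : G → V} (hj : ∀ a, j a ∈ A.gr (deg a)) :
    IsGradedModes (fun a n => A.prod n (j a)) A.one A.gr deg where
  loc a b := A.isLoc (j a) (j b)
  create a n hn := A.prod_one_of_nonneg n hn (j a)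
  one_mem := A.one_mem
  mode_mem a n _ _ hx := A.prod_mem _ _ n _ _ (hj a) hx

end ModesOfVertexAlgebra

/-! ### The vertex algebra of a vertex coalgebra of rational functions -/

section Families

variable {k : Type u} [Field k] {G : Type v} {deg : G → ℤ} {loc : G → G → ℤ}
  {Ω : (l : ℕ) → (Fin l → G) → Submodule k (RatFn k l)}

/-- The equivariant families of functions in `Ω`, one for each word. -/
def families (Ω : (l : ℕ) → (Fin l → G) → Submodule k (RatFn k l)) :
    Submodule k ((l : ℕ) → (Fin l → G) → RatFn k l) where
  carrier := {x | ∀ l a, x l a ∈ Ω l a ∧ ∀ σ : Equiv.Perm (Fin l), permAct k σ (x l (a ∘ σ)) = x l a}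
  zero_mem' := fun l a => ⟨zero_mem _, fun σ => map_zero _⟩
  add_mem' := fun hx hy l a => ⟨add_mem (hx l a).1 (hy l a).1, fun σ => by
    simp only [Pi.add_apply, map_add, (hx l a).2, (hy l a).2]⟩
  smul_mem' := fun c x hx l a => ⟨Submodule.smul_mem _ _ (hx l a).1, fun σ => by
    simp only [Pi.smul_apply, map_smul, (hx l a).2]⟩

theorem IsVertexCoalgebra.euler_mem (hΩ : IsVertexCoalgebra deg loc Ω) {l : ℕ} {a : Fin l → G}
    {α : RatFn k l} (hα : α ∈ Ω l a) : euler α ∈ Ω l a := by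
  rw [hΩ.graded] at hα
  rw [euler_eq_wop]
  induction hα using Submodule.span_induction with
  | mem α h =>
    obtain ⟨h1, d, h2⟩ := h
    rw [← euler_eq_wop, h2.euler]
    exact zsmul_mem h1 d
  | zero => rw [map_zero]; exact zero_mem _
  | add α β _ _ h1 h2 => rw [map_add]; exact add_mem h1 h2
  | smul c α _ h => rw [map_smul]; exact Submodule.smul_mem _ _ h

theorem IsVertexCoalgebra.wop_mem (hΩ : IsVertexCoalgebra deg loc Ω) {l : ℕ} {a : Fin l → G}
    {α : RatFn k l} (hα : α ∈ Ω l a) (s : Fin 3) : wop s (deg ∘ a) α ∈ Ω l a := by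
  fin_cases s
  · exact wop_zero (deg ∘ a) α ▸ hΩ.Delta_mem a α hα
  · refine (wop_one (deg ∘ a) α).symm ▸ add_mem (hΩ.euler_mem hα) (zsmul_mem hα _)
  · exact wop_two (deg ∘ a) α ▸ hΩ.DeltaStar_mem a α hα

/-- The letter `a` acts on families by taking the coefficient of `z_0^{-n-1}` at `z_0 = ∞` in the
words which begin with `a`. -/
def contract (hΩ : IsVertexCoalgebra deg loc Ω) (a : G) (n : ℤ) : Module.End k (families Ω) :=
  LinearMap.restrict
    { toFun := fun x l b => coeffL k l n (x (l + 1) (Fin.cons a b))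
      map_add' := fun x y => by funext l b; simp
      map_smul' := fun c x => by funext l b; simp }
    fun x hx l b => by
      refine ⟨by simpa using! hΩ.coeff_mem _ _ (hx (l + 1) (Fin.cons a b)).1 n, fun σ => ?_⟩
      have e : (Fin.cons a (b ∘ σ) : Fin (l + 1) → G) = (Fin.cons a b : Fin (l + 1) → G) ∘
          extPerm σ := by
        funext i
        refine Fin.cases ?_ (fun i => ?_) i
        · simp [extPerm_zero]
        · simp [extPerm_succ]
      simp only [LinearMap.coe_mk, AddHom.coe_mk]
      rw [← coeffL_permAct, e, (hx (l + 1) (Fin.cons a b)).2]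

theorem contract_apply (hΩ : IsVertexCoalgebra deg loc Ω) (a : G) (n : ℤ) (x : families Ω) (l : ℕ)
    (b : Fin l → G) : (contract hΩ a n x).1 l b = coeffL k l n (x.1 (l + 1) (Fin.cons a b)) := rfl

/-- The operators `Δ`, Euler operator plus degree, and `Δ*` on families. -/
def sl₂Op (hΩ : IsVertexCoalgebra deg loc Ω) (s : Fin 3) : Module.End k (families Ω) :=
  LinearMap.restrict
    { toFun := fun x l a => wop s (deg ∘ a) (x l a)
      map_add' := fun x y => by funext l b; simp
      map_smul' := fun c x => by funext l b; simp }
    fun x hx l a => ⟨hΩ.wop_mem (hx l a).1 s, fun σ => by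
      have := permAct_wop s (deg ∘ a) σ (x l (a ∘ σ))
      rw [(hx l a).2] at this
      exact this⟩

theorem sl₂Op_apply (hΩ : IsVertexCoalgebra deg loc Ω) (s : Fin 3) (x : families Ω) (l : ℕ)
    (a : Fin l → G) : (sl₂Op hΩ s x).1 l a = wop s (deg ∘ a) (x.1 l a) := rfl

theorem weight_comp {l : ℕ} (a : Fin l → G) (σ : Equiv.Perm (Fin l)) :
    weight (a ∘ σ) = weight a :=
  Equiv.sum_comp σ fun i => Finsupp.single (a i) 1

theorem weight_cons (a : G) {l : ℕ} (b : Fin l → G) :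
    weight (Fin.cons a b : Fin (l + 1) → G) = Finsupp.single a 1 + weight b := by
  simp [weight, Fin.sum_univ_succ]

/-- Multiplication of a family by the multiplicity of the letter `c`. -/
def countOp (Ω : (l : ℕ) → (Fin l → G) → Submodule k (RatFn k l)) (c : G) :
    Module.End k (families Ω) :=
  LinearMap.restrict
    { toFun := fun x l a => (weight a c : k) • x l a
      map_add' := fun x y => by funext l b; simp
      map_smul' := fun r x => by funext l b; simp [smul_comm r] }
    fun x hx l a => ⟨Submodule.smul_mem _ _ (hx l a).1, fun σ => by
      simp only [LinearMap.coe_mk, AddHom.coe_mk, map_smul, (hx l a).2, weight_comp]⟩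

theorem families_ext {x y : families Ω} (h : ∀ l a, x.1 l a = y.1 l a) : x = y :=
  Subtype.ext (funext fun l => funext fun a => h l a)

theorem contract_sl₂Op (hΩ : IsVertexCoalgebra deg loc Ω) (s : Fin 3) (a : G) (n : ℤ) :
    contract hΩ a n * sl₂Op hΩ s - sl₂Op hΩ s * contract hΩ a n =
      ((s : ℕ) * deg a - n - (s : ℕ) : ℤ) • contract hΩ a (n + (s : ℕ) - 1) := by
  refine LinearMap.ext fun x => families_ext fun l b => ?_
  have h := coeffL_wop s (deg ∘ (Fin.cons a b : Fin (l + 1) → G)) n (x.1 (l + 1) (Fin.cons a b))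
  have ht : Fin.tail (deg ∘ (Fin.cons a b : Fin (l + 1) → G)) = deg ∘ b := by
    funext i; simp [Fin.tail]
  rw [ht] at h
  simp only [LinearMap.sub_apply, Module.End.mul_apply, LinearMap.smul_apply]
  change coeffL k l n _ - wop s (deg ∘ b) (coeffL k l n _) =
    ((s : ℕ) * deg a - n - (s : ℕ) : ℤ) • coeffL k l _ _
  rw [sub_eq_iff_eq_add']
  refine h.trans ?_
  simp

theorem contract_countOp (hΩ : IsVertexCoalgebra deg loc Ω) (c : G) (a : G) (n : ℤ) :
    contract hΩ a n * countOp Ω c - countOp Ω c * contract hΩ a n =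
      (Finsupp.single a 1 c : ℕ) • contract hΩ a n := by
  refine LinearMap.ext fun x => families_ext fun l b => ?_
  simp only [LinearMap.sub_apply, Module.End.mul_apply, LinearMap.smul_apply]
  change coeffL k l n _ - (weight b c : k) • (coeffL k l n _) =
    (Finsupp.single a 1 c : ℕ) • coeffL k l _ _
  rw [sub_eq_iff_eq_add']
  change coeffL k l n ((weight (Fin.cons a b : Fin (l + 1) → G) c : k) • _) = _
  rw [weight_cons, map_smul, Finsupp.add_apply, Nat.cast_add, add_smul, Nat.cast_smul_eq_nsmul,
    add_comm]

/-- The letters are mutually local: the order of locality is given by the bound on the poles. -/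
theorem contract_comm (hΩ : IsVertexCoalgebra deg loc Ω) (a b : G) :
    dd^[(loc a b).toNat]
      (fun m n => contract hΩ b n * contract hΩ a m - contract hΩ a m * contract hΩ b n) = 0 := by
  funext m n
  refine LinearMap.ext fun x => families_ext fun l c => ?_
  let φ : Module.End k (families Ω) →+ RatFn k l :=
    { toFun := fun T => (T x).1 l c
      map_zero' := rfl
      map_add' := fun _ _ => rfl }
  have h1 := dd_iter_map φ (loc a b).toNat
    (fun m n => contract hΩ b n * contract hΩ a m - contract hΩ a m * contract hΩ b n)
  refine (congrFun (congrFun h1 m) n).symm.trans ?_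
  set w : Fin (l + 2) → G := Fin.cons a (Fin.cons b c) with hw
  have hx := x.2 (l + 2) w
  have hsw : (Fin.cons b (Fin.cons a c) : Fin (l + 2) → G) = w ∘ Equiv.swap 0 1 := by
    funext i
    refine Fin.cases ?_ (fun i => Fin.cases ?_ (fun i => ?_) i) i
    · simp [hw]
    · simp [hw]
    · have : (Equiv.swap (0 : Fin (l + 2)) 1) i.succ.succ = i.succ.succ :=
        Equiv.swap_apply_of_ne_of_ne (Fin.succ_ne_zero _)
          (fun h => Fin.succ_ne_zero i (Fin.succ_injective _ h))
      simp [hw, this]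
  have h01 : (0 : Fin (l + 2)) < 1 := by simp
  have hord : OrdGe 0 1 (-loc a b) (x.1 (l + 2) w) := hΩ.ord_ge w _ hx.1 0 1 h01
  have h2 := dd_iter_of_mem_swapOK (pow_mul_mem_swapOK (hΩ.le_Phi w _ hx.1) hord
    (Int.self_le_toNat (loc a b)))
  have h3 : permAct k (Equiv.swap 0 1) (x.1 (l + 2) w) =
      x.1 (l + 2) (Fin.cons b (Fin.cons a c)) := by
    rw [hsw, ← hx.2 (Equiv.swap 0 1), permAct_swap_swap]
  rw [h3, ← sub_eq_zero, ← dd_iter_sub] at h2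
  exact congrFun (congrFun h2 m) n

/-- The value of a family at the empty word. -/
def vacuum (Ω : (l : ℕ) → (Fin l → G) → Submodule k (RatFn k l)) :
    (families Ω →ₗ[k] k) where
  toFun x := constValue (x.1 0 Fin.elim0)
  map_add' x y := map_add _ _ _
  map_smul' c x := by
    change constValue (c • x.1 0 Fin.elim0) = _
    rw [Algebra.smul_def, map_mul, constValue_algebraMap]; rfl

theorem vacuum_apply (x : families Ω) (a : Fin 0 → G) : vacuum Ω x = constValue (x.1 0 a) := by
  rw [Subsingleton.elim a Fin.elim0]; rfl

theorem vacuum_sl₂Op (hΩ : IsVertexCoalgebra deg loc Ω) (s : Fin 3) :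
    vacuum Ω ∘ₗ sl₂Op hΩ s = 0 := by
  refine LinearMap.ext fun x => ?_
  change constValue (wop s (deg ∘ Fin.elim0) (x.1 0 Fin.elim0)) = 0
  rw [wop_apply, Finset.univ_eq_empty, Finset.sum_empty, map_zero]

theorem vacuum_countOp (c : G) : vacuum Ω ∘ₗ countOp Ω c = 0 := by
  refine LinearMap.ext fun x => ?_
  change constValue ((weight _ c : k) • _) = 0
  simp [weight]

theorem coeffL_ofPoly {l : ℕ} (p : MvPolynomial (Fin (l + 1)) k) {n : ℤ} (hn : 0 ≤ n) :
    coeffL k l n (ofPoly p) = 0 := by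
  induction p using MvPolynomial.induction_on generalizing n with
  | C c =>
    have e : ofPoly (MvPolynomial.C c) = emb (algebraMap k (RatFn k l) c) := by
      rw [AlgHom.commutes]; rfl
    rw [e, coeffL_emb, if_neg (by omega)]
  | add p q hp hq => rw [ofPoly_add, map_add, hp hn, hq hn, add_zero]
  | mul_X p i hp =>
    rw [ofPoly_mul, mul_comm]
    change coeffL k l n (z i * _) = 0
    refine Fin.cases ?_ (fun i => ?_) i
    · rw [coeffL_z_zero_mul, hp (by omega)]
    · rw [coeffL_z_succ_mul, hp hn, mul_zero]

theorem vacuum_contract (hΩ : IsVertexCoalgebra deg loc Ω) (a : G) {n : ℤ} (hn : 0 ≤ n) :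
    vacuum Ω ∘ₗ contract hΩ a n = 0 := by
  refine LinearMap.ext fun x => ?_
  change constValue (coeffL k 0 n (x.1 1 (Fin.cons a Fin.elim0))) = 0
  obtain ⟨p, hp⟩ := (hΩ.single _ _).mp (x.2 1 (Fin.cons a Fin.elim0)).1
  rw [hp, coeffL_ofPoly p hn, map_zero]

/-- The operator on the dual space given by a letter. -/
def dualMode (hΩ : IsVertexCoalgebra deg loc Ω) (a : G) (n : ℤ) :
    Module.End k ((families Ω →ₗ[k] k)) :=
  LinearMap.lcomp k k (contract hΩ a n)

theorem modeWord_dual_apply (hΩ : IsVertexCoalgebra deg loc Ω) {l : ℕ} (a : Fin l → G)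
    (m : Fin l → ℤ) (x : families Ω) :
    modeWord (dualMode hΩ) (vacuum Ω) l a m x = coeffIterL k m (x.1 l a) := by
  induction l generalizing x with
  | zero => exact vacuum_apply x a
  | succ l ih =>
    rw [modeWord, coeffIterL_succ]
    refine (ih (Fin.tail a) (Fin.tail m) (contract hΩ (a 0) (m 0) x)).trans ?_
    rw [contract_apply, Fin.cons_self_tail]

end Families

section Construction

variable {k : Type u} [Field k] {G : Type v} {deg : G → ℤ} {loc : G → G → ℤ}
  {Ω : (l : ℕ) → (Fin l → G) → Submodule k (RatFn k l)}

/-- The span of all words in the dual space of the space of families. -/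
def wordSpan (hΩ : IsVertexCoalgebra deg loc Ω) : Submodule k ((families Ω →ₗ[k] k)) :=
  Submodule.span k {x | ∃ l a m, x = modeWord (dualMode hΩ) (vacuum Ω) l a m}

theorem modeWord_cons {V : Type*} [AddCommGroup V] [Module k V] (g : G → ℤ → Module.End k V)
    (one : V) {l : ℕ} (a : G) (n : ℤ) (b : Fin l → G) (m : Fin l → ℤ) :
    modeWord g one (l + 1) (Fin.cons a b) (Fin.cons n m) = g a n (modeWord g one l b m) := by
  simp [modeWord]

theorem dualMode_mem (hΩ : IsVertexCoalgebra deg loc Ω) (a : G) (n : ℤ) :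
    ∀ x ∈ wordSpan hΩ, dualMode hΩ a n x ∈ wordSpan hΩ := by
  intro x hx
  induction hx using Submodule.span_induction with
  | mem x h =>
    obtain ⟨l, b, m, rfl⟩ := h
    exact Submodule.subset_span ⟨l + 1, Fin.cons a b, Fin.cons n m, (modeWord_cons _ _ _ _ _ _).symm⟩
  | zero => rw [map_zero]; exact zero_mem _
  | add x y _ _ h1 h2 => rw [map_add]; exact add_mem h1 h2
  | smul c x _ h => rw [map_smul]; exact Submodule.smul_mem _ _ h

/-- An operator on families which normalizes the contractions and kills the vacuum acts on the
span of words. -/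
theorem lcomp_mem (hΩ : IsVertexCoalgebra deg loc Ω) {T : Module.End k (families Ω)}
    (h1 : vacuum Ω ∘ₗ T = 0) (h : ∀ a n, ∃ c n' : ℤ,
      contract hΩ a n * T - T * contract hΩ a n = c • contract hΩ a n') :
    ∀ x ∈ wordSpan hΩ, LinearMap.lcomp k k T x ∈ wordSpan hΩ := by
  intro x hx
  induction hx using Submodule.span_induction with
  | mem x hx =>
    obtain ⟨l, a, m, rfl⟩ := hx
    induction l with
    | zero => rw [show LinearMap.lcomp k k T (modeWord (dualMode hΩ) (vacuum Ω) 0 a m) = 0 from h1]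
              exact zero_mem _
    | succ l ih =>
      set w := modeWord (dualMode hΩ) (vacuum Ω) l (Fin.tail a) (Fin.tail m) with hw
      obtain ⟨c, n', hc⟩ := h (a 0) (m 0)
      have e : LinearMap.lcomp k k T (modeWord (dualMode hΩ) (vacuum Ω) (l + 1) a m) =
          dualMode hΩ (a 0) (m 0) (LinearMap.lcomp k k T w) + c • dualMode hΩ (a 0) n' w := by
        refine LinearMap.ext fun x => ?_
        have := congrArg w (LinearMap.congr_fun hc x)
        rw [LinearMap.sub_apply, map_sub, sub_eq_iff_eq_add', LinearMap.smul_apply, map_zsmul] at this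
        exact this
      have hwm : w ∈ wordSpan hΩ := Submodule.subset_span ⟨l, _, _, rfl⟩
      rw [e]
      exact add_mem (dualMode_mem hΩ _ _ _ (ih _ _))
        (zsmul_mem (dualMode_mem hΩ _ _ _ hwm) _)
  | zero => rw [map_zero]; exact zero_mem _
  | add x y _ _ h1 h2 => rw [map_add]; exact add_mem h1 h2
  | smul c x _ h => rw [map_smul]; exact Submodule.smul_mem _ _ h

/-- The underlying space of the vertex algebra of `Ω`. -/
def Space (hΩ : IsVertexCoalgebra deg loc Ω) : Type (max u v) := wordSpan hΩ

instance (hΩ : IsVertexCoalgebra deg loc Ω) : AddCommGroup (Space hΩ) :=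
  inferInstanceAs (AddCommGroup (wordSpan hΩ))

instance (hΩ : IsVertexCoalgebra deg loc Ω) : Module k (Space hΩ) :=
  inferInstanceAs (Module k (wordSpan hΩ))

/-- The pairing of the vertex algebra with families of functions. -/
def pair (hΩ : IsVertexCoalgebra deg loc Ω) : Space hΩ →ₗ[k] families Ω →ₗ[k] k :=
  (wordSpan hΩ).subtype

theorem pair_ext {hΩ : IsVertexCoalgebra deg loc Ω} {x y : Space hΩ}
    (h : ∀ e, pair hΩ x e = pair hΩ y e) : x = y :=
  Subtype.ext (LinearMap.ext h)

/-- The restriction of an operator on the dual space to the span of words. -/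
def restrictOp (hΩ : IsVertexCoalgebra deg loc Ω) (T : Module.End k (families Ω →ₗ[k] k))
    (h : ∀ x ∈ wordSpan hΩ, T x ∈ wordSpan hΩ) : Module.End k (Space hΩ) where
  toFun x := ⟨T x.1, h _ x.2⟩
  map_add' x y := Subtype.ext (map_add T x.1 y.1)
  map_smul' c x := Subtype.ext (map_smul T c x.1)

/-- The modes of a letter on the span of words. -/
def mode (hΩ : IsVertexCoalgebra deg loc Ω) (a : G) (n : ℤ) : Module.End k (Space hΩ) :=
  restrictOp hΩ (dualMode hΩ a n) (dualMode_mem hΩ a n)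

/-- The vacuum vector. -/
def vac (hΩ : IsVertexCoalgebra deg loc Ω) : Space hΩ :=
  ⟨vacuum Ω, Submodule.subset_span ⟨0, Fin.elim0, Fin.elim0, rfl⟩⟩

theorem coe_modeWord (hΩ : IsVertexCoalgebra deg loc Ω) {l : ℕ} (a : Fin l → G) (m : Fin l → ℤ) :
    pair hΩ (modeWord (mode hΩ) (vac hΩ) l a m) = modeWord (dualMode hΩ) (vacuum Ω) l a m := by
  induction l with
  | zero => rfl
  | succ l ih => rw [modeWord, modeWord, ← ih]; rfl

/-- Words are evaluated on families by taking coefficients. -/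
theorem modeWord_apply (hΩ : IsVertexCoalgebra deg loc Ω) {l : ℕ} (a : Fin l → G)
    (m : Fin l → ℤ) (x : families Ω) :
    pair hΩ (modeWord (mode hΩ) (vac hΩ) l a m) x = coeffIterL k m (x.1 l a) := by
  rw [coe_modeWord, modeWord_dual_apply]

/-- The operators `D`, the degree and `D*` on the span of words, for `s = 0, 1, 2`. -/
def sl₂ (hΩ : IsVertexCoalgebra deg loc Ω) (s : Fin 3) : Module.End k (Space hΩ) :=
  restrictOp hΩ (LinearMap.lcomp k k (sl₂Op hΩ s)) (lcomp_mem hΩ (vacuum_sl₂Op hΩ s) fun a n =>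
    ⟨_, _, contract_sl₂Op hΩ s a n⟩)

/-- The multiplicity of the letter `c`, as an operator on the span of words. -/
def count (hΩ : IsVertexCoalgebra deg loc Ω) (c : G) : Module.End k (Space hΩ) :=
  restrictOp hΩ (LinearMap.lcomp k k (countOp Ω c)) (lcomp_mem hΩ (vacuum_countOp c) fun a n =>
    ⟨(Finsupp.single a 1 c : ℕ), n, by rw [contract_countOp, natCast_zsmul]⟩)

theorem sl₂_vac (hΩ : IsVertexCoalgebra deg loc Ω) (s : Fin 3) : sl₂ hΩ s (vac hΩ) = 0 :=
  Subtype.ext (vacuum_sl₂Op hΩ s)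

theorem count_vac (hΩ : IsVertexCoalgebra deg loc Ω) (c : G) : count hΩ c (vac hΩ) = 0 :=
  Subtype.ext (vacuum_countOp c)

theorem sl₂_mode (hΩ : IsVertexCoalgebra deg loc Ω) (s : Fin 3) (a : G) (n : ℤ) :
    sl₂ hΩ s * mode hΩ a n - mode hΩ a n * sl₂ hΩ s =
      ((s : ℕ) * deg a - n - (s : ℕ) : ℤ) • mode hΩ a (n + (s : ℕ) - 1) := by
  refine LinearMap.ext fun x => pair_ext fun y => ?_
  have := congrArg (pair hΩ x) (LinearMap.congr_fun (contract_sl₂Op hΩ s a n) y)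
  rw [LinearMap.sub_apply, map_sub, LinearMap.smul_apply, map_zsmul] at this
  exact this

theorem count_mode (hΩ : IsVertexCoalgebra deg loc Ω) (c a : G) (n : ℤ) :
    count hΩ c * mode hΩ a n - mode hΩ a n * count hΩ c =
      (Finsupp.single a 1 c : ℕ) • mode hΩ a n := by
  refine LinearMap.ext fun x => pair_ext fun y => ?_
  have := congrArg (pair hΩ x) (LinearMap.congr_fun (contract_countOp hΩ c a n) y)
  rw [LinearMap.sub_apply, map_sub, LinearMap.smul_apply, map_nsmul] at this
  exact this

theorem mode_isLoc (hΩ : IsVertexCoalgebra deg loc Ω) (a b : G) :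
    IsLoc (cm (mode hΩ a) (mode hΩ b)) := by
  refine ⟨(loc a b).toNat, ?_⟩
  funext m n
  refine LinearMap.ext fun x => pair_ext fun y => ?_
  let φ : Module.End k (Space hΩ) →+ k :=
    { toFun := fun T => pair hΩ (T x) y
      map_zero' := by simp
      map_add' := fun S T => by simp }
  let ψ : Module.End k (families Ω) →+ k :=
    { toFun := fun T => pair hΩ x (T y)
      map_zero' := map_zero _
      map_add' := fun _ _ => map_add _ _ _ }
  have h1 := dd_iter_map φ (loc a b).toNat (cm (mode hΩ a) (mode hΩ b))
  have h2 := dd_iter_map ψ (loc a b).toNat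
    (fun m n => contract hΩ b n * contract hΩ a m - contract hΩ a m * contract hΩ b n)
  have e : (fun m n => φ (cm (mode hΩ a) (mode hΩ b) m n)) = fun m n =>
      ψ (contract hΩ b n * contract hΩ a m - contract hΩ a m * contract hΩ b n) := by
    funext m n
    exact (map_sub (pair hΩ x) _ _).symm
  rw [e, h2, contract_comm] at h1
  refine (congrFun (congrFun h1 m) n).symm.trans (map_zero ψ)

/-- The modes of the letters on the span of words satisfy the hypotheses of the reconstruction
theorem. -/
theorem isGenerating (hΩ : IsVertexCoalgebra deg loc Ω) :
    IsGenerating (mode hΩ) (vac hΩ) (sl₂ hΩ 0) where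
  loc := mode_isLoc hΩ
  create a n hn := Subtype.ext (vacuum_contract hΩ a hn)
  D_one := sl₂_vac hΩ 0
  D_comm a n := by simpa using sl₂_mode hΩ 0 a n
  span P h1 h := by
    rw [eq_top_iff]
    rintro ⟨x, hx⟩ -
    suffices ∃ h : x ∈ wordSpan hΩ, (⟨x, h⟩ : Space hΩ) ∈ P from this.2
    induction hx using Submodule.span_induction with
    | mem x hx =>
      obtain ⟨l, a, m, rfl⟩ := hx
      have key : modeWord (mode hΩ) (vac hΩ) l a m ∈ P := by
        induction l with
        | zero => exact h1
        | succ l ih => exact h _ _ _ (ih _ _)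
      have e := coe_modeWord hΩ a m
      have hm : modeWord (dualMode hΩ) (vacuum Ω) l a m ∈ wordSpan hΩ :=
        Submodule.subset_span ⟨l, a, m, rfl⟩
      have e' : (⟨_, hm⟩ : Space hΩ) = modeWord (mode hΩ) (vac hΩ) l a m := Subtype.ext e.symm
      exact ⟨hm, e' ▸ key⟩
    | zero => exact ⟨zero_mem _, zero_mem _⟩
    | add x y _ _ hx hy => exact ⟨_, add_mem hx.2 hy.2⟩
    | smul c x _ hx => exact ⟨_, Submodule.smul_mem P c hx.2⟩

end Construction

/-! ### Gradings and spans of words -/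

section LinearAlgebra

variable {k : Type u} [Field k] {V : Type v} [AddCommGroup V] [Module k V]

/-- A family of subspaces which spans cannot be smaller than an independent family. -/
theorem eq_of_le_of_iSupIndep {κ : Type*} {p q : κ → Submodule k V} (hpq : ∀ i, p i ≤ q i)
    (hq : iSupIndep q) (hp : ⨆ i, p i = ⊤) (i : κ) : p i = q i := by
  refine le_antisymm (hpq i) fun x hx => ?_
  have hx' : x ∈ p i ⊔ ⨆ (j) (_ : j ≠ i), p j := by
    have : ⨆ j, p j ≤ p i ⊔ ⨆ (j) (_ : j ≠ i), p j := iSup_le fun j => by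
      by_cases h : j = i
      · subst h; exact le_sup_left
      · exact le_sup_of_le_right (le_iSup₂_of_le j h le_rfl)
    exact this (hp ▸ Submodule.mem_top)
  obtain ⟨y, hy, w, hw, rfl⟩ := Submodule.mem_sup.mp hx'
  have h1 : w ∈ q i := by simpa using sub_mem hx (hpq i hy)
  have h2 : w ∈ ⨆ (j) (_ : j ≠ i), q j := iSup₂_mono (fun j _ => hpq j) hw
  have h0 : w = 0 := (Submodule.disjoint_def.mp (hq i)) w h1 h2
  rwa [h0, add_zero]

/-- Simultaneous eigenspaces of commuting operators for distinct systems of eigenvalues are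
independent. -/
theorem iSupIndep_iInf_eigenspace [CharZero k] {κ : Type*} {T : κ → Module.End k V}
    (hT : ∀ i j, Commute (T i) (T j)) :
    iSupIndep fun μ : κ →₀ ℕ => ⨅ c, Module.End.eigenspace (T c) (μ c : k) := by
  have h1 := Module.End.independent_iInf_maxGenEigenspace_of_forall_mapsTo T
    fun i j φ => Module.End.mapsTo_maxGenEigenspace_of_comm (hT j i) φ
  have hinj : Injective fun (μ : κ →₀ ℕ) (c : κ) => (μ c : k) := fun μ ν h =>
    Finsupp.ext fun c => Nat.cast_injective (congrFun h c)
  exact (h1.comp hinj).mono fun μ => iInf_mono fun c =>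
    Module.End.eigenspace_le_maxGenEigenspace

/-- The restriction of a linear map to one component of a grading, extended by zero. -/
theorem exists_component_map {gr : ℤ → Submodule k V} (h : DirectSum.IsInternal gr) (d : ℤ)
    {N : Type*} [AddCommGroup N] [Module k N] (f : V →ₗ[k] N) :
    ∃ f' : V →ₗ[k] N, (∀ x ∈ gr d, f' x = f x) ∧ ∀ n, n ≠ d → ∀ x ∈ gr n, f' x = 0 := by
  let e : (DirectSum ℤ fun i => gr i) ≃ₗ[k] V :=
    LinearEquiv.ofBijective (DirectSum.coeLinearMap gr) h
  have he : ∀ n (x : gr n), e.symm x.1 = DirectSum.lof k ℤ (fun i => gr i) n x := fun n x => by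
    rw [LinearEquiv.symm_apply_eq]
    exact (DirectSum.coeLinearMap_lof gr n x).symm
  refine ⟨f ∘ₗ (gr d).subtype ∘ₗ DirectSum.component k ℤ (fun i => gr i) d ∘ₗ e.symm.toLinearMap,
    fun x hx => ?_, fun n hn x hx => ?_⟩
  · have := he d ⟨x, hx⟩
    simp only [LinearMap.comp_apply, LinearEquiv.coe_coe]
    rw [this, DirectSum.component.lof_self]; rfl
  · have := he n ⟨x, hx⟩
    simp only [LinearMap.comp_apply, LinearEquiv.coe_coe]
    rw [this, DirectSum.component.of, dif_neg hn, map_zero, map_zero]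

/-- Functionals of some degree separate the vectors of a graded space. -/
theorem eq_zero_of_isDegree {gr : ℤ → Submodule k V} (h : DirectSum.IsInternal gr) {x : V}
    (hx : ∀ d (f : V →ₗ[k] k), IsDegree gr d f → f x = 0) : x = 0 := by
  classical
  choose P hP hP' using fun d => exists_component_map h d (LinearMap.id : V →ₗ[k] V)
  have h1 : ∀ d, P d x = 0 := fun d => by
    rw [← Module.forall_dual_apply_eq_zero_iff k]
    intro f
    exact hx d (f ∘ₗ P d) fun n hn y hy => by rw [LinearMap.comp_apply, hP' d n hn y hy, map_zero]
  have h2 : ∀ y : V, (∀ d, P d y = 0) → ∀ s : Finset ℤ, y ∈ ⨆ d ∈ s, gr d → y = 0 := by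
    intro y hy s
    induction s using Finset.induction_on generalizing y with
    | empty => intro h; simpa using h
    | insert d s hd ih =>
      intro hys
      rw [Finset.iSup_insert] at hys
      obtain ⟨u, hu, w, hw, rfl⟩ := Submodule.mem_sup.mp hys
      have hPw : P d w = 0 := by
        have : ⨆ n ∈ s, gr n ≤ LinearMap.ker (P d) := iSup₂_le fun n hn y hy =>
          hP' d n (fun e => hd (e ▸ hn)) y hy
        exact this hw
      have hu0 : u = 0 := by
        have := hy d
        rwa [map_add, hPw, add_zero, hP d u hu] at this
      rw [hu0, zero_add] at hy ⊢
      exact ih w hy hw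
  have h3 : x ∈ ⨆ d, gr d := h.submodule_iSup_eq_top ▸ Submodule.mem_top
  obtain ⟨s, hs⟩ := Submodule.mem_iSup_iff_exists_finset.mp h3
  exact h2 x h1 s hs

end LinearAlgebra

section WordSpans

variable {k : Type u} [Field k] {V : Type v} [AddCommGroup V] [Module k V] {G : Type w}
  {g : G → ℤ → Module.End k V} {one : V} {D : Module.End k V}

theorem IsGenerating.span_modeWord (hg : IsGenerating g one D) :
    Submodule.span k {x | ∃ l a m, x = modeWord g one l a m} = ⊤ := by
  refine hg.span _ (Submodule.subset_span ⟨0, Fin.elim0, Fin.elim0, rfl⟩) fun a n v hv => ?_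
  induction hv using Submodule.span_induction with
  | mem x h =>
    obtain ⟨l, b, m, rfl⟩ := h
    exact Submodule.subset_span ⟨l + 1, Fin.cons a b, Fin.cons n m, (modeWord_cons _ _ _ _ _ _).symm⟩
  | zero => rw [map_zero]; exact zero_mem _
  | add x y _ _ h1 h2 => rw [map_add]; exact add_mem h1 h2
  | smul c x _ h => rw [map_smul]; exact Submodule.smul_mem _ _ h

/-- The span of all words in the letters of a list. -/
def listSpan (g : G → ℤ → Module.End k V) (one : V) : List G → Submodule k V
  | [] => Submodule.span k {one}
  | a :: L => ⨆ n, (listSpan g one L).map (g a n)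

theorem mode_mem_listSpan {a : G} (n : ℤ) {L : List G} {v : V} (hv : v ∈ listSpan g one L) :
    g a n v ∈ listSpan g one (a :: L) :=
  Submodule.mem_iSup_of_mem n (Submodule.mem_map_of_mem hv)

theorem listSpan_cons_le {a : G} {L : List G} {P : Submodule k V}
    (h : ∀ n, ∀ v ∈ listSpan g one L, g a n v ∈ P) : listSpan g one (a :: L) ≤ P :=
  iSup_le fun n => Submodule.map_le_iff_le_comap.mpr (h n)

theorem span_modeWord_eq_listSpan {l : ℕ} (a : Fin l → G) :
    Submodule.span k (Set.range (modeWord g one l a)) = listSpan g one (List.ofFn a) := by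
  induction l with
  | zero =>
    rw [List.ofFn_zero, listSpan]
    congr 1
    ext x
    simp [modeWord, eq_comm]
  | succ l ih =>
    rw [List.ofFn_succ, listSpan]
    have h := ih (Fin.tail a)
    refine le_antisymm (Submodule.span_le.mpr ?_) (iSup_le fun n => ?_)
    · rintro _ ⟨m, rfl⟩
      refine Submodule.mem_iSup_of_mem (m 0) (Submodule.mem_map_of_mem ?_)
      change _ ∈ listSpan g one (List.ofFn (Fin.tail a))
      rw [← h]
      exact Submodule.subset_span ⟨_, rfl⟩
    · change (listSpan g one (List.ofFn (Fin.tail a))).map _ ≤ _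
      rw [← h, Submodule.map_span, Submodule.span_le]
      rintro _ ⟨_, ⟨m, rfl⟩, rfl⟩
      exact Submodule.subset_span ⟨Fin.cons n m, by simp [modeWord]⟩

theorem IsGenerating.listSpan_swap_le (hg : IsGenerating g one D) (a b : G) (L : List G) :
    listSpan g one (a :: b :: L) ≤ listSpan g one (b :: a :: L) := by
  set T := listSpan g one (b :: a :: L) with hT
  refine listSpan_cons_le fun m => listSpan_cons_le (P := T.comap (g a m)) fun n v hv => ?_
  rw [Submodule.mem_comap, ← Submodule.Quotient.mk_eq_zero, ← Submodule.mkQ_apply]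
  -- Modulo the words beginning with `b` and `a` the products `a(m) b(n) v` are local in `m, n`
  -- and vanish for large `n`.
  obtain ⟨n₀, hn₀⟩ := hg.trunc b v
  have hloc : IsLoc fun m n => T.mkQ (g a m (g b n v)) := by
    have := (hg.loc a b).map (T.mkQ.toAddMonoidHom.comp
      (LinearMap.applyₗ' (M₂ := V) ℕ v).toAddMonoidHom)
    convert this using 3 with m n
    have h0 : T.mkQ (g b n (g a m v)) = 0 := by
      rw [Submodule.mkQ_apply, Submodule.Quotient.mk_eq_zero]
      exact mode_mem_listSpan _ (mode_mem_listSpan _ hv)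
    simp only [AddMonoidHom.comp_apply, LinearMap.toAddMonoidHom_coe, LinearMap.applyₗ'_apply_apply,
      cm, Module.End.mul_apply, map_sub, h0, sub_zero]
  exact congrFun (congrFun (hloc.eq_zero n₀ fun m n hn => by rw [hn₀ n hn, map_zero, map_zero]) m) n

/-- The span of the words in given letters does not depend on the order of the letters. -/
theorem IsGenerating.listSpan_perm (hg : IsGenerating g one D) {L L' : List G} (h : L.Perm L') :
    listSpan g one L = listSpan g one L' := by
  induction h with
  | nil => rfl
  | cons a _ ih => rw [listSpan, listSpan, ih]
  | swap a b L => exact le_antisymm (hg.listSpan_swap_le b a L) (hg.listSpan_swap_le a b L)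
  | trans _ _ h1 h2 => exact h1.trans h2

theorem toMultiset_weight {l : ℕ} (a : Fin l → G) :
    Finsupp.toMultiset (weight a) = (List.ofFn a : Multiset G) := by
  rw [weight, map_sum]
  simp only [Finsupp.toMultiset_single, one_smul]
  induction l with
  | zero => simp
  | succ l ih =>
    rw [Fin.sum_univ_succ, List.ofFn_succ, ← Multiset.cons_coe, ← ih]
    rfl

theorem exists_ofFn (L : List G) : ∃ (l : ℕ) (a : Fin l → G), List.ofFn a = L :=
  ⟨L.length, L.get, List.ofFn_get L⟩

theorem modeWord_mem_listSpan {l : ℕ} (a : Fin l → G) (m : Fin l → ℤ) :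
    modeWord g one l a m ∈ listSpan g one (List.ofFn a) := by
  rw [← span_modeWord_eq_listSpan]; exact Submodule.subset_span ⟨m, rfl⟩

theorem listSpan_invariant {T : Module.End k V} (h1 : T one = 0)
    (h : ∀ a n, ∃ c n' : ℤ, T * g a n - g a n * T = c • g a n') (L : List G) :
    ∀ x ∈ listSpan g one L, T x ∈ listSpan g one L := by
  induction L with
  | nil =>
    intro x hx
    obtain ⟨c, rfl⟩ := Submodule.mem_span_singleton.mp hx
    rw [map_smul, h1, smul_zero]; exact zero_mem _
  | cons a L ih =>
    intro x hx
    refine (listSpan_cons_le (P := (listSpan g one (a :: L)).comap T) fun n v hv => ?_) hx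
    obtain ⟨c, n', hc⟩ := h a n
    have e := LinearMap.congr_fun hc v
    rw [LinearMap.sub_apply, sub_eq_iff_eq_add'] at e
    rw [Submodule.mem_comap]
    refine e.symm ▸ add_mem (mode_mem_listSpan _ (ih v hv)) (zsmul_mem (mode_mem_listSpan _ hv) _)

end WordSpans

/-! ### The graded vertex algebra -/

section Structure

variable {k : Type u} [Field k] {G : Type v} {deg : G → ℤ} {loc : G → G → ℤ}
  {Ω : (l : ℕ) → (Fin l → G) → Submodule k (RatFn k l)}

/-- The homogeneous components of the vertex algebra. -/
def gradedPiece (hΩ : IsVertexCoalgebra deg loc Ω) (d : ℤ) : Submodule k (Space hΩ) :=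
  Module.End.eigenspace (sl₂ hΩ 1) (d : k)

/-- The components of the grading by multisets of letters. -/
def weightPiece (hΩ : IsVertexCoalgebra deg loc Ω) (μ : G →₀ ℕ) : Submodule k (Space hΩ) :=
  ⨅ c, Module.End.eigenspace (count hΩ c) (μ c : k)

variable (hΩ : IsVertexCoalgebra deg loc Ω)

theorem mem_gradedPiece {d : ℤ} {x : Space hΩ} : x ∈ gradedPiece hΩ d ↔ sl₂ hΩ 1 x = d • x := by
  rw [gradedPiece, Module.End.mem_eigenspace_iff, Int.cast_smul_eq_zsmul]

theorem mem_weightPiece {μ : G →₀ ℕ} {x : Space hΩ} :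
    x ∈ weightPiece hΩ μ ↔ ∀ c, count hΩ c x = (μ c : ℤ) • x := by
  simp only [weightPiece, Submodule.mem_iInf, Module.End.mem_eigenspace_iff,
    Nat.cast_smul_eq_nsmul]

theorem degree_mode (a : G) (n : ℤ) : sl₂ hΩ 1 * mode hΩ a n - mode hΩ a n * sl₂ hΩ 1 =
    (deg a - (n + 1)) • mode hΩ a n := by
  have := sl₂_mode hΩ 1 a n
  simpa [sub_sub] using this

theorem special_mode (a : G) (n : ℤ) : sl₂ hΩ 2 * mode hΩ a n - mode hΩ a n * sl₂ hΩ 2 =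
    (2 * deg a - n - 2) • mode hΩ a (n + 1) := by
  have := sl₂_mode hΩ 2 a n
  have e : n + ((2 : Fin 3) : ℕ) - 1 = n + 1 := by norm_num; ring
  rw [e] at this
  simpa using this

theorem count_mode_zsmul (c a : G) (n : ℤ) : count hΩ c * mode hΩ a n - mode hΩ a n * count hΩ c =
    ((Finsupp.single a 1 c : ℕ) - 0 * (n + 1) : ℤ) • mode hΩ a n := by
  rw [count_mode, zero_mul, sub_zero, natCast_zsmul]

theorem isGradedModes_mode : IsGradedModes (mode hΩ) (vac hΩ) (gradedPiece hΩ) deg where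
  loc := mode_isLoc hΩ
  create := (isGenerating hΩ).create
  one_mem := by rw [mem_gradedPiece, sl₂_vac, zero_smul]
  mode_mem a n i x hx := by
    rw [mem_gradedPiece] at hx ⊢
    have := LinearMap.congr_fun (degree_mode hΩ a n) x
    rw [LinearMap.sub_apply, sub_eq_iff_eq_add', Module.End.mul_apply, Module.End.mul_apply, hx,
      map_zsmul, LinearMap.smul_apply, ← add_smul] at this
    rw [this]
    congr 1; ring

theorem modeWord_mem_weightPiece {l : ℕ} (a : Fin l → G) (m : Fin l → ℤ) :
    modeWord (mode hΩ) (vac hΩ) l a m ∈ weightPiece hΩ (weight a) := by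
  rw [mem_weightPiece]
  intro c
  induction l with
  | zero => simp [modeWord, count_vac, weight]
  | succ l ih =>
    have := LinearMap.congr_fun (count_mode hΩ c (a 0) (m 0))
      (modeWord (mode hΩ) (vac hΩ) l (Fin.tail a) (Fin.tail m))
    rw [LinearMap.sub_apply, sub_eq_iff_eq_add', Module.End.mul_apply, Module.End.mul_apply, ih,
      map_zsmul, LinearMap.smul_apply] at this
    have e : weight a = Finsupp.single (a 0) 1 + weight (Fin.tail a) := by
      rw [← weight_cons, Fin.cons_self_tail]
    rw [modeWord, this, e, Finsupp.add_apply, Nat.cast_add, add_smul, add_comm]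
    congr 1
    rw [natCast_zsmul]

theorem count_comm (c c' : G) : Commute (count hΩ c) (count hΩ c') := by
  refine LinearMap.ext fun x => pair_ext fun e => ?_
  have : countOp Ω c' * countOp Ω c = countOp Ω c * countOp Ω c' :=
    LinearMap.ext fun e => families_ext fun l a => smul_comm (weight a c' : k) (weight a c : k) _
  exact congrArg (pair hΩ x) (LinearMap.congr_fun this e)

theorem iSup_gradedPiece : ⨆ d, gradedPiece hΩ d = ⊤ := by
  rw [eq_top_iff, ← (isGenerating hΩ).span_modeWord, Submodule.span_le]
  rintro _ ⟨l, a, m, rfl⟩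
  exact Submodule.mem_iSup_of_mem _ ((isGradedModes_mode hΩ).modeWord_mem a m)

theorem iSup_weightPiece : ⨆ μ, weightPiece hΩ μ = ⊤ := by
  rw [eq_top_iff, ← (isGenerating hΩ).span_modeWord, Submodule.span_le]
  rintro _ ⟨l, a, m, rfl⟩
  exact Submodule.mem_iSup_of_mem _ (modeWord_mem_weightPiece hΩ a m)

/-- The operator `D*` has degree `-1`. -/
theorem degree_special : sl₂ hΩ 1 * sl₂ hΩ 2 - sl₂ hΩ 2 * sl₂ hΩ 1 = -sl₂ hΩ 2 := by
  rw [← sub_eq_zero]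
  refine (isGenerating hΩ).end_eq_zero (by simp [sl₂_vac]) fun a n => ?_
  have hH := degree_mode hΩ a n
  have hH' := degree_mode hΩ a (n + 1)
  have hE := special_mode hΩ a n
  rw [sub_eq_iff_eq_add'] at hH hH' hE
  have e1 : sl₂ hΩ 1 * sl₂ hΩ 2 * mode hΩ a n = mode hΩ a n * (sl₂ hΩ 1 * sl₂ hΩ 2) +
      (deg a - (n + 1)) • (mode hΩ a n * sl₂ hΩ 2) +
      (2 * deg a - n - 2) • (mode hΩ a (n + 1) * sl₂ hΩ 1) +
      ((2 * deg a - n - 2) * (deg a - (n + 1 + 1))) • mode hΩ a (n + 1) := by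
    rw [mul_assoc, hE, mul_add, ← mul_assoc, hH, mul_smul_comm, hH', add_mul, smul_mul_assoc,
      mul_assoc, smul_add, smul_smul]
    abel
  have e2 : sl₂ hΩ 2 * sl₂ hΩ 1 * mode hΩ a n = mode hΩ a n * (sl₂ hΩ 2 * sl₂ hΩ 1) +
      (2 * deg a - n - 2) • (mode hΩ a (n + 1) * sl₂ hΩ 1) +
      (deg a - (n + 1)) • (mode hΩ a n * sl₂ hΩ 2) +
      ((2 * deg a - n - 2) * (deg a - (n + 1))) • mode hΩ a (n + 1) := by
    rw [mul_assoc, hH, mul_add, ← mul_assoc, hE, mul_smul_comm, hE, add_mul, smul_mul_assoc,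
      mul_assoc, smul_add, smul_smul, mul_comm (deg a - (n + 1))]
    abel
  rw [sub_neg_eq_add, add_mul, sub_mul, e1, e2, hE, mul_add (mode hΩ a n), mul_sub (mode hΩ a n)]
  module

theorem special_mem (d : ℤ) {x : Space hΩ} (hx : x ∈ gradedPiece hΩ d) :
    sl₂ hΩ 2 x ∈ gradedPiece hΩ (d - 1) := by
  rw [mem_gradedPiece] at hx ⊢
  have := LinearMap.congr_fun (degree_special hΩ) x
  rw [LinearMap.sub_apply, sub_eq_iff_eq_add', Module.End.mul_apply, Module.End.mul_apply, hx,
    map_zsmul, LinearMap.neg_apply] at this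
  rw [this, sub_smul, one_smul, sub_eq_add_neg]

variable [CharZero k]

theorem iSupIndep_gradedPiece : iSupIndep (gradedPiece hΩ) :=
  (Module.End.eigenspaces_iSupIndep (sl₂ hΩ 1)).comp Int.cast_injective

/-- The span of the words of a given degree. -/
def degreeSpan (d : ℤ) : Submodule k (Space hΩ) :=
  Submodule.span k {x | ∃ l a m, ∑ i : Fin l, (deg (a i) - m i - 1) = d ∧
    x = modeWord (mode hΩ) (vac hΩ) l a m}

/-- The homogeneous components are spanned by words. -/
theorem degreeSpan_eq (d : ℤ) : degreeSpan hΩ d = gradedPiece hΩ d := by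
  refine eq_of_le_of_iSupIndep (p := degreeSpan hΩ) (q := gradedPiece hΩ)
    (fun d => Submodule.span_le.mpr ?_) (iSupIndep_gradedPiece hΩ) ?_ d
  · rintro _ ⟨l, a, m, rfl, rfl⟩
    exact (isGradedModes_mode hΩ).modeWord_mem a m
  · rw [eq_top_iff, ← (isGenerating hΩ).span_modeWord, Submodule.span_le]
    rintro _ ⟨l, a, m, rfl⟩
    exact Submodule.mem_iSup_of_mem (p := degreeSpan hΩ) _
      (Submodule.subset_span ⟨l, a, m, rfl, rfl⟩)

theorem isInternal_gradedPiece : DirectSum.IsInternal (gradedPiece hΩ) :=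
  DirectSum.isInternal_submodule_of_iSupIndep_of_iSup_eq_top (iSupIndep_gradedPiece hΩ)
    (iSup_gradedPiece hΩ)

theorem iSupIndep_weightPiece : iSupIndep (weightPiece hΩ) :=
  iSupIndep_iInf_eigenspace (count_comm hΩ)

theorem listSpan_eq_weightPiece {l : ℕ} (a : Fin l → G) :
    listSpan (mode hΩ) (vac hΩ) (List.ofFn a) = weightPiece hΩ (weight a) := by
  let p : (G →₀ ℕ) → Submodule k (Space hΩ) := fun μ =>
    ⨆ (L : List G) (_ : (L : Multiset G) = Finsupp.toMultiset μ), listSpan (mode hΩ) (vac hΩ) L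
  have hp : p (weight a) = weightPiece hΩ (weight a) := by
    refine eq_of_le_of_iSupIndep (p := p) (fun μ => iSup₂_le fun L hL => ?_)
      (iSupIndep_weightPiece hΩ) ?_ (weight a)
    · obtain ⟨l, b, rfl⟩ := exists_ofFn L
      have : μ = weight b := by
        classical
        apply Multiset.toFinsupp.symm.injective
        exact hL.symm.trans (toMultiset_weight b).symm
      rw [this, ← span_modeWord_eq_listSpan, Submodule.span_le]
      rintro _ ⟨m, rfl⟩
      exact modeWord_mem_weightPiece hΩ b m
    · rw [eq_top_iff, ← (isGenerating hΩ).span_modeWord, Submodule.span_le]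
      rintro _ ⟨l, b, m, rfl⟩
      refine Submodule.mem_iSup_of_mem (weight b) ?_
      exact (le_iSup₂_of_le (List.ofFn b) (toMultiset_weight b).symm le_rfl :
        listSpan (mode hΩ) (vac hΩ) (List.ofFn b) ≤ p (weight b)) (modeWord_mem_listSpan b m)
  rw [← hp]
  refine le_antisymm (le_iSup₂_of_le (List.ofFn a) (toMultiset_weight a).symm le_rfl)
    (iSup₂_le fun L hL => ?_)
  rw [toMultiset_weight, Multiset.coe_eq_coe] at hL
  exact ((isGenerating hΩ).listSpan_perm hL).le

theorem special_locallyNilpotent (x : Space hΩ) : ∃ n : ℕ, (sl₂ hΩ 2)^[n] x = 0 := by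
  have hx : x ∈ Submodule.span k {x | ∃ l a m, x = modeWord (mode hΩ) (vac hΩ) l a m} :=
    (isGenerating hΩ).span_modeWord ▸ Submodule.mem_top
  have key : ∀ (y : Space hΩ) (n n' : ℕ), n ≤ n' → (sl₂ hΩ 2)^[n] y = 0 →
      (sl₂ hΩ 2)^[n'] y = 0 := by
    intro y n n' h hy
    obtain ⟨j, rfl⟩ := Nat.exists_eq_add_of_le' h
    rw [iterate_add_apply, hy, iterate_map_zero]
  induction hx using Submodule.span_induction with
  | mem x h =>
    obtain ⟨l, a, m, rfl⟩ := h
    obtain ⟨d₀, hd₀⟩ := (isGradedModes_mode hΩ).exists_degree_bound a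
    set d := ∑ i, (deg (a i) - m i - 1) with hd
    have hmem : ∀ n : ℕ, (sl₂ hΩ 2)^[n] (modeWord (mode hΩ) (vac hΩ) l a m) ∈
        gradedPiece hΩ (d - n) ∧ (sl₂ hΩ 2)^[n] (modeWord (mode hΩ) (vac hΩ) l a m) ∈
        listSpan (mode hΩ) (vac hΩ) (List.ofFn a) := by
      intro n
      induction n with
      | zero =>
        refine ⟨?_, modeWord_mem_listSpan a m⟩
        simpa [hd] using (isGradedModes_mode hΩ).modeWord_mem a m
      | succ n ih =>
        rw [iterate_succ_apply']
        refine ⟨?_, listSpan_invariant (sl₂_vac hΩ 2)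
          (fun a n => ⟨_, _, special_mode hΩ a n⟩) _ _ ih.2⟩
        have := special_mem hΩ _ ih.1
        rwa [sub_sub, ← Nat.cast_succ] at this
    refine ⟨(d - d₀ + 1).toNat, ?_⟩
    obtain ⟨h1, h2⟩ := hmem (d - d₀ + 1).toNat
    refine eq_zero_of_isDegree (isInternal_gradedPiece hΩ) fun n f hf => ?_
    by_cases hn : d - (d - d₀ + 1).toNat = n
    · rw [← span_modeWord_eq_listSpan] at h2
      have : Submodule.span k (Set.range (modeWord (mode hΩ) (vac hΩ) l a)) ≤ LinearMap.ker f := by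
        rw [Submodule.span_le]
        rintro _ ⟨m, rfl⟩
        exact hd₀ n (by omega) f hf m
      exact this h2
    · exact hf _ hn _ h1
  | zero => exact ⟨0, rfl⟩
  | add x y _ _ hx hy =>
    obtain ⟨n, hn⟩ := hx
    obtain ⟨n', hn'⟩ := hy
    refine ⟨max n n', ?_⟩
    rw [iterate_map_add, key x _ _ (le_max_left _ _) hn, key y _ _ (le_max_right _ _) hn', add_zero]
  | smul c x _ hx =>
    obtain ⟨n, hn⟩ := hx
    exact ⟨n, by rw [← Module.End.pow_apply, map_smul, Module.End.pow_apply, hn, smul_zero]⟩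

/-- The vertex algebra of a vertex coalgebra of rational functions. -/
def vertexAlgebraOf : Sl2VertexAlgebra k (Space hΩ) where
  toVertexAlgebra := (isGenerating hΩ).vertexAlgebra
  gr := gradedPiece hΩ
  isInternal := isInternal_gradedPiece hΩ
  one_mem := (isGradedModes_mode hΩ).one_mem
  prod_mem i j n a b ha hb := by
    rw [mem_gradedPiece] at *
    rw [(isGenerating hΩ).grading_eigen (c := deg) (ε := 1) (sl₂_vac hΩ 1)
      (by simpa using degree_mode hΩ) ha hb]
    congr 1; ring
  Dstar := sl₂ hΩ 2
  Dstar_mem d a ha := special_mem hΩ d ha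
  Dstar_locallyNilpotent := special_locallyNilpotent hΩ
  Dstar_one := sl₂_vac hΩ 2
  Dstar_prod d m a b ha := by
    rw [mem_gradedPiece] at ha
    exact (isGenerating hΩ).special_prod (sl₂_vac hΩ 1) (degree_mode hΩ) (sl₂_vac hΩ 2)
      (special_mode hΩ) ha m b

/-- The vector `a = a(-1)1` given by a letter. -/
def letter (a : G) : Space hΩ := mode hΩ a (-1) (vac hΩ)

theorem prod_letter (a : G) (n : ℤ) : (vertexAlgebraOf hΩ).prod n (letter hΩ a) = mode hΩ a n :=
  (isGenerating hΩ).prod_gen a n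

theorem one_vertexAlgebraOf : (vertexAlgebraOf hΩ).one = vac hΩ := rfl

theorem word_letter {l : ℕ} (a : Fin l → G) (m : Fin l → ℤ) :
    (vertexAlgebraOf hΩ).word l (letter hΩ ∘ a) m = modeWord (mode hΩ) (vac hΩ) l a m := by
  rw [word_comp]
  simp only [prod_letter, one_vertexAlgebraOf]

theorem isMinimalGenerators_letter : (vertexAlgebraOf hΩ).IsMinimalGenerators deg (letter hΩ) where
  mem_gr a := by
    have := (isGradedModes_mode hΩ).mode_mem a (-1) 0 _ (isGradedModes_mode hΩ).one_mem
    have e : deg a + 0 - (-1) - 1 = deg a := by ring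
    rwa [e] at this
  Dstar_eq_zero a := by
    have := LinearMap.congr_fun (special_mode hΩ a (-1)) (vac hΩ)
    rw [LinearMap.sub_apply, sub_eq_iff_eq_add', Module.End.mul_apply, Module.End.mul_apply,
      sl₂_vac, map_zero, zero_add, LinearMap.smul_apply,
      (isGenerating hΩ).create a (-1 + 1) (by norm_num), smul_zero] at this
    exact this
  generates W hW h1 h := (isGenerating hΩ).span W h1 fun a n v hv => by
    rw [← prod_letter]
    exact h n _ v (hW ⟨a, rfl⟩) hv

theorem wordSpace_letter {l : ℕ} (a : Fin l → G) :
    (vertexAlgebraOf hΩ).wordSpace (letter hΩ ∘ a) = weightPiece hΩ (weight a) := by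
  rw [← listSpan_eq_weightPiece, ← span_modeWord_eq_listSpan, VertexAlgebra.wordSpace]
  congr 2
  funext m
  exact word_letter hΩ a m

theorem prod_mem_weightPiece (μ ν : G →₀ ℕ) (n : ℤ) {x y : Space hΩ} (hx : x ∈ weightPiece hΩ μ)
    (hy : y ∈ weightPiece hΩ ν) : (vertexAlgebraOf hΩ).prod n x y ∈ weightPiece hΩ (μ + ν) := by
  rw [mem_weightPiece] at *
  intro c
  have := (isGenerating hΩ).grading_eigen (ε := 0) (c := fun a => (Finsupp.single a 1 c : ℕ))
    (count_vac hΩ c) (count_mode_zsmul hΩ c) (hx c) (hy c) n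
  refine this.trans ?_
  congr 1
  simp

end Structure

/-! ### Correlation functions of the vertex algebra -/

section Correlation

variable {k : Type u} [Field k] {G : Type v} {deg : G → ℤ} {loc : G → G → ℤ}
  {Ω : (l : ℕ) → (Fin l → G) → Submodule k (RatFn k l)}

/-- The functions in `Ω^a` are invariant under all permutations which fix the word `a`. -/
theorem IsVertexCoalgebra.permAct_eq_self (hΩ : IsVertexCoalgebra deg loc Ω) {l : ℕ}
    {a : Fin l → G} {α : RatFn k l} (hα : α ∈ Ω l a) (τ : Equiv.Perm (Fin l)) (h : a ∘ τ = a) :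
    permAct k τ α = α := by
  induction hn : τ.support.card using Nat.strong_induction_on generalizing τ with
  | _ n ih =>
    by_cases h1 : τ = 1
    · rw [h1, permAct_one]
    · obtain ⟨x, hx⟩ : ∃ x, τ x ≠ x := by
        by_contra! h'
        exact h1 (Equiv.ext h')
      have hax : a x = a (τ x) := (congrFun h x).symm
      have hs : ∀ y, a (Equiv.swap x (τ x) y) = a y := by
        intro y
        rcases Equiv.swap_apply_eq_iff.mp (rfl : Equiv.swap x (τ x) y = _) with h'
        by_cases hyx : y = x
        · rw [hyx, Equiv.swap_apply_left, hax]
        · by_cases hyt : y = τ x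
          · rw [hyt, Equiv.swap_apply_right, hax]
          · rw [Equiv.swap_apply_of_ne_of_ne hyx hyt]
      have h2 := ih _ (hn ▸ Equiv.Perm.card_support_swap_mul hx) (Equiv.swap x (τ x) * τ)
        (funext fun y => (hs (τ y)).trans (congrFun h y)) rfl
      rw [permAct_mul] at h2
      rw [← permAct_swap_swap x (τ x) (permAct k τ α), h2, hΩ.symm a x (τ x) hax α hα]

/-- The function on words of length `l` which extends `α` equivariantly from `a` to its orbit, by
zero outside of the orbit. -/
def orbitFn {l : ℕ} (a : Fin l → G) (α : RatFn k l) (b : Fin l → G) : RatFn k l :=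
  open scoped Classical in
  if h : ∃ τ : Equiv.Perm (Fin l), a ∘ τ = b then permAct k h.choose⁻¹ α else 0

theorem orbitFn_of_not {l : ℕ} {a : Fin l → G} {α : RatFn k l} {b : Fin l → G}
    (h : ¬ ∃ τ : Equiv.Perm (Fin l), a ∘ τ = b) : orbitFn a α b = 0 := dif_neg h

theorem orbitFn_comp (hΩ : IsVertexCoalgebra deg loc Ω) {l : ℕ}
    {a : Fin l → G} {α : RatFn k l} (hα : α ∈ Ω l a) (τ : Equiv.Perm (Fin l)) :
    orbitFn a α (a ∘ τ) = permAct k τ⁻¹ α := by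
  have h : ∃ τ' : Equiv.Perm (Fin l), a ∘ τ' = a ∘ τ := ⟨τ, rfl⟩
  rw [orbitFn, dif_pos h]
  have h1 := hΩ.permAct_eq_self hα (h.choose * τ⁻¹) (by
    funext x
    have := congrFun h.choose_spec (τ⁻¹ x)
    simpa using this)
  rw [permAct_mul] at h1
  nth_rewrite 1 [← h1]
  rw [permAct_inv_apply]

/-- Every homogeneous function in `Ω` is a member of an equivariant family supported on the orbit of
its word. Evaluation at this family is a functional on the vertex algebra whose correlation
function is the given function. -/
theorem exists_family (hΩ : IsVertexCoalgebra deg loc Ω) {l : ℕ}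
    {a : Fin l → G} {α : RatFn k l} (hα : α ∈ Ω l a) {d : ℤ} (hd : euler α = d • α) :
    ∃ e : families Ω, e.1 l a = α ∧ (∀ b, (∀ τ : Equiv.Perm (Fin l), a ∘ τ ≠ b) → e.1 l b = 0) ∧
      sl₂Op hΩ 1 e = (d + ∑ i, deg (a i)) • e := by
  have hmem : (Pi.single l (orbitFn a α) : (l : ℕ) → (Fin l → G) → RatFn k l) ∈ families Ω := by
    intro l' b
    by_cases hl : l' = l
    · subst hl
      rw [Pi.single_eq_same]
      by_cases h : ∃ τ : Equiv.Perm (Fin l'), a ∘ τ = b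
      · obtain ⟨τ, rfl⟩ := h
        refine ⟨?_, fun σ => ?_⟩
        · rw [orbitFn_comp hΩ hα]
          have h1 := hα
          rw [hΩ.perm a τ] at h1
          obtain ⟨β, hβ, rfl⟩ := h1
          rw [AlgHom.toLinearMap_apply, permAct_inv_apply]
          exact hβ
        · have := orbitFn_comp hΩ hα (τ * σ)
          rw [Equiv.Perm.coe_mul, ← comp_assoc] at this
          rw [this, orbitFn_comp hΩ hα, ← permAct_mul, mul_inv_rev, mul_inv_cancel_left]
      · refine ⟨?_, fun σ => ?_⟩
        · rw [orbitFn_of_not h]; exact zero_mem _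
        · rw [orbitFn_of_not h, orbitFn_of_not, map_zero]
          rintro ⟨τ, hτ⟩
          refine h ⟨τ * σ⁻¹, ?_⟩
          rw [Equiv.Perm.coe_mul, ← comp_assoc, hτ, comp_assoc, ← Equiv.Perm.coe_mul,
            mul_inv_cancel, Equiv.Perm.coe_one, comp_id]
    · rw [Pi.single_eq_of_ne hl]
      exact ⟨zero_mem _, fun σ => map_zero _⟩
  have h1 : ∀ b, (Pi.single l (orbitFn a α) : (l : ℕ) → (Fin l → G) → RatFn k l) l b =
      orbitFn a α b := fun b => by rw [Pi.single_eq_same]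
  refine ⟨⟨_, hmem⟩, ?_, fun b hb => ?_, families_ext fun l' b => ?_⟩
  · have := orbitFn_comp hΩ hα 1
    rw [Equiv.Perm.coe_one, comp_id, inv_one, permAct_one] at this
    exact (h1 a).trans this
  · exact (h1 b).trans (orbitFn_of_not fun ⟨τ, hτ⟩ => hb τ hτ)
  · rw [sl₂Op_apply]
    change wop 1 (deg ∘ b) _ = (d + ∑ i, deg (a i)) • _
    by_cases hl : l' = l
    · subst hl
      simp only [h1]
      by_cases h : ∃ τ : Equiv.Perm (Fin l'), a ∘ τ = b
      · obtain ⟨τ, rfl⟩ := h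
        have h2 : euler (permAct k τ⁻¹ α) = d • permAct k τ⁻¹ α := by
          have := permAct_wop 1 0 τ⁻¹ α
          rw [Pi.zero_comp, ← euler_eq_wop, ← euler_eq_wop, hd, map_zsmul] at this
          exact this.symm
        rw [orbitFn_comp hΩ hα, wop_one, h2, ← add_smul,
          ← Equiv.sum_comp τ fun i => deg (a i)]
        rfl
      · rw [orbitFn_of_not h, map_zero]
        exact (zsmul_zero _).symm
    · have h0 : (Pi.single l (orbitFn a α) : (l : ℕ) → (Fin l → G) → RatFn k l) l' b = 0 := by
        rw [Pi.single_eq_of_ne hl]; rfl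
      simp only [h0, map_zero]
      exact (zsmul_zero _).symm

variable (hΩ : IsVertexCoalgebra deg loc Ω)

theorem letter_eq (a : G) :
    letter hΩ a = modeWord (mode hΩ) (vac hΩ) 1 (fun _ => a) (fun _ => -1) := rfl

/-- The functions in `Ω^a` of degree `d`. -/
def homogPart (Ω : (l : ℕ) → (Fin l → G) → Submodule k (RatFn k l)) {l : ℕ} (a : Fin l → G)
    (d : ℤ) : Submodule k (RatFn k l) :=
  Ω l a ⊓ LinearMap.eqLocus (wop 1 0) (d • LinearMap.id)

theorem mem_homogPart {l : ℕ} {a : Fin l → G} {d : ℤ} {α : RatFn k l} :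
    α ∈ homogPart Ω a d ↔ α ∈ Ω l a ∧ euler α = d • α := by
  rw [euler_eq_wop]; rfl

variable [CharZero k]

theorem letter_injective : Injective (letter hΩ) := by
  intro a b hab
  by_contra hne
  obtain ⟨e, he, he', -⟩ := exists_family hΩ (a := fun _ : Fin 1 => a) (α := ofPoly 1)
    (d := 0) ((hΩ.single _ _).mpr ⟨1, rfl⟩) (by
      simpa using euler_ofPoly (MvPolynomial.isHomogeneous_one (Fin 1) k))
  have h := congrArg (fun x => pair hΩ x e) hab
  simp only [letter_eq, modeWord_apply] at h
  rw [he, he' (fun _ => b) (fun τ hτ => hne (congrFun hτ 0)), map_zero, coeffIterL_succ,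
    show ofPoly (1 : MvPolynomial (Fin 1) k) = emb 1 from
      (map_one (algebraMap _ _)).trans (map_one emb).symm, coeffL_emb, if_pos rfl] at h
  have h1 : coeffIterL k (Fin.tail fun _ : Fin 1 => (-1 : ℤ)) (1 : RatFn k 0) = 1 :=
    map_one constValue
  rw [h1] at h
  exact one_ne_zero h

/-- Homogeneous functions in `Ω` are correlation functions. -/
theorem isCorrFn_of_isHomog {l : ℕ} {a : Fin l → G} {α : RatFn k l} (hα : α ∈ Ω l a) {d : ℤ}
    (hd : IsHomog d α) : α ∈ (vertexAlgebraOf hΩ).corrSpace (letter hΩ ∘ a) := by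
  obtain ⟨e, he, -, heH⟩ := exists_family hΩ hα hd.euler
  refine Submodule.subset_span ⟨d + ∑ i, deg (a i), (pair hΩ).flip e, fun n hn x hx => ?_,
    hΩ.le_Phi a α hα, fun m => ?_⟩
  · have h1 : sl₂ hΩ 1 x = n • x := (mem_gradedPiece hΩ).mp hx
    have h2 : pair hΩ (sl₂ hΩ 1 x) e = pair hΩ x (sl₂Op hΩ 1 e) := rfl
    rw [h1, heH, map_zsmul, map_zsmul, LinearMap.smul_apply, ← sub_eq_zero, ← sub_smul] at h2
    exact (smul_eq_zero.mp h2).resolve_left (sub_ne_zero.mpr hn)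
  · rw [word_letter, LinearMap.flip_apply, modeWord_apply, he]
    rfl

theorem finite_homogPart (hΩ : IsVertexCoalgebra deg loc Ω) {l : ℕ} (a : Fin l → G) (d : ℤ) : Module.Finite k (homogPart Ω a d) := by
  refine finite_of_bounded_poles _
    (Finset.univ.sup fun x : Fin l × Fin l => (loc (a x.1) (a x.2)).toNat) d fun α hα => ?_
  obtain ⟨h1, h2⟩ := mem_homogPart.mp hα
  refine ⟨exists_ofPoly_of_ordGe (hΩ.le_Phi a α h1) fun i j hij =>
    ⟨loc (a i) (a j), (Int.self_le_toNat _).trans ?_, hΩ.ord_ge a α h1 i j hij⟩, h2⟩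
  exact_mod_cast Finset.le_sup
    (f := fun x : Fin l × Fin l => (loc (a x.1) (a x.2)).toNat) (Finset.mem_univ (i, j))

/-- The correlation functions of the vertex algebra belong to `Ω`. -/
theorem mem_of_isCorrFn {l : ℕ} {a : Fin l → G} {α : RatFn k l} {d : ℤ} {f : Space hΩ →ₗ[k] k}
    (hf : IsDegree (gradedPiece hΩ) d f)
    (hα : (vertexAlgebraOf hΩ).IsCorrFn f (letter hΩ ∘ a) α) : α ∈ Ω l a := by
  set d' : ℤ := d - ∑ i, deg (a i) with hd'
  have hfin := finite_homogPart hΩ a d'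
  set S := homogPart Ω a d'
  have hword : ∀ m, coeffIterL k m α = f (modeWord (mode hΩ) (vac hΩ) l a m) := fun m => by
    rw [← word_letter]; exact hα.2 m
  -- Words whose degree differs from `d` are replaced by zero, which does not change their image
  -- under `f`.
  let w : (Fin l → ℤ) → Space hΩ := fun m =>
    if d' + ∑ i, (m i + 1) = 0 then modeWord (mode hΩ) (vac hΩ) l a m else 0
  have hw : ∀ m, f (w m) = f (modeWord (mode hΩ) (vac hΩ) l a m) := by
    intro m
    by_cases h : d' + ∑ i, (m i + 1) = 0
    · simp only [w, if_pos h]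
    · simp only [w, if_neg h, map_zero]
      refine (hf _ (fun h' => h ?_) _ ((isGradedModes_mode hΩ).modeWord_mem a m)).symm
      rw [hd', ← h', ← Finset.sum_sub_distrib, ← Finset.sum_add_distrib]
      exact Finset.sum_eq_zero fun i _ => by ring
  let P : ((Fin l → ℤ) →₀ k) →ₗ[k] Space hΩ := Finsupp.linearCombination k w
  let Q : ((Fin l → ℤ) →₀ k) →ₗ[k] Module.Dual k S :=
    Finsupp.linearCombination k fun m => coeffIterL k m ∘ₗ S.subtype
  -- The functional `f` is well defined on the coefficient functionals of the functions in `Ω^a`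
  -- of the appropriate degree.
  have hker : f ∘ₗ P ∈ (LinearMap.ker Q).dualAnnihilator := by
    rw [Submodule.mem_dualAnnihilator]
    intro c hc
    have hQ : ∀ β ∈ S, c.sum (fun m r => r * coeffIterL k m β) = 0 := fun β hβ => by
      have := LinearMap.congr_fun (LinearMap.mem_ker.mp hc) ⟨β, hβ⟩
      rw [Finsupp.linearCombination_apply, Finsupp.sum, LinearMap.sum_apply] at this
      exact this
    have hP : P c = 0 := by
      refine pair_ext fun e => ?_
      let T : (Fin l → ℤ) → RatFn k l →ₗ[k] k := fun m =>
        if d' + ∑ i, (m i + 1) = 0 then coeffIterL k m else 0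
      let R : RatFn k l →ₗ[k] k := ∑ m ∈ c.support, c m • T m
      have h1 : pair hΩ (P c) e = R (e.1 l a) := by
        have h2 : ∀ m, pair hΩ (w m) e = T m (e.1 l a) := fun m => by
          simp only [w, T]
          split_ifs
          · exact modeWord_apply hΩ a m e
          · rw [map_zero]; rfl
        simp only [P, R, Finsupp.linearCombination_apply, Finsupp.sum, map_sum, map_smul,
          LinearMap.sum_apply, LinearMap.smul_apply, h2]
      have key : Ω l a ≤ LinearMap.ker R := by
        rw [hΩ.graded, Submodule.span_le]
        rintro β ⟨hβ, d'', hβd⟩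
        rw [SetLike.mem_coe, LinearMap.mem_ker, LinearMap.sum_apply]
        by_cases hdd : d'' = d'
        · rw [← hQ β (mem_homogPart.mpr ⟨hβ, hdd ▸ hβd.euler⟩)]
          refine Finset.sum_congr rfl fun m _ => ?_
          rw [LinearMap.smul_apply, smul_eq_mul]
          simp only [T]
          split_ifs with h
          · rfl
          · rw [coeffIterL_eq_zero hβd.euler (hdd ▸ h)]; rfl
        · refine Finset.sum_eq_zero fun m _ => ?_
          rw [LinearMap.smul_apply]
          simp only [T]
          split_ifs with h
          · rw [coeffIterL_eq_zero hβd.euler (by omega), smul_zero]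
          · rw [LinearMap.zero_apply, smul_zero]
      rw [h1, map_zero, LinearMap.zero_apply]
      exact key (e.2 l a).1
    rw [LinearMap.comp_apply, hP, map_zero]
  rw [← LinearMap.range_dualMap_eq_dualAnnihilator_ker] at hker
  obtain ⟨h, hh⟩ := hker
  set s : S := (Module.evalEquiv k S).symm h with hs
  have hs' : ∀ φ : Module.Dual k S, h φ = φ s := fun φ => by
    rw [hs]; exact (Module.apply_evalEquiv_symm_apply k S φ h).symm
  have : α = s.1 := coeffIterL_ext fun m => by
    have h1 := LinearMap.congr_fun hh (Finsupp.single m 1)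
    rw [LinearMap.dualMap_apply, LinearMap.comp_apply, hs'] at h1
    simp only [Q, P, Finsupp.linearCombination_single, one_smul, hw] at h1
    rw [hword, ← h1]
    rfl
  rw [this]
  exact (mem_homogPart.mp s.2).1

/-- The correlation functions of the vertex algebra of `Ω` are the functions in `Ω`. -/
theorem corrSpace_letter {l : ℕ} (a : Fin l → G) :
    (vertexAlgebraOf hΩ).corrSpace (letter hΩ ∘ a) = Ω l a := by
  refine le_antisymm (Submodule.span_le.mpr ?_) ?_
  · rintro α ⟨d, f, hf, hα⟩
    exact mem_of_isCorrFn hΩ hf hα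
  · rw [hΩ.graded, Submodule.span_le]
    rintro α ⟨hα, d, hd⟩
    exact isCorrFn_of_isHomog hΩ hα hd

end Correlation

/-! ### The universal property -/

section Universal

variable {k : Type u} [Field k] {G : Type v} {deg : G → ℤ} {loc : G → G → ℤ}
  {Ω : (l : ℕ) → (Fin l → G) → Submodule k (RatFn k l)}
  {U : Type w} [AddCommGroup U] [Module k U] {B : Sl2VertexAlgebra k U} {j : G → U}

/-- The modes of the images of the letters. -/
def imageMode (B : Sl2VertexAlgebra k U) (j : G → U) (a : G) (n : ℤ) : Module.End k U :=
  B.prod n (j a)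

/-- A homogeneous functional on `U` defines a family of functions in `Ω`. -/
theorem exists_corrFamily (hj : B.IsMinimalGenerators deg j)
    (hB : ∀ (l : ℕ) (a : Fin l → G), B.corrSpace (j ∘ a) ≤ Ω l a) {d : ℤ} {f : U →ₗ[k] k}
    (hf : IsDegree B.gr d f) : ∃ e : families Ω, ∀ l a m,
      coeffIterL k m (e.1 l a) = f (modeWord (imageMode B j) B.one l a m) := by
  have hg : IsGradedModes (imageMode B j) B.one B.gr deg := B.isGradedModes hj.mem_gr
  choose x hxΦ hx using fun (l : ℕ) (a : Fin l → G) => hg.exists_corrFn a hf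
  refine ⟨⟨x, fun l a => ⟨hB l a (Submodule.subset_span ⟨d, f, hf, hxΦ l a, fun m => ?_⟩),
    fun σ => hg.corrFn_perm σ a hf (hx l a) (hx l (a ∘ σ))⟩⟩, hx⟩
  rw [word_comp]
  exact hx l a m

/-- The linear map to `U` which is defined by its values on words. -/
theorem exists_wordMap (hΩ : IsVertexCoalgebra deg loc Ω) (hj : B.IsMinimalGenerators deg j)
    (hB : ∀ (l : ℕ) (a : Fin l → G), B.corrSpace (j ∘ a) ≤ Ω l a) :
    ∃ φ : Space hΩ →ₗ[k] U, ∀ l a m,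
      φ (modeWord (mode hΩ) (vac hΩ) l a m) = modeWord (imageMode B j) B.one l a m := by
  let κ := Σ l : ℕ, (Fin l → G) × (Fin l → ℤ)
  let w : κ → Space hΩ := fun x => modeWord (mode hΩ) (vac hΩ) x.1 x.2.1 x.2.2
  let w' : κ → U := fun x => modeWord (imageMode B j) B.one x.1 x.2.1 x.2.2
  let P : (κ →₀ k) →ₗ[k] Space hΩ := Finsupp.linearCombination k w
  let P' : (κ →₀ k) →ₗ[k] U := Finsupp.linearCombination k w'
  have hP : LinearMap.range P = ⊤ := by
    rw [Finsupp.range_linearCombination, eq_top_iff, ← (isGenerating hΩ).span_modeWord]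
    refine Submodule.span_mono ?_
    rintro _ ⟨l, a, m, rfl⟩
    exact ⟨⟨l, a, m⟩, rfl⟩
  -- Linear relations between words in the vertex algebra hold in `U`, since they are detected by
  -- homogeneous functionals.
  have hker : ∀ c, P c = 0 → P' c = 0 := by
    intro c hc
    refine eq_zero_of_isDegree B.isInternal fun d f hf => ?_
    obtain ⟨e, he⟩ := exists_corrFamily hj hB hf
    have h1 : f (P' c) = pair hΩ (P c) e := by
      simp only [P, P', Finsupp.linearCombination_apply, Finsupp.sum, map_sum, map_smul,
        LinearMap.sum_apply, LinearMap.smul_apply]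
      refine Finset.sum_congr rfl fun x _ => ?_
      rw [modeWord_apply, he]
    rw [h1, hc, map_zero, LinearMap.zero_apply]
  obtain ⟨s, hs⟩ := P.exists_rightInverse_of_surjective hP
  refine ⟨P' ∘ₗ s, fun l a m => ?_⟩
  have h1 : P (Finsupp.single ⟨l, a, m⟩ 1) = modeWord (mode hΩ) (vac hΩ) l a m := by
    simp [P, w]
  have h2 : P' (Finsupp.single ⟨l, a, m⟩ 1) = modeWord (imageMode B j) B.one l a m := by
    simp [P', w']
  rw [← h1, ← h2, LinearMap.comp_apply, ← sub_eq_zero, ← map_sub]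
  refine hker _ ?_
  rw [map_sub, ← LinearMap.comp_apply, hs, LinearMap.id_apply, sub_self]

variable [CharZero k]

/-- A linear map which intertwines the modes of the letters is a homomorphism. -/
theorem isHom_of_intertwines (hΩ : IsVertexCoalgebra deg loc Ω) (hj : B.IsMinimalGenerators deg j)
    {φ : Space hΩ →ₗ[k] U} (h1 : φ (vac hΩ) = B.one)
    (hφ : ∀ a n x, φ (mode hΩ a n x) = B.prod n (j a) (φ x)) :
    (vertexAlgebraOf hΩ).IsHom B φ := by
  have hg := isGenerating hΩ
  have hB1 : ∀ n x, 0 ≤ n → B.prod n x B.one = 0 := fun n x hn => B.prod_one_of_nonneg n hn x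
  -- The map commutes with the translation operators.
  have hD : ∀ x, φ (sl₂ hΩ 0 x) = B.prod (-2) (φ x) B.one := by
    let P : Submodule k (Space hΩ) := LinearMap.eqLocus (φ ∘ₗ sl₂ hΩ 0)
      ((LinearMap.flip (B.prod (-2)) B.one) ∘ₗ φ)
    have hP : P = ⊤ := hg.span P (by
      rw [LinearMap.mem_eqLocus, LinearMap.comp_apply, sl₂_vac, map_zero, LinearMap.comp_apply, h1,
        LinearMap.flip_apply, B.one_prod, if_neg (by norm_num)]) fun a n v hv => by
      rw [LinearMap.mem_eqLocus, LinearMap.comp_apply, LinearMap.comp_apply,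
        LinearMap.flip_apply] at hv ⊢
      have e := LinearMap.congr_fun (hg.D_comm a n) v
      rw [LinearMap.sub_apply, sub_eq_iff_eq_add', Module.End.mul_apply, Module.End.mul_apply,
        LinearMap.smul_apply] at e
      rw [e, map_add, hφ, hv, map_zsmul, hφ, hφ, B.D_prod, B.prod_D, add_comm]
    intro x
    exact (hP ▸ Submodule.mem_top : x ∈ P)
  have hprod : ∀ n x y, φ ((vertexAlgebraOf hΩ).prod n x y) = B.prod n (φ x) (φ y) := by
    intro n x y
    have hX := hg.prod_isField x
    have hA : ∀ n, (vertexAlgebraOf hΩ).prod n = hg.vertexAlgebra.prod n := fun _ => rfl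
    have h0 := goddard hg (fun a m => B.prod m (j a))
      (fun n => φ ∘ₗ (vertexAlgebraOf hΩ).prod n x - B.prod n (φ x) ∘ₗ φ) (fun a => by
        have l1 := (hX.loc a).map (AddMonoidHom.mk' (fun T : Module.End k (Space hΩ) => φ ∘ₗ T)
          fun _ _ => LinearMap.comp_add _ _ _)
        have l2 := (B.isLoc (φ x) (j a)).map (AddMonoidHom.mk'
          (fun T : Module.End k U => T ∘ₗ φ) fun _ _ => LinearMap.add_comp _ _ _)
        convert l1.sub l2 using 1
        funext n m
        refine LinearMap.ext fun v => ?_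
        simp only [cm, LinearMap.sub_apply, LinearMap.comp_apply, Pi.sub_apply,
          AddMonoidHom.mk'_apply, Module.End.mul_apply, map_sub, hφ, hA]
        abel) (fun n => by
        rw [LinearMap.sub_apply, LinearMap.comp_apply, LinearMap.comp_apply, h1, sub_eq_zero]
        by_cases hn : 0 ≤ n
        · rw [hB1 n _ hn]
          exact (congrArg φ (hX.create n hn)).trans (map_zero φ)
        · obtain ⟨p, rfl⟩ : ∃ p : ℕ, n = -(p : ℤ) - 1 := ⟨(-n - 1).toNat, by omega⟩
          rw [B.prod_one]
          refine (congrArg φ (hX.apply_one hg.D_one p)).trans ?_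
          rw [map_smul]
          congr 1
          exact (show Semiconj φ (sl₂ hΩ 0) fun y => B.prod (-2) y B.one from hD).iterate_right p x)
    exact sub_eq_zero.mp (LinearMap.congr_fun (congrFun h0 n) y)
  have hword : ∀ l a m, φ (modeWord (mode hΩ) (vac hΩ) l a m) =
      modeWord (imageMode B j) B.one l a m := by
    intro l
    induction l with
    | zero => intro a m; exact h1
    | succ l ih => intro a m; rw [modeWord, hφ, ih]; rfl
  refine ⟨h1, hprod, fun d x hx => ?_, fun x => ?_⟩
  · have hgm : IsGradedModes (imageMode B j) B.one B.gr deg := B.isGradedModes hj.mem_gr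
    have h2 : degreeSpan hΩ d ≤ (B.gr d).comap φ := by
      rw [degreeSpan, Submodule.span_le]
      rintro _ ⟨l, a, m, rfl, rfl⟩
      rw [SetLike.mem_coe, Submodule.mem_comap, hword]
      exact hgm.modeWord_mem a m
    exact h2 (degreeSpan_eq hΩ d ▸ hx)
  · let P : Submodule k (Space hΩ) := LinearMap.eqLocus (φ ∘ₗ sl₂ hΩ 2) (B.Dstar ∘ₗ φ)
    have hP : P = ⊤ := hg.span P (by
      rw [LinearMap.mem_eqLocus, LinearMap.comp_apply, sl₂_vac, map_zero, LinearMap.comp_apply, h1,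
        B.Dstar_one]) fun a n v hv => by
      rw [LinearMap.mem_eqLocus, LinearMap.comp_apply, LinearMap.comp_apply] at hv ⊢
      have e := LinearMap.congr_fun (special_mode hΩ a n) v
      rw [LinearMap.sub_apply, sub_eq_iff_eq_add', Module.End.mul_apply, Module.End.mul_apply,
        LinearMap.smul_apply] at e
      have e' := B.Dstar_prod (deg a) n (j a) (φ v) (hj.mem_gr a)
      rw [sub_eq_iff_eq_add', hj.Dstar_eq_zero, map_zero, LinearMap.zero_apply, add_zero] at e'
      rw [e, map_add, hφ, hv, map_zsmul, hφ, hφ, e']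
    exact (hP ▸ Submodule.mem_top : x ∈ P)

/-- The universal property: a vertex algebra whose correlation functions lie in `Ω` receives a
unique homomorphism which is compatible with the letters. -/
theorem existsUnique_hom (hΩ : IsVertexCoalgebra deg loc Ω) (hj : B.IsMinimalGenerators deg j)
    (hB : ∀ (l : ℕ) (a : Fin l → G), B.corrSpace (j ∘ a) ≤ Ω l a) :
    ∃! φ : Space hΩ →ₗ[k] U, (vertexAlgebraOf hΩ).IsHom B φ ∧ ∀ a, φ (letter hΩ a) = j a := by
  obtain ⟨φ, hφ⟩ := exists_wordMap hΩ hj hB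
  have h1 : φ (vac hΩ) = B.one := hφ 0 Fin.elim0 Fin.elim0
  have h2 : ∀ a n x, φ (mode hΩ a n x) = B.prod n (j a) (φ x) := by
    intro a n x
    have hx : x ∈ Submodule.span k {x | ∃ l a m, x = modeWord (mode hΩ) (vac hΩ) l a m} :=
      (isGenerating hΩ).span_modeWord ▸ Submodule.mem_top
    induction hx using Submodule.span_induction with
    | mem x h =>
      obtain ⟨l, b, m, rfl⟩ := h
      rw [← modeWord_cons, hφ, hφ, modeWord_cons]; rfl
    | zero => simp only [map_zero]
    | add x y _ _ hx hy => simp only [map_add, hx, hy]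
    | smul c x _ hx => simp only [map_smul, hx]
  refine ⟨φ, ⟨isHom_of_intertwines hΩ hj h1 h2, fun a => ?_⟩, fun ψ hψ => ?_⟩
  · rw [letter, h2, h1]
    simpa using B.prod_one 0 (j a)
  · refine LinearMap.ext fun x => ?_
    have hP : LinearMap.eqLocus ψ φ = ⊤ := (isGenerating hΩ).span _
      (hψ.1.map_one.trans h1.symm) fun a n v hv => by
        rw [LinearMap.mem_eqLocus] at hv ⊢
        rw [h2, ← hv, ← hψ.2 a, ← hψ.1.map_prod, prod_letter]
    exact (hP ▸ Submodule.mem_top : x ∈ LinearMap.eqLocus ψ φ)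

end Universal

end VertexCoalg

end

theorem theorem4p1 {k : Type u} [Field k] [CharZero k] {G : Type v} (deg : G → ℤ)
    (loc : G → G → ℤ) (Ω : (l : ℕ) → (Fin l → G) → Submodule k (VertexCoalg.RatFn k l))
    (hΩ : VertexCoalg.IsVertexCoalgebra deg loc Ω) :
    ∃ (V : Type (max u v)) (_ : AddCommGroup V) (_ : Module k V)
      (A : VertexCoalg.Sl2VertexAlgebra k V) (ι : G → V) (W : (G →₀ ℕ) → Submodule k V),
      Function.Injective ι ∧
      A.IsMinimalGenerators deg ι ∧
      (∀ (l : ℕ) (a : Fin l → G), A.corrSpace (ι ∘ a) = Ω l a) ∧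
      -- `V` is the direct sum of the subspaces `V^μ`, and this is a grading of the vertex algebra
      (iSupIndep W ∧ ⨆ μ, W μ = ⊤) ∧
      (∀ (l : ℕ) (a : Fin l → G), A.wordSpace (ι ∘ a) = W (VertexCoalg.weight a)) ∧
      (∀ (μ ν : G →₀ ℕ) (n : ℤ), ∀ x ∈ W μ, ∀ y ∈ W ν, A.prod n x y ∈ W (μ + ν)) ∧
      -- the universal property
      (∀ (U : Type w) [AddCommGroup U] [Module k U] (B : VertexCoalg.Sl2VertexAlgebra k U)
        (j : G → U), B.IsMinimalGenerators deg j →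
        (∀ (l : ℕ) (a : Fin l → G), B.corrSpace (j ∘ a) ≤ Ω l a) →
        ∃! φ : V →ₗ[k] U, A.IsHom B φ ∧ ∀ a, φ (ι a) = j a) :=
  ⟨VertexCoalg.Space hΩ, inferInstance, inferInstance, VertexCoalg.vertexAlgebraOf hΩ,
    VertexCoalg.letter hΩ, VertexCoalg.weightPiece hΩ, VertexCoalg.letter_injective hΩ,
    VertexCoalg.isMinimalGenerators_letter hΩ, fun _ a => VertexCoalg.corrSpace_letter hΩ a,
    ⟨VertexCoalg.iSupIndep_weightPiece hΩ, VertexCoalg.iSup_weightPiece hΩ⟩,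
    fun _ a => VertexCoalg.wordSpace_letter hΩ a,
    fun μ ν n _ hx _ hy => VertexCoalg.prod_mem_weightPiece hΩ μ ν n hx hy,
    fun _ _ _ _ _ hj hB => VertexCoalg.existsUnique_hom hΩ hj hB⟩
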